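/- All manifolds (Hausdorff, second countable, without boundary) and vector bundles (of finite rank) are smooth and real. A Lie algebroid is a vector bundle $q\colon A\to M$ with an $\mathbb R$-Lie bracket $[\cdot,\cdot]$ on its space $\Gamma(A)$ of smooth sections and a vector bundle morphism $\rho\colon A\to TM$ over $\mathrm{id}_M$ such that $[a,f b]=f[a,b]+\rho(a)(f)\,b$ for $a,b\in\Gamma(A)$, $f\in C^\infty(M)$. It restricts to a Lie algebroid $A|_U=q^{-1}(U)\to U$ for each open $U\subseteq M$. A morphism of Lie algebroids $(\Phi,\varphi)$ from $A\to M$ to $B\to N$ is a vector bundle morphism $\Phi\colon A\to B$ over a smooth map $\varphi\colon M\to N$ with $\rho_B\circ\Phi=T\varphi\circ\rho_A$ and such that, whenever $a_1,a_2\in\Gamma(A)$ satisfy $\Phi\circ a_1=\sum_i f^1_i\,(b^1_i\circ\varphi)$ and $\Phi\circ a_2=\sum_j f^2_j\,(b^2_j\circ\varphi)$ (finite sums) with $b^1_i,b^2_j\in\Gamma(B)$ and $f^1_i,f^2_j\in C^\infty(M)$, \[\Phi\circ[a_1,a_2]=\sum_{i,j}f^1_if^2_j\,([b^1_i,b^2_j]\circ\varphi)+\sum_j\rho_A(a_1)(f^2_j)\,(b^2_j\circ\varphi)-\sum_i\rho_A(a_2)(f^1_i)\,(b^1_i\circ\varphi).\]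 An isomorphism of Lie algebroids is such a morphism that has an inverse morphism. **Proposition 7.2.** Let $q\colon A\to M$ be a Lie algebroid and let $D$ be a derivation of the Lie algebroid $A$ with symbol $X\in\mathfrak X(M)$: an $\mathbb R$-linear map $D\colon\Gamma(A)\to\Gamma(A)$ with $D(fa)=fD(a)+X(f)a$ and $D[a,b]=[Da,b]+[a,Db]$ for all $a,b\in\Gamma(A)$ and $f\in C^\infty(M)$. Let $\widehat D$ be the corresponding linear vector field on the manifold $A$, \[\widehat D(e_m)=T_me(X(m))+\left.\tfrac{d}{dt}\right|_{t=0}\bigl(e_m-t\,D(e)(m)\bigr)\] for $e_m\in A$ over $m\in M$ and any $e\in\Gamma(A)$ with $e(m)=e_m$. Let $\xi\colon\Omega\to M$, $\Omega\subseteq\mathbb R\times M$, be the (maximal) flow of $X$, let $\Xi$ be the (maximal) flow of $\widehat D$, and set $M_t=\{x\in M\mid (t,x)\in\Omega\}$. Then $\Xi$ is defined exactly on $\widetilde\Omega=\{(t,e)\in\mathbb R\times A\mid (t,q(e))\in\Omega\}$, and for each $t\in\mathbb R$ the sets $M_t$ and $M_{-t}$ are open and the map \[\Xi_t\colon q^{-1}(M_t)\to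 q^{-1}(M_{-t})\] is an isomorphism of Lie algebroids over the diffeomorphism $\xi_t\colon M_t\to M_{-t}$. -/

import Mathlib

open Bundle Set Filter
open scoped Manifold ContDiff Topology

noncomputable section

/-! ### Flows of vector fields on manifolds -/

section Flow

variable {E : Type*} [NormedAddCommGroup E] [NormedSpace ℝ E]
  {H : Type*} [TopologicalSpace H] {I : ModelWithCorners ℝ E H}
  {M : Type*} [TopologicalSpace M] [ChartedSpace H M]

/-- `FlowsTo V t x y`: there is an integral curve of `V`, defined on an open interval that contains
`0` and `t`, which is at `x` at time `0` and at `y` at time `t`. -/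
def FlowsTo (V : (x : M) → TangentSpace I x) (t : ℝ) (x y : M) : Prop :=
  ∃ (γ : ℝ → M) (a b : ℝ), (0 : ℝ) ∈ Ioo a b ∧ t ∈ Ioo a b ∧
    IsMIntegralCurveOn γ V (Ioo a b) ∧ γ 0 = x ∧ γ t = y

/-- The (maximal) flow domain `Ω ⊆ ℝ × M` of a vector field: the pairs `(t, x)` such that the
integral curve of `V` through `x` exists until time `t`. -/
def flowDomain (V : (x : M) → TangentSpace I x) : Set (ℝ × M) :=
  {p | ∃ y, FlowsTo V p.1 p.2 y}

/-- The set `M_t` of the points from which the flow of `V` exists until time `t`. -/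
def flowDomainAt (V : (x : M) → TangentSpace I x) (t : ℝ) : Set M :=
  {x | (t, x) ∈ flowDomain V}

open Classical in
/-- The time-`t` flow map of `V`. On `M_t` its value at `x` is the position at time `t` of the
integral curve starting at `x`; outside of `M_t` the value is irrelevant. -/
def flow (V : (x : M) → TangentSpace I x) (t : ℝ) (x : M) : M :=
  if h : ∃ y, FlowsTo V t x y then h.choose else x

end Flow

/-! ### Smooth sections, derivations of vector bundles and linear vector fields -/

section VectorBundles

variable {E : Type*} [NormedAddCommGroup E] [NormedSpace ℝ E]
  {M : Type*} [TopologicalSpace M] [ChartedSpace E M]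
  {F : Type*} [NormedAddCommGroup F] [NormedSpace ℝ F]
  {A : M → Type*} [TopologicalSpace (TotalSpace F A)] [∀ x, TopologicalSpace (A x)]
  [∀ x, AddCommGroup (A x)] [∀ x, Module ℝ (A x)] [FiberBundle F A] [VectorBundle ℝ F A]

/-- The derivative `v(f)` of a real-valued function `f` along a tangent vector `v` at `x`. -/
def dirDeriv (f : M → ℝ) (x : M) (v : TangentSpace 𝓘(ℝ, E) x) : ℝ :=
  mfderiv 𝓘(ℝ, E) 𝓘(ℝ, ℝ) f x v

variable (E F) in
/-- The (possibly only locally meaningful) section `s` is smooth on the set `U`. -/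
def SmoothSectionOn (s : (x : M) → A x) (U : Set M) : Prop :=
  ContMDiffOn 𝓘(ℝ, E) (𝓘(ℝ, E).prod 𝓘(ℝ, F)) ∞ (fun x => (⟨x, s x⟩ : TotalSpace F A)) U

/-- The product `f • s` of a smooth function and a smooth section. -/
def smulSection (f : C^∞⟮𝓘(ℝ, E), M; ℝ⟯) (s : Cₛ^∞⟮𝓘(ℝ, E); F, A⟯) : Cₛ^∞⟮𝓘(ℝ, E); F, A⟯ :=
  ⟨fun x => f x • s x, f.contMDiff.smul_section s.contMDiff⟩

section Extension

variable [FiniteDimensional ℝ E] [T2Space M] [IsManifold 𝓘(ℝ, E) ∞ M]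

/-- A section that is smooth near `x` agrees near `x` with a globally defined smooth section. -/
theorem exists_section_eventuallyEq {s : (x : M) → A x} {U : Set M} {x : M} (hU : U ∈ 𝓝 x)
    (hs : SmoothSectionOn E F s U) :
    ∃ s' : Cₛ^∞⟮𝓘(ℝ, E); F, A⟯, ∀ᶠ y in 𝓝 x, s' y = s y := by
  obtain ⟨V, hVU, hV, hxV⟩ := mem_nhds_iff.1 hU
  obtain ⟨ψ, hψ, -⟩ := (SmoothBumpFunction.nhds_basis_support (I := 𝓘(ℝ, E))
    (hV.mem_nhds hxV)).mem_iff.1 (hV.mem_nhds hxV)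
  refine ⟨⟨fun y => ψ y • s y, ?_⟩, ?_⟩
  · exact ContMDiffOn.smul_section_of_tsupport ψ.contMDiff.contMDiffOn hV hψ (hs.mono hVU)
  · filter_upwards [ψ.eventuallyEq_one] with y hy
    change ψ y • s y = s y
    rw [hy]; simp

variable [ContMDiffVectorBundle ∞ F A 𝓘(ℝ, E)]

/-- There is a smooth section through every point of the total space of a vector bundle. -/
theorem exists_section_through (e : TotalSpace F A) :
    ∃ s : Cₛ^∞⟮𝓘(ℝ, E); F, A⟯, s e.1 = e.2 := by
  obtain ⟨U, hU, hs⟩ := FiberBundle.exists_contMDiffOn_extend (k := ∞) 𝓘(ℝ, E) F e.2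
  obtain ⟨s, h⟩ := exists_section_eventuallyEq hU hs
  exact ⟨s, by simpa using h.self_of_nhds⟩

end Extension

variable (E F A) in
/-- A linear derivation of the vector bundle `A`: an `ℝ`-linear operator `D` on smooth sections
together with a smooth vector field `X` (its symbol) such that `D (f a) = f D a + X(f) a`. -/
structure LinearDerivation [IsManifold 𝓘(ℝ, E) ∞ M] where
  toLinearMap : Cₛ^∞⟮𝓘(ℝ, E); F, A⟯ →ₗ[ℝ] Cₛ^∞⟮𝓘(ℝ, E); F, A⟯
  symbol : Cₛ^∞⟮𝓘(ℝ, E); E, (TangentSpace 𝓘(ℝ, E) : M → Type _)⟯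
  leibniz : ∀ (f : C^∞⟮𝓘(ℝ, E), M; ℝ⟯) (a : Cₛ^∞⟮𝓘(ℝ, E); F, A⟯) (x : M),
    toLinearMap (smulSection f a) x = f x • toLinearMap a x + dirDeriv f x (symbol x) • a x

/-- For a section `s` through `e`, the tangent vector
`T s (X(m)) + d/dt|₀ (e - t (D s)(m))` at `e`, where `m` is the base point of `e`. -/
def LinearDerivation.liftAlong [IsManifold 𝓘(ℝ, E) ∞ M] (D : LinearDerivation E F A)
    (e : TotalSpace F A) (s : Cₛ^∞⟮𝓘(ℝ, E); F, A⟯) :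
    TangentSpace (𝓘(ℝ, E).prod 𝓘(ℝ, F)) e :=
  let horizontal : E × F :=
    mfderiv 𝓘(ℝ, E) (𝓘(ℝ, E).prod 𝓘(ℝ, F)) (fun x => (⟨x, s x⟩ : TotalSpace F A)) e.1
      (D.symbol e.1)
  let vertical : E × F :=
    mfderiv 𝓘(ℝ, ℝ) (𝓘(ℝ, E).prod 𝓘(ℝ, F))
      (fun t : ℝ => (⟨e.1, e.2 - t • D.toLinearMap s e.1⟩ : TotalSpace F A)) 0 (1 : ℝ)
  (horizontal + vertical : E × F)

/-- The linear vector field on the total space of `A` that corresponds to a linear derivation `D`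
with symbol `X`: at `e` over `m` it is `T s (X(m)) + d/dt|₀ (e - t (D s)(m))`, where `s` is any
smooth section with `s m = e`. -/
def LinearDerivation.hat [FiniteDimensional ℝ E] [T2Space M] [IsManifold 𝓘(ℝ, E) ∞ M]
    [ContMDiffVectorBundle ∞ F A 𝓘(ℝ, E)] (D : LinearDerivation E F A) (e : TotalSpace F A) :
    TangentSpace (𝓘(ℝ, E).prod 𝓘(ℝ, F)) e :=
  D.liftAlong e (exists_section_through e).choose

end VectorBundles

/-! ### Lie algebroids -/

section LieAlgebroids

variable {E : Type*} [NormedAddCommGroup E] [NormedSpace ℝ E]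
  {M : Type*} [TopologicalSpace M] [ChartedSpace E M] [IsManifold 𝓘(ℝ, E) ∞ M]
  {F : Type*} [NormedAddCommGroup F] [NormedSpace ℝ F]
  {A : M → Type*} [TopologicalSpace (TotalSpace F A)] [∀ x, TopologicalSpace (A x)]
  [∀ x, AddCommGroup (A x)] [∀ x, Module ℝ (A x)] [FiberBundle F A] [VectorBundle ℝ F A]

variable (E F A) in
/-- A Lie algebroid structure on the smooth vector bundle `A → M`: a real Lie bracket on the space
of smooth sections, and a smooth vector bundle morphism `A → TM` over the identity (the anchor),
related by the Leibniz rule. -/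
structure LieAlgebroid where
  anchor : (x : M) → A x →ₗ[ℝ] TangentSpace 𝓘(ℝ, E) x
  contMDiff_anchor : ContMDiff (𝓘(ℝ, E).prod 𝓘(ℝ, F)) (𝓘(ℝ, E).prod 𝓘(ℝ, E)) ∞
    (fun e : TotalSpace F A => (⟨e.1, anchor e.1 e.2⟩ : TangentBundle 𝓘(ℝ, E) M))
  bracket : Cₛ^∞⟮𝓘(ℝ, E); F, A⟯ →ₗ[ℝ] Cₛ^∞⟮𝓘(ℝ, E); F, A⟯ →ₗ[ℝ] Cₛ^∞⟮𝓘(ℝ, E); F, A⟯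
  bracket_self : ∀ a, bracket a a = 0
  jacobi : ∀ a b c, bracket a (bracket b c) = bracket (bracket a b) c + bracket b (bracket a c)
  leibniz : ∀ (a : Cₛ^∞⟮𝓘(ℝ, E); F, A⟯) (f : C^∞⟮𝓘(ℝ, E), M; ℝ⟯) (b : Cₛ^∞⟮𝓘(ℝ, E); F, A⟯) (x : M),
    bracket a (smulSection f b) x = f x • bracket a b x + dirDeriv f x (anchor x (a x)) • b x

namespace LieAlgebroid

/-- The derivation `D` of the vector bundle `A` is a derivation of the Lie algebroid `A`:
`D [b, c] = [D b, c] + [b, D c]`. -/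
def IsDerivation (L : LieAlgebroid E F A) (D : LinearDerivation E F A) : Prop :=
  ∀ b c, D.toLinearMap (L.bracket b c) =
    L.bracket (D.toLinearMap b) c + L.bracket b (D.toLinearMap c)

open Classical in
/-- The bracket at `x` of two local sections `a`, `b` of `A` that are smooth near `x`, in the
restriction of the Lie algebroid to an open neighbourhood of `x`. The bracket is a local operation,
so this is `[a', b'] x` for any global sections `a'`, `b'` that agree with `a`, `b` near `x`
(see `localBracket_eq`; such sections exist by `exists_section_eventuallyEq`). -/
def localBracket (L : LieAlgebroid E F A) (a b : (x : M) → A x) (x : M) : A x :=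
  if h : (∃ a' : Cₛ^∞⟮𝓘(ℝ, E); F, A⟯, ∀ᶠ y in 𝓝 x, a' y = a y) ∧
      ∃ b' : Cₛ^∞⟮𝓘(ℝ, E); F, A⟯, ∀ᶠ y in 𝓝 x, b' y = b y
  then L.bracket h.1.choose h.2.choose x else 0

section Locality

variable [FiniteDimensional ℝ E] [T2Space M]

/-- The bracket of a Lie algebroid is a local operation, in its second argument. -/
theorem bracket_congr_right (L : LieAlgebroid E F A) (a : Cₛ^∞⟮𝓘(ℝ, E); F, A⟯)
    {b b' : Cₛ^∞⟮𝓘(ℝ, E); F, A⟯} {x : M} (h : ∀ᶠ y in 𝓝 x, b y = b' y) :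
    L.bracket a b x = L.bracket a b' x := by
  obtain ⟨V, hV, hVo, hxV⟩ := mem_nhds_iff.1 h
  obtain ⟨ψ, hψ, -⟩ := (SmoothBumpFunction.nhds_basis_support (I := 𝓘(ℝ, E))
    (hVo.mem_nhds hxV)).mem_iff.1 (hVo.mem_nhds hxV)
  let f : C^∞⟮𝓘(ℝ, E), M; ℝ⟯ := ⟨ψ, ψ.contMDiff⟩
  have hf : f x = 1 := ψ.eq_one
  have hbb : b x = b' x := h.self_of_nhds
  have key : smulSection f b = smulSection f b' := by
    ext y
    change ψ y • b y = ψ y • b' y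
    by_cases hy : y ∈ V
    · rw [show b y = b' y from hV hy]
    · have : ψ y = 0 := by
        by_contra h0
        exact hy (hψ (subset_tsupport _ h0))
      rw [this, zero_smul, zero_smul]
  have h1 := L.leibniz a f b x
  have h2 := L.leibniz a f b' x
  rw [key, h2, hf, hbb, one_smul, one_smul] at h1
  exact (add_right_cancel h1).symm

/-- The bracket of a Lie algebroid is a local operation. -/
theorem bracket_congr (L : LieAlgebroid E F A) {a a' b b' : Cₛ^∞⟮𝓘(ℝ, E); F, A⟯} {x : M}
    (ha : ∀ᶠ y in 𝓝 x, a y = a' y) (hb : ∀ᶠ y in 𝓝 x, b y = b' y) :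
    L.bracket a b x = L.bracket a' b' x := by
  have skew : ∀ c d : Cₛ^∞⟮𝓘(ℝ, E); F, A⟯, L.bracket c d = -L.bracket d c := by
    intro c d
    have h := L.bracket_self (c + d)
    simp only [map_add, LinearMap.add_apply, L.bracket_self, zero_add, add_zero] at h
    exact eq_neg_of_add_eq_zero_right h
  rw [L.bracket_congr_right a hb, skew a b', skew a' b']
  change -(L.bracket b' a x) = -(L.bracket b' a' x)
  rw [L.bracket_congr_right b' ha]

/-- The local bracket can be computed with any global sections that extend the given germs. -/
theorem localBracket_eq (L : LieAlgebroid E F A) {a b : (x : M) → A x} {x : M}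
    {a' b' : Cₛ^∞⟮𝓘(ℝ, E); F, A⟯} (ha : ∀ᶠ y in 𝓝 x, a' y = a y)
    (hb : ∀ᶠ y in 𝓝 x, b' y = b y) : L.localBracket a b x = L.bracket a' b' x := by
  have h : (∃ a' : Cₛ^∞⟮𝓘(ℝ, E); F, A⟯, ∀ᶠ y in 𝓝 x, a' y = a y) ∧
      ∃ b' : Cₛ^∞⟮𝓘(ℝ, E); F, A⟯, ∀ᶠ y in 𝓝 x, b' y = b y := ⟨⟨a', ha⟩, ⟨b', hb⟩⟩
  rw [localBracket, dif_pos h]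
  refine L.bracket_congr ?_ ?_
  · filter_upwards [h.1.choose_spec, ha] with y h1 h2
    rw [h1, h2]
  · filter_upwards [h.2.choose_spec, hb] with y h1 h2
    rw [h1, h2]

end Locality

end LieAlgebroid

/-! ### Morphisms and isomorphisms between restrictions of Lie algebroids to open sets -/

section Morphisms

variable {E' : Type*} [NormedAddCommGroup E'] [NormedSpace ℝ E']
  {N : Type*} [TopologicalSpace N] [ChartedSpace E' N] [IsManifold 𝓘(ℝ, E') ∞ N]
  {F' : Type*} [NormedAddCommGroup F'] [NormedSpace ℝ F']
  {B : N → Type*} [TopologicalSpace (TotalSpace F' B)] [∀ x, TopologicalSpace (B x)]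
  [∀ x, AddCommGroup (B x)] [∀ x, Module ℝ (B x)] [FiberBundle F' B] [VectorBundle ℝ F' B]

variable (E E') in
/-- `Φ` restricts to a smooth vector bundle morphism `A|_U → B|_V` over the smooth map
`φ : U → V`, where `U` and `V` are open. Values of `Φ` and `φ` outside of `q⁻¹(U)` and `U` are
irrelevant. -/
structure IsVectorBundleMorphismOn (U : Set M) (V : Set N)
    (Φ : TotalSpace F A → TotalSpace F' B) (φ : M → N) : Prop where
  isOpen_source : IsOpen U
  isOpen_target : IsOpen V
  mapsTo : MapsTo φ U V
  contMDiffOn_base : ContMDiffOn 𝓘(ℝ, E) 𝓘(ℝ, E') ∞ φ U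
  contMDiffOn_total :
    ContMDiffOn (𝓘(ℝ, E).prod 𝓘(ℝ, F)) (𝓘(ℝ, E').prod 𝓘(ℝ, F')) ∞ Φ {e | e.1 ∈ U}
  fiberwise_linear : ∀ x ∈ U, ∃ T : A x →ₗ[ℝ] B (φ x), ∀ v : A x, Φ ⟨x, v⟩ = ⟨φ x, T v⟩

/-- `(Φ, φ)` restricts to a morphism of Lie algebroids `A|_U → B|_V`, where `U` and `V` are open:
it is a vector bundle morphism, it is compatible with the anchors, and for all sections `a₁, a₂` of
`A|_U` such that `Φ ∘ a₁ = ∑ᵢ f₁ᵢ (b₁ᵢ ∘ φ)` and `Φ ∘ a₂ = ∑ⱼ f₂ⱼ (b₂ⱼ ∘ φ)` with sections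
`b₁ᵢ, b₂ⱼ` of `B|_V` and smooth functions `f₁ᵢ, f₂ⱼ` on `U`,
`Φ ∘ [a₁, a₂] = ∑ᵢⱼ f₁ᵢ f₂ⱼ ([b₁ᵢ, b₂ⱼ] ∘ φ) + ∑ⱼ ρ(a₁)(f₂ⱼ) (b₂ⱼ ∘ φ) - ∑ᵢ ρ(a₂)(f₁ᵢ) (b₁ᵢ ∘ φ)`. -/
structure LieAlgebroid.IsMorphismOn (LA : LieAlgebroid E F A) (LB : LieAlgebroid E' F' B)
    (U : Set M) (V : Set N) (Φ : TotalSpace F A → TotalSpace F' B) (φ : M → N) : Prop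
    extends IsVectorBundleMorphismOn E E' U V Φ φ where
  anchor_comp : ∀ x ∈ U, ∀ v : A x,
    (⟨(Φ ⟨x, v⟩).1, LB.anchor _ (Φ ⟨x, v⟩).2⟩ : TangentBundle 𝓘(ℝ, E') N) =
      ⟨φ x, mfderiv 𝓘(ℝ, E) 𝓘(ℝ, E') φ x (LA.anchor x v)⟩
  bracket_comp : ∀ (a₁ a₂ : (x : M) → A x), SmoothSectionOn E F a₁ U → SmoothSectionOn E F a₂ U →
    ∀ (n₁ n₂ : ℕ) (f₁ : Fin n₁ → M → ℝ) (f₂ : Fin n₂ → M → ℝ)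
      (b₁ : Fin n₁ → (y : N) → B y) (b₂ : Fin n₂ → (y : N) → B y),
    (∀ i, ContMDiffOn 𝓘(ℝ, E) 𝓘(ℝ, ℝ) ∞ (f₁ i) U) →
    (∀ j, ContMDiffOn 𝓘(ℝ, E) 𝓘(ℝ, ℝ) ∞ (f₂ j) U) →
    (∀ i, SmoothSectionOn E' F' (b₁ i) V) → (∀ j, SmoothSectionOn E' F' (b₂ j) V) →
    (∀ x ∈ U, Φ ⟨x, a₁ x⟩ = ⟨φ x, ∑ i, f₁ i x • b₁ i (φ x)⟩) →
    (∀ x ∈ U, Φ ⟨x, a₂ x⟩ = ⟨φ x, ∑ j, f₂ j x • b₂ j (φ x)⟩) →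
    ∀ x ∈ U, Φ ⟨x, LA.localBracket a₁ a₂ x⟩ =
      ⟨φ x, ∑ i, ∑ j, (f₁ i x * f₂ j x) • LB.localBracket (b₁ i) (b₂ j) (φ x)
        + ∑ j, dirDeriv (f₂ j) x (LA.anchor x (a₁ x)) • b₂ j (φ x)
        - ∑ i, dirDeriv (f₁ i) x (LA.anchor x (a₂ x)) • b₁ i (φ x)⟩

/-- `(Φ, φ)` restricts to an isomorphism of Lie algebroids `A|_U → B|_V` over the diffeomorphism
`φ : U → V`: it is a morphism of Lie algebroids with an inverse morphism of Lie algebroids. -/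
def LieAlgebroid.IsIsomorphismOn (LA : LieAlgebroid E F A) (LB : LieAlgebroid E' F' B)
    (U : Set M) (V : Set N) (Φ : TotalSpace F A → TotalSpace F' B) (φ : M → N) : Prop :=
  LA.IsMorphismOn LB U V Φ φ ∧
    ∃ (Ψ : TotalSpace F' B → TotalSpace F A) (ψ : N → M), LB.IsMorphismOn LA V U Ψ ψ ∧
      (∀ x ∈ U, ψ (φ x) = x) ∧ (∀ y ∈ V, φ (ψ y) = y) ∧
      (∀ e : TotalSpace F A, e.1 ∈ U → Ψ (Φ e) = e) ∧
      (∀ e : TotalSpace F' B, e.1 ∈ V → Φ (Ψ e) = e)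

end Morphisms

end LieAlgebroids

end

/-!
# The flow of a derivation of a Lie algebroid

Write `X` for the symbol of the derivation `D` and `D.hat` for its linear vector field. In a chart
of the base and a trivialization of the bundle, `D` is given by `D a = da(X) + Δ a` with a field `Δ`
of endomorphisms of the fibre, and `D.hat` is the vector field `(y, v) ↦ (X(y), -Δ(y) v)`: the
choice of a section in the definition of `D.hat` cancels (`mfderiv_coordTotal_hat`). Its flow is
therefore `(y, v) ↦ (φ_t y, T_t(y) v)`, where `φ` is the flow of `X` and `T` is the parallel
transport of a linear equation along the integral curves of `X`. In particular it is fibrewise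
linear over `φ`.

For small times, everything takes place in one chart (`CoordModel`). The flow and its spatial
derivative solve ordinary differential equations; smooth dependence on initial values, which also
provides the variational equation, is proved in `exists_local_flow` by inverting the map
`u ↦ u - ε ∫ Z(u)` on the Banach space of curves. Compatibility of the flow with the anchor and the
bracket means that certain defects vanish. The Leibniz rule of `D` for the bracket, evaluated on
constant sections and on sections with linear coefficients (`CoordModel.IsDerivation.anc_eq`,
`CoordModel.IsDerivation.brk_eq`), shows that these defects solve linear differential equations with
initial value zero (`CoordModel.IsLocalFlow.fderiv_anc`, `CoordModel.IsLocalFlow.fibre_brk`).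

The passage to arbitrary times rests on `FlowsTo.propagate`: a property of pairs (time, point) that
holds for small times and is inherited by concatenations holds along all integral curves. It is
applied to existence, smoothness and fibrewise linearity of the flow
(`LinearDerivation.IsRegularAt`), then to the compatibility with anchor and bracket
(`compatibleAt`).
The latter is formulated with sections that are related by the flow near a point; concatenation
works because sections can be pushed forward along the flow (`exists_relatedAt`). Since the flow of
`D.hat` lives over that of `X` as long as the latter exists, the two flow domains correspond to each
other, and the flow at time `-t` is the inverse morphism.

The general bracket condition, for decompositions `Φ ∘ a = ∑ᵢ fᵢ (bᵢ ∘ φ)`, reduces to related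
sections: the functions `fᵢ` are pushed forward along the flow, so that `a` is related to a
combination of the `bᵢ` on the target, and the bracket of two such combinations is given by the
Leibniz rule (`LieAlgebroid.bracket_sum_sum`).
-/

noncomputable section

/-! ### Smooth dependence of solutions of ordinary differential equations on initial values -/

section Superposition

variable {K : Type*} [TopologicalSpace K] [CompactSpace K]

variable {L G G' : Type*} [NormedAddCommGroup L] [NormedSpace ℝ L]
  [NormedAddCommGroup G] [NormedSpace ℝ G] [NormedAddCommGroup G'] [NormedSpace ℝ G']

variable (K) in
/-- A bounded bilinear map, applied pointwise to continuous functions on a compact space. -/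
def pointwiseCLM (B : L →L[ℝ] G →L[ℝ] G') : C(K, L) →L[ℝ] C(K, G) →L[ℝ] C(K, G') :=
  LinearMap.mkContinuous₂
    (LinearMap.mk₂ ℝ
      (fun (T : C(K, L)) (h : C(K, G)) =>
        (⟨fun k => B (T k) (h k), B.continuous₂.comp (T.continuous.prodMk h.continuous)⟩ :
          C(K, G')))
      (fun _ _ _ => by ext; simp; rfl) (fun _ _ _ => by ext; simp; rfl)
      (fun _ _ _ => by ext; simp; rfl) (fun _ _ _ => by ext; simp; rfl)) ‖B‖
    (fun T h => by
      rw [ContinuousMap.norm_le _ (by positivity)]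
      intro k
      refine (B.le_opNorm₂ _ _).trans ?_
      gcongr
      · exact T.norm_coe_le_norm k
      · exact h.norm_coe_le_norm k)

@[simp]
theorem pointwiseCLM_apply (B : L →L[ℝ] G →L[ℝ] G') (T : C(K, L)) (h : C(K, G)) (k : K) :
    pointwiseCLM K B T h k = B (T k) (h k) := rfl

/-- Superposition with a `C¹` function is differentiable for the topology of uniform convergence.
The uniformity needed for the remainder estimate is the continuity of superposition with the
derivative. The derivative of `f` is given as `x ↦ B (f' x)` with values in the image of a fixed
continuous linear map. -/
theorem hasFDerivAt_continuousMap_comp (B : L →L[ℝ] G →L[ℝ] G')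
    (f : C(G, G')) (f' : C(G, L)) (hf : ∀ x, HasFDerivAt f (B (f' x)) x) (γ : C(K, G)) :
    HasFDerivAt (fun γ : C(K, G) => f.comp γ) (pointwiseCLM K B (f'.comp γ)) γ := by
  rw [hasFDerivAt_iff_isLittleO_nhds_zero, Asymptotics.isLittleO_iff]
  intro c hc
  have hcont : Continuous fun η : C(K, G) => f'.comp η := ContinuousMap.continuous_postcomp f'
  have hc' : 0 < c / (‖B‖ + 1) := by positivity
  obtain ⟨δ, hδ, hball⟩ := Metric.continuousAt_iff.1 (hcont.continuousAt (x := γ)) _ hc'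
  filter_upwards [Metric.ball_mem_nhds (0 : C(K, G)) hδ] with h hh
  rw [mem_ball_zero_iff] at hh
  rw [ContinuousMap.norm_le _ (by positivity)]
  intro k
  have key : ‖f (γ k + h k) - f (γ k) - B (f' (γ k)) (γ k + h k - γ k)‖
      ≤ c * ‖γ k + h k - γ k‖ := by
    refine (convex_segment (γ k) (γ k + h k)).norm_image_sub_le_of_norm_hasFDerivWithin_le'
      (f' := fun x => B (f' x)) (fun x _ => (hf x).hasFDerivWithinAt) ?_
      (left_mem_segment ℝ _ _) (right_mem_segment ℝ _ _)
    intro z hz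
    rw [segment_eq_image'] at hz
    obtain ⟨θ, hθ, rfl⟩ := hz
    have h1 : dist (γ + θ • h) γ < δ := by
      rw [dist_eq_norm, add_sub_cancel_left, norm_smul, Real.norm_of_nonneg hθ.1]
      exact (mul_le_of_le_one_left (norm_nonneg _) hθ.2).trans_lt hh
    have h2 := hball h1
    rw [dist_eq_norm] at h2
    have h3 := ((f'.comp (γ + θ • h) - f'.comp γ).norm_coe_le_norm k).trans h2.le
    have h4 : ‖f' (γ k + θ • h k) - f' (γ k)‖ ≤ c / (‖B‖ + 1) := by simpa using h3
    rw [← map_sub, add_sub_cancel_left]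
    refine (B.le_opNorm _).trans ((mul_le_mul_of_nonneg_left h4 (norm_nonneg _)).trans ?_)
    rw [mul_div_assoc', div_le_iff₀ (by positivity)]
    nlinarith [norm_nonneg B]
  have h4 : ‖γ k + h k - γ k‖ ≤ ‖h‖ := by
    rw [add_sub_cancel_left]; exact h.norm_coe_le_norm k
  refine le_trans ?_ (key.trans (mul_le_mul_of_nonneg_left h4 hc.le))
  simp

theorem contDiff_continuousMap_comp_succ {n : ℕ} (B : L →L[ℝ] G →L[ℝ] G')
    (f : C(G, G')) (f' : C(G, L)) (hf : ∀ x, HasFDerivAt f (B (f' x)) x)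
    (h : ContDiff ℝ n (fun γ : C(K, G) => f'.comp γ)) :
    ContDiff ℝ (n + 1) (fun γ : C(K, G) => f.comp γ) :=
  contDiff_succ_iff_hasFDerivAt.2 ⟨_, (pointwiseCLM K B).contDiff.comp h,
    hasFDerivAt_continuousMap_comp B f f' hf⟩

/-- The codomains `G'` lie in the universe of `G`, so that the induction can pass from `G'` to the
space `G →L[ℝ] G'` of the values of the derivative. -/
theorem contDiff_nat_continuousMap_comp.{u} {K : Type*} [TopologicalSpace K] [CompactSpace K]
    {G : Type u} [NormedAddCommGroup G] [NormedSpace ℝ G]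
    (n : ℕ) : ∀ {G' : Type u} [NormedAddCommGroup G'] [NormedSpace ℝ G'] (f : C(G, G')),
      ContDiff ℝ n f → ContDiff ℝ n (fun γ : C(K, G) => f.comp γ) := by
  induction n with
  | zero =>
    intro G' _ _ f _
    rw [Nat.cast_zero, contDiff_zero]
    exact ContinuousMap.continuous_postcomp f
  | succ n ih =>
    intro G' _ _ f hf
    rw [Nat.cast_succ, contDiff_succ_iff_hasFDerivAt] at hf
    obtain ⟨f', hf', hd⟩ := hf
    exact contDiff_continuousMap_comp_succ (ContinuousLinearMap.id ℝ _) f ⟨f', hf'.continuous⟩ hd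
      (ih _ hf')

/-- Superposition with a smooth function is a smooth map between spaces of continuous functions. -/
theorem contDiff_continuousMap_comp.{u} {G G' : Type u} [NormedAddCommGroup G] [NormedSpace ℝ G]
    [NormedAddCommGroup G'] [NormedSpace ℝ G'] (f : C(G, G')) (hf : ContDiff ℝ ∞ f) :
    ContDiff ℝ ∞ (fun γ : C(K, G) => f.comp γ) :=
  contDiff_infty.2 fun n => contDiff_nat_continuousMap_comp n f (contDiff_infty.1 hf n)

end Superposition

section Integration

theorem continuous_comp_projIcc {G : Type*} [TopologicalSpace G] (γ : C(Icc (-1 : ℝ) 1, G)) :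
    Continuous fun s => γ (projIcc (-1 : ℝ) 1 (by norm_num) s) :=
  γ.continuous.comp continuous_projIcc

variable {G : Type*} [NormedAddCommGroup G] [NormedSpace ℝ G]

/-- Integration from `0`, as a continuous linear operator on `C([-1, 1], G)`. -/
def primitiveCLM (G : Type*) [NormedAddCommGroup G] [NormedSpace ℝ G] :
    C(Icc (-1 : ℝ) 1, G) →L[ℝ] C(Icc (-1 : ℝ) 1, G) :=
  LinearMap.mkContinuous
    { toFun := fun γ => ⟨fun t => ∫ s in (0 : ℝ)..t, γ (projIcc (-1 : ℝ) 1 (by norm_num) s),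
        (intervalIntegral.continuous_primitive
          (fun _ _ => (continuous_comp_projIcc γ).intervalIntegrable _ _) 0).comp
            continuous_subtype_val⟩
      map_add' := fun γ η => by
        ext t
        exact intervalIntegral.integral_add ((continuous_comp_projIcc γ).intervalIntegrable _ _)
          ((continuous_comp_projIcc η).intervalIntegrable _ _)
      map_smul' := fun c γ => by
        ext t
        exact intervalIntegral.integral_smul c _ } 1
    (fun γ => by
      rw [one_mul, ContinuousMap.norm_le _ (norm_nonneg _)]
      intro t
      refine (intervalIntegral.norm_integral_le_of_norm_le_const
        (fun s _ => γ.norm_coe_le_norm _)).trans ?_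
      refine mul_le_of_le_one_right (norm_nonneg _) ?_
      rw [sub_zero, abs_le]
      exact t.2)

theorem primitiveCLM_apply (γ : C(Icc (-1 : ℝ) 1, G)) (t : Icc (-1 : ℝ) 1) :
    primitiveCLM G γ t = ∫ s in (0 : ℝ)..t, γ (projIcc (-1 : ℝ) 1 (by norm_num) s) := rfl

theorem norm_primitiveCLM_le : ‖primitiveCLM G‖ ≤ 1 :=
  LinearMap.mkContinuous_norm_le _ zero_le_one _

/-- A solution of `u = c + ε ∫ h` on `[-1, 1]` gives, after rescaling time by `ε`, an
antiderivative of `h`. -/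
theorem hasDerivAt_of_eq_add_primitive [CompleteSpace G] {ε : ℝ} (hε : 0 < ε) {c : G}
    {u h : C(Icc (-1 : ℝ) 1, G)} (hu : ∀ t, u t = c + ε • primitiveCLM G h t) {t : ℝ}
    (ht : t ∈ Ioo (-ε) ε) :
    HasDerivAt (fun s => u (projIcc (-1 : ℝ) 1 (by norm_num) (s / ε)))
      (h (projIcc (-1 : ℝ) 1 (by norm_num) (t / ε))) t := by
  have h1 : HasDerivAt (fun r : ℝ => ∫ s in (0 : ℝ)..r, h (projIcc (-1 : ℝ) 1 (by norm_num) s))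
      (h (projIcc (-1 : ℝ) 1 (by norm_num) (t / ε))) (t / ε) :=
    (continuous_comp_projIcc h).integral_hasStrictDerivAt 0 (t / ε) |>.hasDerivAt
  have h2 : HasDerivAt (fun s : ℝ => s / ε) (1 / ε) t := (hasDerivAt_id t).div_const ε
  have h3 := ((h1.scomp t h2).const_smul ε).const_add c
  rw [smul_smul, mul_one_div_cancel hε.ne', one_smul] at h3
  refine h3.congr_of_eventuallyEq ?_
  filter_upwards [isOpen_Ioo.mem_nhds ht] with s hs
  have hs' : s / ε ∈ Icc (-1 : ℝ) 1 := by
    constructor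
    · rw [le_div_iff₀ hε]; linarith [hs.1]
    · rw [div_le_iff₀ hε]; linarith [hs.2]
  rw [projIcc_of_mem _ hs', hu, primitiveCLM_apply]
  rfl

end Integration

section GlobalFlow

variable {G : Type*} [NormedAddCommGroup G] [NormedSpace ℝ G] [CompleteSpace G]

/-- For a smooth field `Z` with bounded derivative and small `ε`, the solutions on `[-1, 1]` of the
integral equation `u = z + ε ∫ Z(u)` depend smoothly on `z`, as elements of `C([-1, 1], G)`: the map
`u ↦ u - ε ∫ Z(u)` is a small Lipschitz perturbation of the identity of the Banach space
`C([-1, 1], G)`, hence a diffeomorphism. -/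
theorem exists_contDiff_solution {Z : G → G} (hZ : ContDiff ℝ ∞ Z) {C : ℝ} (hC : 0 < C)
    (hbound : ∀ x, ‖fderiv ℝ Z x‖ ≤ C) :
    ∃ (ε : ℝ) (u : G → C(Icc (-1 : ℝ) 1, G)), 0 < ε ∧ ContDiff ℝ ∞ u ∧
      ∀ z, u z = ContinuousMap.const _ z +
        ε • primitiveCLM G ((⟨Z, hZ.continuous⟩ : C(G, G)).comp (u z)) := by
  let Zc : C(G, G) := ⟨Z, hZ.continuous⟩
  let Z' : C(G, G →L[ℝ] G) := ⟨fderiv ℝ Z, hZ.continuous_fderiv (by simp)⟩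
  set ε : ℝ := 1 / (2 * C) with hεdef
  have hε : 0 < ε := by positivity
  have hεC : ε * C = 1 / 2 := by rw [hεdef]; field_simp
  have hlip : ∀ a b : G, ‖Z a - Z b‖ ≤ C * ‖a - b‖ := fun a b =>
    convex_univ.norm_image_sub_le_of_norm_fderiv_le
      (fun x _ => (hZ.differentiable (by simp)) x) (fun x _ => hbound x) (mem_univ _) (mem_univ _)
  let S : C(Icc (-1 : ℝ) 1, G) → C(Icc (-1 : ℝ) 1, G) :=
    fun γ => γ - ε • primitiveCLM G (Zc.comp γ)
  have hJ : ∀ γ, ‖primitiveCLM G γ‖ ≤ ‖γ‖ := fun γ => by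
    simpa using (primitiveCLM G).le_of_opNorm_le norm_primitiveCLM_le γ
  have hS : ContDiff ℝ ∞ S :=
    contDiff_id.sub
      (((primitiveCLM G).contDiff.comp (contDiff_continuousMap_comp Zc hZ)).const_smul ε)
  let P : C(Icc (-1 : ℝ) 1, G) → C(Icc (-1 : ℝ) 1, G) →L[ℝ] C(Icc (-1 : ℝ) 1, G) := fun γ =>
    ε • (primitiveCLM G).comp (pointwiseCLM _ (ContinuousLinearMap.id ℝ (G →L[ℝ] G)) (Z'.comp γ))
  have hP : ∀ γ, ‖P γ‖ < 1 := by
    intro γ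
    refine lt_of_le_of_lt (ContinuousLinearMap.opNorm_le_bound _ (M := 1 / 2) (by norm_num) ?_)
      (by norm_num)
    intro h
    change ‖ε • primitiveCLM G
      (pointwiseCLM _ (ContinuousLinearMap.id ℝ (G →L[ℝ] G)) (Z'.comp γ) h)‖ ≤ _
    rw [norm_smul, Real.norm_of_nonneg hε.le, ← hεC, mul_assoc]
    refine mul_le_mul_of_nonneg_left ((hJ _).trans ?_) hε.le
    rw [ContinuousMap.norm_le _ (by positivity)]
    intro k
    exact ((Z' (γ k)).le_of_opNorm_le (hbound _) _).trans
      (mul_le_mul_of_nonneg_left (h.norm_coe_le_norm k) hC.le)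
  have hS' : ∀ γ, HasFDerivAt S
      ((ContinuousLinearEquiv.unitsEquiv ℝ _ (Units.oneSub (P γ) (hP γ)) :
        C(Icc (-1 : ℝ) 1, G) ≃L[ℝ] C(Icc (-1 : ℝ) 1, G)) :
        C(Icc (-1 : ℝ) 1, G) →L[ℝ] C(Icc (-1 : ℝ) 1, G)) γ := by
    intro γ
    have h1 := hasFDerivAt_continuousMap_comp (ContinuousLinearMap.id ℝ _) Zc Z'
      (fun x => (hZ.differentiable (by simp) x).hasFDerivAt) γ
    have h2 := (hasFDerivAt_id γ).sub
      ((((primitiveCLM G).hasFDerivAt (x := Zc.comp γ)).comp γ h1).const_smul ε)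
    exact h2
  have happ : ApproximatesLinearOn S
      ((ContinuousLinearEquiv.refl ℝ C(Icc (-1 : ℝ) 1, G) : _ ≃L[ℝ] _) :
        C(Icc (-1 : ℝ) 1, G) →L[ℝ] C(Icc (-1 : ℝ) 1, G)) univ (1 / 2) := by
    intro x _ y _
    have h1 : S x - S y - (x - y) = -(ε • primitiveCLM G (Zc.comp x - Zc.comp y)) := by
      simp only [S, map_sub, smul_sub]; abel
    change ‖S x - S y - (x - y)‖ ≤ ((1 / 2 : NNReal) : ℝ) * ‖x - y‖
    rw [h1, norm_neg, norm_smul, Real.norm_of_nonneg hε.le]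
    have : ((1 / 2 : NNReal) : ℝ) = ε * C := by rw [hεC]; norm_num
    rw [this, mul_assoc]
    refine mul_le_mul_of_nonneg_left ((hJ _).trans ?_) hε.le
    rw [ContinuousMap.norm_le _ (by positivity)]
    intro k
    exact (hlip _ _).trans (mul_le_mul_of_nonneg_left ((x - y).norm_coe_le_norm k) hC.le)
  have hc : Subsingleton C(Icc (-1 : ℝ) 1, G) ∨ (1 / 2 : NNReal) <
      ‖((ContinuousLinearEquiv.refl ℝ C(Icc (-1 : ℝ) 1, G)).symm :
        C(Icc (-1 : ℝ) 1, G) →L[ℝ] C(Icc (-1 : ℝ) 1, G))‖₊⁻¹ := by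
    rcases subsingleton_or_nontrivial C(Icc (-1 : ℝ) 1, G) with h | h
    · exact Or.inl h
    · right
      have : ‖((ContinuousLinearEquiv.refl ℝ C(Icc (-1 : ℝ) 1, G)).symm :
        C(Icc (-1 : ℝ) 1, G) →L[ℝ] C(Icc (-1 : ℝ) 1, G))‖₊ = 1 :=
        NNReal.eq ContinuousLinearMap.norm_id
      rw [this, inv_one]
      exact NNReal.half_lt_self one_ne_zero
  let Φ := happ.toHomeomorph S hc
  have hΦ : ∀ x, Φ x = S x := fun _ => rfl
  have hsymm : ContDiff ℝ ∞ Φ.symm := Φ.contDiff_symm hS' hS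
  let cst : G →L[ℝ] C(Icc (-1 : ℝ) 1, G) := LinearMap.mkContinuous
    { toFun := fun z => ContinuousMap.const _ z
      map_add' := fun _ _ => rfl
      map_smul' := fun _ _ => rfl } 1
    (fun z => by
      rw [one_mul, ContinuousMap.norm_le _ (norm_nonneg _)]
      intro t
      exact le_rfl)
  refine ⟨ε, fun z => Φ.symm (cst z), hε, hsymm.comp cst.contDiff, fun z => ?_⟩
  have h := Φ.apply_symm_apply (cst z)
  rw [hΦ] at h
  exact (sub_eq_iff_eq_add.1 h)

end GlobalFlow

/-- Local flows of smooth vector fields exist, are smooth in the initial value, and their spatial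
derivative solves the variational equation. -/
theorem exists_local_flow {G : Type*} [NormedAddCommGroup G] [NormedSpace ℝ G]
    [FiniteDimensional ℝ G] {Z : G → G} {W : Set G} (hW : IsOpen W) (hZ : ContDiffOn ℝ ∞ Z W)
    {z₀ : G} (hz₀ : z₀ ∈ W) :
    ∃ (ε : ℝ) (U : Set G) (φ : ℝ → G → G), 0 < ε ∧ IsOpen U ∧ z₀ ∈ U ∧ U ⊆ W ∧
      ∀ t ∈ Ioo (-ε) ε, ContDiff ℝ ∞ (φ t) ∧ ∀ z ∈ U, φ 0 z = z ∧ φ t z ∈ W ∧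
        HasDerivAt (fun s => φ s z) (Z (φ t z)) t ∧
        ∀ h, HasDerivAt (fun s => fderiv ℝ (φ s) z h)
          (fderiv ℝ Z (φ t z) (fderiv ℝ (φ t) z h)) t := by
  have : CompleteSpace G := FiniteDimensional.complete ℝ G
  obtain ⟨r, hr, hrW⟩ := Metric.isOpen_iff.1 hW z₀ hz₀
  -- the field is cut off to one with bounded derivative; the two agree on the ball of radius
  -- `r / 4`, and the flow stays there for small times
  let ψ : ContDiffBump z₀ := ⟨r / 4, r / 2, by positivity, by linarith⟩
  let Y : G → G := fun x => ψ x • Z x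
  have hY : ContDiff ℝ ∞ Y := by
    rw [contDiff_iff_contDiffAt]
    intro x
    by_cases hx : x ∈ Metric.ball z₀ r
    · exact ψ.contDiff.contDiffAt.smul ((hZ x (hrW hx)).contDiffAt (hW.mem_nhds (hrW hx)))
    · have hx' : x ∉ tsupport ψ := by
        rw [ψ.tsupport_eq]
        intro h
        exact hx (Metric.closedBall_subset_ball (by change r / 2 < r; linarith) h)
      have : Y =ᶠ[𝓝 x] fun _ => 0 := by
        filter_upwards [(isClosed_tsupport ψ).isOpen_compl.mem_nhds hx'] with y hy
        simp [Y, image_eq_zero_of_notMem_tsupport hy]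
      exact contDiffAt_const.congr_of_eventuallyEq this
  have hsupp : HasCompactSupport Y := ψ.hasCompactSupport.smul_right
  have hYZ : ∀ y ∈ Metric.ball z₀ (r / 4), Y =ᶠ[𝓝 y] Z := by
    intro y hy
    filter_upwards [Metric.isOpen_ball.mem_nhds hy] with x hx
    have : ψ x = 1 := ψ.one_of_mem_closedBall (Metric.ball_subset_closedBall hx)
    simp [Y, this]
  obtain ⟨C, hC⟩ := (hsupp.fderiv ℝ).exists_bound_of_continuous (hY.continuous_fderiv (by simp))
  obtain ⟨ε, u, hε, hu, heq⟩ := exists_contDiff_solution hY (C := max C 1)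
    (lt_of_lt_of_le one_pos (le_max_right _ _)) (fun x => (hC x).trans (le_max_left _ _))
  let pr : ℝ → Icc (-1 : ℝ) 1 := projIcc (-1 : ℝ) 1 (by norm_num)
  let φ : ℝ → G → G := fun t z => u z (pr (t / ε))
  have hev : ∀ k : Icc (-1 : ℝ) 1, ∀ z, HasFDerivAt (fun z => u z k)
      ((ContinuousMap.evalCLM ℝ k).comp (fderiv ℝ u z)) z := fun k z =>
    (ContinuousMap.evalCLM ℝ k : C(Icc (-1 : ℝ) 1, G) →L[ℝ] G).hasFDerivAt.comp z
      (hu.differentiable (by simp) z).hasFDerivAt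
  have hφfd : ∀ s z h, fderiv ℝ (φ s) z h = fderiv ℝ u z h (pr (s / ε)) := fun s z h => by
    rw [(hev (pr (s / ε)) z).fderiv]; rfl
  have hφ0 : ∀ z, φ 0 z = z := by
    intro z
    have h0 : pr (0 / ε) = ⟨0, by norm_num⟩ := by
      rw [zero_div]; exact projIcc_of_mem _ (by norm_num)
    change u z (pr (0 / ε)) = z
    rw [heq z, h0]
    simp [primitiveCLM_apply]
  have hcont : Continuous fun p : ℝ × G => φ p.1 p.2 := by
    have h1 : Continuous fun p : ℝ × G => u p.2 := hu.continuous.comp continuous_snd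
    have h2 : Continuous fun p : ℝ × G => pr (p.1 / ε) :=
      continuous_projIcc.comp (continuous_fst.div_const ε)
    exact h1.eval h2
  have hmem : ∀ᶠ p in 𝓝 ((0 : ℝ), z₀), φ p.1 p.2 ∈ Metric.ball z₀ (r / 4) := by
    refine hcont.continuousAt.eventually_mem (Metric.isOpen_ball.mem_nhds ?_)
    simp only [hφ0]
    exact Metric.mem_ball_self (by positivity)
  rw [nhds_prod_eq] at hmem
  obtain ⟨s₁, hs₁, s₂, hs₂, hsub⟩ := Filter.mem_prod_iff.1 hmem
  obtain ⟨δ, hδ, hδs⟩ := Metric.mem_nhds_iff.1 hs₁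
  obtain ⟨U, hUs, hU, hzU⟩ := mem_nhds_iff.1 hs₂
  refine ⟨min ε δ, U ∩ Metric.ball z₀ (r / 4), φ, lt_min hε hδ, hU.inter Metric.isOpen_ball,
    ⟨hzU, Metric.mem_ball_self (by positivity)⟩,
    fun x hx => hrW (Metric.ball_subset_ball (by linarith) hx.2), ?_⟩
  intro t ht
  have htε : t ∈ Ioo (-ε) ε :=
    ⟨lt_of_le_of_lt (neg_le_neg (min_le_left _ _)) ht.1, ht.2.trans_le (min_le_left _ _)⟩
  refine ⟨(ContinuousMap.evalCLM ℝ (pr (t / ε)) : C(Icc (-1 : ℝ) 1, G) →L[ℝ] G).contDiff.comp hu,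
    fun z hz => ?_⟩
  have hball : φ t z ∈ Metric.ball z₀ (r / 4) := by
    refine hsub (mk_mem_prod (hδs ?_) (hUs hz.1))
    rw [mem_ball_zero_iff, Real.norm_eq_abs, abs_lt]
    exact ⟨lt_of_le_of_lt (neg_le_neg (min_le_right _ _)) ht.1, ht.2.trans_le (min_le_right _ _)⟩
  refine ⟨hφ0 z, hrW (Metric.ball_subset_ball (by linarith) hball), ?_, fun h => ?_⟩
  · have h1 := hasDerivAt_of_eq_add_primitive hε (c := z) (u := u z)
      (h := (⟨Y, hY.continuous⟩ : C(G, G)).comp (u z))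
      (fun t => by
        conv_lhs => rw [heq z]
        rfl) htε
    rw [← (hYZ _ hball).self_of_nhds]
    exact h1
  · let Yc : C(G, G) := ⟨Y, hY.continuous⟩
    let Y' : C(G, G →L[ℝ] G) := ⟨fderiv ℝ Y, hY.continuous_fderiv (by simp)⟩
    have hYd := hasFDerivAt_continuousMap_comp (ContinuousLinearMap.id ℝ _) Yc Y'
      (fun x => (hY.differentiable (by simp) x).hasFDerivAt) (u z)
    -- the variational equation is the derivative of the integral equation for the solutions
    have hvar : ∀ t, fderiv ℝ u z h t = h + ε • primitiveCLM G
        (pointwiseCLM _ (ContinuousLinearMap.id ℝ (G →L[ℝ] G)) (Y'.comp (u z))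
          (fderiv ℝ u z h)) t := by
      intro t
      have h1 := hev t z
      have h2 : HasFDerivAt (fun z => u z t) (ContinuousLinearMap.id ℝ G +
          ε • (ContinuousMap.evalCLM ℝ t).comp ((primitiveCLM G).comp
            ((pointwiseCLM _ (ContinuousLinearMap.id ℝ (G →L[ℝ] G)) (Y'.comp (u z))).comp
              (fderiv ℝ u z)))) z := by
        have h3 : (fun z => u z t) = fun z => z + ε •
            (ContinuousMap.evalCLM ℝ t : C(Icc (-1 : ℝ) 1, G) →L[ℝ] G)
              (primitiveCLM G (Yc.comp (u z))) := by
          funext z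
          conv_lhs => rw [heq z]
          rfl
        rw [h3]
        refine (hasFDerivAt_id z).add (HasFDerivAt.const_smul ?_ ε)
        exact (ContinuousMap.evalCLM ℝ t).hasFDerivAt.comp z
          ((primitiveCLM G).hasFDerivAt.comp z
            (hYd.comp z (hu.differentiable (by simp) z).hasFDerivAt))
      exact DFunLike.congr_fun (h1.unique h2) h
    have h1 := hasDerivAt_of_eq_add_primitive hε hvar htε
    simp only [hφfd]
    rw [← (hYZ _ hball).fderiv_eq]
    exact h1


/-! ### Lie algebroids on trivial bundles over open subsets of a vector space -/

/-- A linear ordinary differential equation with continuous coefficients has only the zero solution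
with initial value zero. -/
theorem eq_zero_of_hasDerivAt_clm {G : Type*} [NormedAddCommGroup G] [NormedSpace ℝ G]
    {B : ℝ → G →L[ℝ] G} {f : ℝ → G} {ε : ℝ} (hB : ContinuousOn B (Ioo (-ε) ε))
    (hf : ∀ t ∈ Ioo (-ε) ε, HasDerivAt f (B t (f t)) t) (h0 : f 0 = 0) {t : ℝ}
    (ht : t ∈ Ioo (-ε) ε) : f t = 0 := by
  obtain ⟨r, hr1, hr2⟩ := exists_between (abs_lt.2 ht)
  have hr0 : 0 < r := (abs_nonneg t).trans_lt hr1
  have hsub : Icc (-r) r ⊆ Ioo (-ε) ε := fun s hs => ⟨by linarith [hs.1], by linarith [hs.2]⟩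
  obtain ⟨C, hC⟩ := isCompact_Icc.exists_bound_of_continuousOn (hB.mono hsub)
  have hlip : ∀ s ∈ Ioo (-r) r, LipschitzOnWith C.toNNReal (fun x => B s x) univ := by
    intro s hs
    refine ((B s).lipschitz.weaken ?_).lipschitzOnWith
    rw [← NNReal.coe_le_coe]
    exact (hC s (Ioo_subset_Icc_self hs)).trans (Real.le_coe_toNNReal C)
  exact ODE_solution_unique_of_mem_Ioo (v := fun s x => B s x) (s := fun _ => univ) hlip
    (g := fun _ => 0) (t₀ := 0) ⟨by linarith, hr0⟩
    (fun s hs => ⟨hf s (hsub (Ioo_subset_Icc_self hs)), mem_univ _⟩)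
    (fun s _ => ⟨by simpa using hasDerivAt_const s (0 : G), mem_univ _⟩) h0 (abs_lt.1 hr1)

/-- The coordinate expression of a bracket and of a linear derivation on the sections of the trivial
bundle with fibre `F` over an open subset `dom` of `E`: the symbol `vf` of the derivation, its
values `der` on constant sections, the anchor `anc`, and the brackets `brk` of constant sections. -/
structure CoordModel (E F : Type*) [NormedAddCommGroup E] [NormedSpace ℝ E]
    [NormedAddCommGroup F] [NormedSpace ℝ F] where
  dom : Set E
  vf : E → E
  der : E → F →L[ℝ] F
  anc : E → F →L[ℝ] E
  brk : E → F →L[ℝ] F →L[ℝ] F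
  isOpen_dom : IsOpen dom
  contDiffOn_vf : ContDiffOn ℝ ∞ vf dom
  contDiffOn_der : ContDiffOn ℝ ∞ der dom
  contDiffOn_anc : ContDiffOn ℝ ∞ anc dom
  contDiffOn_brk : ContDiffOn ℝ ∞ brk dom

namespace CoordModel

variable {E : Type*} [NormedAddCommGroup E] [NormedSpace ℝ E]
  {F : Type*} [NormedAddCommGroup F] [NormedSpace ℝ F] (m : CoordModel E F)

/-- The derivation applied to a section `a`. -/
def deriv (a : E → F) (y : E) : F := fderiv ℝ a y (m.vf y) + m.der y (a y)

/-- The bracket of two sections. -/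
def bracket (a b : E → F) (y : E) : F :=
  m.brk y (a y) (b y) + fderiv ℝ b y (m.anc y (a y)) - fderiv ℝ a y (m.anc y (b y))

/-- The derivation satisfies the Leibniz rule for the bracket. -/
def IsDerivation : Prop :=
  ∀ a b : E → F, ContDiff ℝ ∞ a → ContDiff ℝ ∞ b → ∀ y ∈ m.dom,
    m.deriv (m.bracket a b) y = m.bracket (m.deriv a) b y + m.bracket a (m.deriv b) y

variable {m} {y : E}

theorem hasFDerivAt_vf (hy : y ∈ m.dom) : HasFDerivAt m.vf (fderiv ℝ m.vf y) y :=
  ((m.contDiffOn_vf.contDiffAt (m.isOpen_dom.mem_nhds hy)).differentiableAt (by simp)).hasFDerivAt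

theorem hasFDerivAt_der (hy : y ∈ m.dom) : HasFDerivAt m.der (fderiv ℝ m.der y) y :=
  ((m.contDiffOn_der.contDiffAt (m.isOpen_dom.mem_nhds hy)).differentiableAt (by simp)).hasFDerivAt

theorem hasFDerivAt_anc (hy : y ∈ m.dom) : HasFDerivAt m.anc (fderiv ℝ m.anc y) y :=
  ((m.contDiffOn_anc.contDiffAt (m.isOpen_dom.mem_nhds hy)).differentiableAt (by simp)).hasFDerivAt

theorem hasFDerivAt_brk (hy : y ∈ m.dom) : HasFDerivAt m.brk (fderiv ℝ m.brk y) y :=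
  ((m.contDiffOn_brk.contDiffAt (m.isOpen_dom.mem_nhds hy)).differentiableAt (by simp)).hasFDerivAt

/-- The anchor intertwines the derivation with the Lie derivative along its symbol. This is the
Leibniz rule of the derivation, tested on a constant section and on the product of a constant
section with a linear function that vanishes at the given point. -/
theorem IsDerivation.anc_eq (h : m.IsDerivation) (hy : y ∈ m.dom) (v : F) :
    fderiv ℝ m.anc y (m.vf y) v - fderiv ℝ m.vf y (m.anc y v) = m.anc y (m.der y v) := by
  rcases subsingleton_or_nontrivial F with hF | hF
  · simp [Subsingleton.elim v 0]
  obtain ⟨w, hw⟩ := exists_ne (0 : F)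
  rw [← sub_eq_zero]
  refine SeparatingDual.eq_zero_of_forall_dual_eq_zero (R := ℝ) fun l => ?_
  let b : E → F := fun z => l (z - y) • w
  have hb : ∀ z, HasFDerivAt b (l.smulRight w) z := fun z => by
    have h1 : HasFDerivAt (fun z => l (z - y)) l z := by
      have h2 := l.hasFDerivAt.comp z ((hasFDerivAt_id z).sub_const y)
      exact h2
    exact h1.smul_const w
  have hbs : ContDiff ℝ ∞ b := (l.contDiff.comp (contDiff_id.sub contDiff_const)).smul
    contDiff_const
  have hb0 : b y = 0 := by simp [b]
  have key := h (fun _ => v) b contDiff_const hbs y hy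
  have hbr : m.bracket (fun _ => v) b = fun z => m.brk z v (b z) + l (m.anc z v) • w := by
    funext z; simp [bracket, (hb z).fderiv]
  have hdv : m.deriv (fun _ => v) = fun z => m.der z v := by
    funext z; simp [deriv]
  have hdb : m.deriv b = fun z => l (m.vf z) • w + m.der z (b z) := by
    funext z; simp [deriv, (hb z).fderiv]
  have h1 := ((((hasFDerivAt_brk hy).clm_apply (hasFDerivAt_const v y)).clm_apply (hb y)).add
    ((l.hasFDerivAt.comp y ((hasFDerivAt_anc hy).clm_apply (hasFDerivAt_const v y))).smul_const w))
  have h1' : HasFDerivAt (fun z => m.brk z v (b z) + l (m.anc z v) • w) _ y := h1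
  have h2 := ((l.hasFDerivAt.comp y (hasFDerivAt_vf hy)).smul_const w).add
    ((hasFDerivAt_der hy).clm_apply (hb y))
  have h2' : HasFDerivAt (fun z => l (m.vf z) • w + m.der z (b z)) _ y := h2
  rw [hbr, hdv, hdb] at key
  simp only [deriv, bracket, h1'.fderiv, h2'.fderiv, (hb y).fderiv, hb0] at key
  simp only [map_zero, _root_.add_apply, ContinuousLinearMap.smulRight_apply,
    ContinuousLinearMap.comp_apply, ContinuousLinearMap.flip_apply, map_smul, zero_add, add_zero,
    sub_zero, _root_.zero_apply, fderiv_fun_const, Pi.zero_apply,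
    smul_zero] at key
  have key2 : l (fderiv ℝ m.anc y (m.vf y) v - fderiv ℝ m.vf y (m.anc y v)
      - m.anc y (m.der y v)) • w = 0 := by
    simp only [map_sub, sub_smul]
    rw [← sub_eq_zero] at key
    convert key using 1
    module
  exact (smul_eq_zero.1 key2).resolve_right hw

/-- The Leibniz rule of the derivation on constant sections. -/
theorem IsDerivation.brk_eq (h : m.IsDerivation) (hy : y ∈ m.dom) (v w : F) :
    fderiv ℝ m.brk y (m.vf y) v w + m.der y (m.brk y v w) =
      m.brk y (m.der y v) w - fderiv ℝ m.der y (m.anc y w) v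
        + (m.brk y v (m.der y w) + fderiv ℝ m.der y (m.anc y v) w) := by
  have key := h (fun _ => v) (fun _ => w) contDiff_const contDiff_const y hy
  have hbr : m.bracket (fun _ => v) (fun _ => w) = fun z => m.brk z v w := by
    funext z; simp [bracket]
  have hd : ∀ u : F, m.deriv (fun _ => u) = fun z => m.der z u := fun u => by
    funext z; simp [deriv]
  have h1 : HasFDerivAt (fun z => m.brk z v w) _ y :=
    ((hasFDerivAt_brk hy).clm_apply (hasFDerivAt_const v y)).clm_apply (hasFDerivAt_const w y)
  have h2 : ∀ u : F, HasFDerivAt (fun z => m.der z u) _ y := fun u =>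
    (hasFDerivAt_der hy).clm_apply (hasFDerivAt_const u y)
  rw [hbr, hd, hd] at key
  simp only [deriv, bracket, h1.fderiv, (h2 _).fderiv] at key
  simp only [_root_.add_apply, ContinuousLinearMap.comp_apply,
    ContinuousLinearMap.flip_apply, map_zero, zero_add, add_zero, sub_zero,
    _root_.zero_apply, fderiv_fun_const, Pi.zero_apply] at key
  exact key

variable (m) in
/-- `φ` is a smooth local flow of the symbol, and `T t y` is parallel transport along `s ↦ φ s y`
for the equation `v' = -(der v)`; both start in `U` and are considered for times in `(-ε, ε)`. The
spatial derivatives of both solve the variational equations. -/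
structure IsLocalFlow (ε : ℝ) (U : Set E) (φ : ℝ → E → E) (T : ℝ → E → F →L[ℝ] F) : Prop where
  pos : 0 < ε
  isOpen : IsOpen U
  contDiff_base : ∀ t ∈ Ioo (-ε) ε, ContDiff ℝ ∞ (φ t)
  contDiff_fibre : ∀ t ∈ Ioo (-ε) ε, ContDiff ℝ ∞ (T t)
  base_zero : ∀ y ∈ U, φ 0 y = y
  fibre_zero : ∀ y ∈ U, T 0 y = ContinuousLinearMap.id ℝ F
  mem_dom : ∀ t ∈ Ioo (-ε) ε, ∀ y ∈ U, φ t y ∈ m.dom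
  hasDerivAt_base : ∀ t ∈ Ioo (-ε) ε, ∀ y ∈ U, HasDerivAt (fun s => φ s y) (m.vf (φ t y)) t
  hasDerivAt_fibre : ∀ t ∈ Ioo (-ε) ε, ∀ y ∈ U,
    HasDerivAt (fun s => T s y) (-((m.der (φ t y)).comp (T t y))) t
  hasDerivAt_fderiv_base : ∀ t ∈ Ioo (-ε) ε, ∀ y ∈ U, ∀ h : E,
    HasDerivAt (fun s => fderiv ℝ (φ s) y h) (fderiv ℝ m.vf (φ t y) (fderiv ℝ (φ t) y h)) t
  hasDerivAt_fderiv_fibre : ∀ t ∈ Ioo (-ε) ε, ∀ y ∈ U, ∀ h : E,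
    HasDerivAt (fun s => fderiv ℝ (T s) y h)
      (-((fderiv ℝ m.der (φ t y) (fderiv ℝ (φ t) y h)).comp (T t y) +
        (m.der (φ t y)).comp (fderiv ℝ (T t) y h))) t

/-- Local flows exist: `φ` and `T` are the components of the flow of the vector field
`(y, S) ↦ (X(y), -Δ(y) ∘ S)` on `E × (F →L[ℝ] F)`, started at `(y, id)`, where `X` is the symbol and
`Δ` are the values of the derivation on constant sections. -/
theorem exists_isLocalFlow [FiniteDimensional ℝ E] [FiniteDimensional ℝ F] (m : CoordModel E F)
    {y₀ : E} (hy₀ : y₀ ∈ m.dom) :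
    ∃ (ε : ℝ) (U : Set E) (φ : ℝ → E → E) (T : ℝ → E → F →L[ℝ] F),
      m.IsLocalFlow ε U φ T ∧ y₀ ∈ U ∧ U ⊆ m.dom := by
  let Z : E × (F →L[ℝ] F) → E × (F →L[ℝ] F) := fun p => (m.vf p.1, -((m.der p.1).comp p.2))
  have hZ : ContDiffOn ℝ ∞ Z (m.dom ×ˢ univ) :=
    (m.contDiffOn_vf.comp contDiff_fst.contDiffOn fun p hp => hp.1).prodMk
      ((m.contDiffOn_der.comp contDiff_fst.contDiffOn fun p hp => hp.1).clm_comp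
        contDiff_snd.contDiffOn).neg
  have hZ' : ∀ p : E × (F →L[ℝ] F), p.1 ∈ m.dom → ∀ k, fderiv ℝ Z p k =
      (fderiv ℝ m.vf p.1 k.1,
        -((fderiv ℝ m.der p.1 k.1).comp p.2 + (m.der p.1).comp k.2)) := by
    intro p hp k
    have h1 : HasFDerivAt Z _ p :=
      ((hasFDerivAt_vf hp).comp p hasFDerivAt_fst).prodMk
        (((hasFDerivAt_der hp).comp p hasFDerivAt_fst).clm_comp hasFDerivAt_snd).neg
    rw [h1.fderiv]
    ext <;> simp [add_comm]
  obtain ⟨ε, U, Φ, hε, hU, h0, hsub, H⟩ := exists_local_flow (m.isOpen_dom.prod isOpen_univ) hZ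
    (z₀ := (y₀, ContinuousLinearMap.id ℝ F)) ⟨hy₀, mem_univ _⟩
  let ι : E → E × (F →L[ℝ] F) := fun y => (y, ContinuousLinearMap.id ℝ F)
  have hι : ContDiff ℝ ∞ ι := contDiff_id.prodMk contDiff_const
  have hι' : ∀ y, HasFDerivAt ι (ContinuousLinearMap.inl ℝ E (F →L[ℝ] F)) y := fun y =>
    (hasFDerivAt_id y).prodMk (hasFDerivAt_const _ y)
  have hd : ∀ s ∈ Ioo (-ε) ε, ∀ y, HasFDerivAt (fun y => Φ s (ι y))
      ((fderiv ℝ (Φ s) (ι y)).comp (ContinuousLinearMap.inl ℝ E (F →L[ℝ] F))) y := fun s hs y =>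
    (((H s hs).1.differentiable (by simp)) (ι y)).hasFDerivAt.comp y (hι' y)
  have hd1 : ∀ s ∈ Ioo (-ε) ε, ∀ y h, fderiv ℝ (fun y => (Φ s (ι y)).1) y h =
      (fderiv ℝ (Φ s) (ι y) (h, 0)).1 := fun s hs y h => by
    have := (hasFDerivAt_fst.comp y (hd s hs y)).fderiv
    exact (DFunLike.congr_fun this h)
  have hd2 : ∀ s ∈ Ioo (-ε) ε, ∀ y h, fderiv ℝ (fun y => (Φ s (ι y)).2) y h =
      (fderiv ℝ (Φ s) (ι y) (h, 0)).2 := fun s hs y h => by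
    have := (hasFDerivAt_snd.comp y (hd s hs y)).fderiv
    exact (DFunLike.congr_fun this h)
  refine ⟨ε, ι ⁻¹' U, fun t y => (Φ t (ι y)).1, fun t y => (Φ t (ι y)).2, ?_, h0,
    fun y hy => (hsub hy).1⟩
  have H0 := fun y (hy : ι y ∈ U) => ((H 0 ⟨neg_lt_zero.2 hε, hε⟩).2 (ι y) hy).1
  have hv : ∀ t ∈ Ioo (-ε) ε, ∀ y, ι y ∈ U → ∀ h, _ := fun t ht y hy h =>
    ((H t ht).2 (ι y) hy).2.2.2 (h, 0)
  have hW := fun t ht y (hy : ι y ∈ U) => (((H t ht).2 (ι y) hy).2.1).1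
  refine ⟨hε, hU.preimage hι.continuous,
    fun t ht => contDiff_fst.comp ((H t ht).1.comp hι),
    fun t ht => contDiff_snd.comp ((H t ht).1.comp hι),
    fun y hy => congrArg Prod.fst (H0 y hy), fun y hy => congrArg Prod.snd (H0 y hy), hW,
    ?_, ?_, ?_, ?_⟩
  · intro t ht y hy
    have h := HasFDerivAt.comp_hasDerivAt t hasFDerivAt_fst ((H t ht).2 (ι y) hy).2.2.1
    exact h
  · intro t ht y hy
    have h := HasFDerivAt.comp_hasDerivAt t hasFDerivAt_snd ((H t ht).2 (ι y) hy).2.2.1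
    exact h
  · intro t ht y hy h
    have hv1 := HasFDerivAt.comp_hasDerivAt t hasFDerivAt_fst (hv t ht y hy h)
    rw [hZ' _ (hW t ht y hy)] at hv1
    rw [hd1 t ht]
    refine hv1.congr_of_eventuallyEq ?_
    filter_upwards [isOpen_Ioo.mem_nhds ht] with s hs using hd1 s hs y h
  · intro t ht y hy h
    have hv2 := HasFDerivAt.comp_hasDerivAt t hasFDerivAt_snd (hv t ht y hy h)
    rw [hZ' _ (hW t ht y hy)] at hv2
    rw [hd1 t ht, hd2 t ht]
    refine hv2.congr_of_eventuallyEq ?_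
    filter_upwards [isOpen_Ioo.mem_nhds ht] with s hs using hd2 s hs y h

namespace IsLocalFlow

variable {ε : ℝ} {U : Set E} {φ : ℝ → E → E} {T : ℝ → E → F →L[ℝ] F}

theorem continuousOn_base (hf : m.IsLocalFlow ε U φ T) {y : E} (hy : y ∈ U) :
    ContinuousOn (fun s => φ s y) (Ioo (-ε) ε) := fun t ht =>
  (hf.hasDerivAt_base t ht y hy).continuousAt.continuousWithinAt

theorem fderiv_base_zero (hf : m.IsLocalFlow ε U φ T) {y : E} (hy : y ∈ U) (h : E) :
    fderiv ℝ (φ 0) y h = h := by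
  have : φ 0 =ᶠ[𝓝 y] id := by
    filter_upwards [hf.isOpen.mem_nhds hy] with z hz using hf.base_zero z hz
  rw [this.fderiv_eq, fderiv_id, ContinuousLinearMap.id_apply]

theorem fderiv_fibre_zero (hf : m.IsLocalFlow ε U φ T) {y : E} (hy : y ∈ U) (h : E) :
    fderiv ℝ (T 0) y h = 0 := by
  have : T 0 =ᶠ[𝓝 y] fun _ => ContinuousLinearMap.id ℝ F := by
    filter_upwards [hf.isOpen.mem_nhds hy] with z hz using hf.fibre_zero z hz
  rw [this.fderiv_eq, fderiv_fun_const, Pi.zero_apply, _root_.zero_apply]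

/-- The flow of a derivation is compatible with the anchor: the defect solves a linear differential
equation. -/
theorem fderiv_anc (hf : m.IsLocalFlow ε U φ T) (hm : m.IsDerivation) {t : ℝ}
    (ht : t ∈ Ioo (-ε) ε) {y : E} (hy : y ∈ U) (v : F) :
    fderiv ℝ (φ t) y (m.anc y v) = m.anc (φ t y) (T t y v) := by
  rw [← sub_eq_zero]
  have hB : ContinuousOn (fun s => fderiv ℝ m.vf (φ s y)) (Ioo (-ε) ε) :=
    (m.contDiffOn_vf.continuousOn_fderiv_of_isOpen m.isOpen_dom (by simp)).comp
      (hf.continuousOn_base hy) fun s hs => hf.mem_dom s hs y hy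
  refine eq_zero_of_hasDerivAt_clm
    (f := fun s => fderiv ℝ (φ s) y (m.anc y v) - m.anc (φ s y) (T s y v)) hB ?_ ?_ ht
  · intro s hs
    have hd := hf.mem_dom s hs y hy
    have h1 := (hasFDerivAt_anc hd).comp_hasDerivAt s (hf.hasDerivAt_base s hs y hy)
    have h2 := (hf.hasDerivAt_fibre s hs y hy).clm_apply (hasDerivAt_const s v)
    have h3 := (hf.hasDerivAt_fderiv_base s hs y hy (m.anc y v)).sub (h1.clm_apply h2)
    refine HasDerivAt.congr_deriv h3 ?_
    have h4 := hm.anc_eq hd (T s y v)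
    simp only [_root_.neg_apply, ContinuousLinearMap.comp_apply, map_zero, add_zero,
      map_neg, map_sub, ← h4, Function.comp_apply]
    abel
  · simp only [hf.fderiv_base_zero hy, hf.base_zero y hy, hf.fibre_zero y hy,
      ContinuousLinearMap.id_apply, sub_self]

set_option synthInstance.maxHeartbeats 400000 in
set_option maxHeartbeats 1000000 in
/-- The flow of a derivation is compatible with the brackets of constant sections: the defect solves
a linear differential equation along the flow. -/
theorem fibre_brk (hf : m.IsLocalFlow ε U φ T) (hm : m.IsDerivation) {t : ℝ}
    (ht : t ∈ Ioo (-ε) ε) {y : E} (hy : y ∈ U) (v w : F) :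
    T t y (m.brk y v w) - m.brk (φ t y) (T t y v) (T t y w)
      - fderiv ℝ (T t) y (m.anc y v) w + fderiv ℝ (T t) y (m.anc y w) v = 0 := by
  have hB : ContinuousOn (fun s => -m.der (φ s y)) (Ioo (-ε) ε) :=
    (m.contDiffOn_der.continuousOn.comp
      (hf.continuousOn_base hy) fun s hs => hf.mem_dom s hs y hy).neg
  refine eq_zero_of_hasDerivAt_clm (f := fun s =>
    T s y (m.brk y v w) - m.brk (φ s y) (T s y v) (T s y w)
      - fderiv ℝ (T s) y (m.anc y v) w + fderiv ℝ (T s) y (m.anc y w) v) hB ?_ ?_ ht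
  · intro s hs
    have hd := hf.mem_dom s hs y hy
    have hT := fun u : F => (hf.hasDerivAt_fibre s hs y hy).clm_apply (hasDerivAt_const s u)
    have hT' := fun (u u' : F) =>
      (hf.hasDerivAt_fderiv_fibre s hs y hy (m.anc y u)).clm_apply (hasDerivAt_const s u')
    have hb : HasDerivAt (fun s => m.brk (φ s y)) (fderiv ℝ m.brk (φ s y) (m.vf (φ s y))) s :=
      HasFDerivAt.comp_hasDerivAt (l := m.brk) s (hasFDerivAt_brk hd) (hf.hasDerivAt_base s hs y hy)
    have h1 := (((hT (m.brk y v w)).sub ((hb.clm_apply (hT v)).clm_apply (hT w))).sub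
      (hT' v w)).add (hT' w v)
    refine HasDerivAt.congr_deriv h1 ?_
    have h2 := hm.brk_eq hd (T s y v) (T s y w)
    rw [← hf.fderiv_anc hm hs hy, ← hf.fderiv_anc hm hs hy, ← eq_sub_iff_add_eq] at h2
    simp only [_root_.neg_apply, ContinuousLinearMap.comp_apply, map_zero, add_zero,
      _root_.add_apply, map_neg, map_sub, map_add, h2]
    abel
  · simp only [hf.fderiv_fibre_zero hy, hf.base_zero y hy, hf.fibre_zero y hy,
      ContinuousLinearMap.id_apply, _root_.zero_apply]
    abel

/-- The flow of a derivation maps brackets of sections to brackets of related sections. -/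
theorem fibre_bracket (hf : m.IsLocalFlow ε U φ T) (hm : m.IsDerivation) {t : ℝ}
    (ht : t ∈ Ioo (-ε) ε) {y : E} (hy : y ∈ U) {a b α β : E → F} (ha : DifferentiableAt ℝ a y)
    (hb : DifferentiableAt ℝ b y) (hα : DifferentiableAt ℝ α (φ t y))
    (hβ : DifferentiableAt ℝ β (φ t y)) (haα : ∀ᶠ z in 𝓝 y, T t z (a z) = α (φ t z))
    (hbβ : ∀ᶠ z in 𝓝 y, T t z (b z) = β (φ t z)) :
    T t y (m.bracket a b y) = m.bracket α β (φ t y) := by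
  -- the derivatives of related sections are compared by differentiating the relation; the terms
  -- with the derivative of `T t` are those of `fibre_brk`
  have hφ := ((hf.contDiff_base t ht).differentiable (by simp) y).hasFDerivAt
  have hT := ((hf.contDiff_fibre t ht).differentiable (by simp) y).hasFDerivAt
  have key : ∀ {c γ : E → F}, DifferentiableAt ℝ c y → DifferentiableAt ℝ γ (φ t y) →
      (∀ᶠ z in 𝓝 y, T t z (c z) = γ (φ t z)) → ∀ h : E,
      fderiv ℝ γ (φ t y) (fderiv ℝ (φ t) y h) =
        T t y (fderiv ℝ c y h) + fderiv ℝ (T t) y h (c y) := by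
    intro c γ hc hγ he h
    have h1 : HasFDerivAt (fun z => γ (φ t z)) _ y := hγ.hasFDerivAt.comp y hφ
    have h2 := (hT.clm_apply hc.hasFDerivAt).congr_of_eventuallyEq
      (EventuallyEq.symm he)
    exact DFunLike.congr_fun (h1.unique h2) h
  have h0 := hf.fibre_brk hm ht hy (a y) (b y)
  rw [bracket, bracket, ← haα.self_of_nhds, ← hbβ.self_of_nhds, ← hf.fderiv_anc hm ht hy,
    ← hf.fderiv_anc hm ht hy, key ha hα haα, key hb hβ hbβ, map_sub, map_add, ← sub_eq_zero,
    ← h0]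
  abel

end IsLocalFlow

end CoordModel


/-! ### Coordinates on a vector bundle -/

section Coordinates

set_option linter.unusedSectionVars false

variable {E : Type*} [NormedAddCommGroup E] [NormedSpace ℝ E] [FiniteDimensional ℝ E]
  {M : Type*} [TopologicalSpace M] [ChartedSpace E M] [IsManifold 𝓘(ℝ, E) ∞ M] [T2Space M]
  {F : Type*} [NormedAddCommGroup F] [NormedSpace ℝ F]
  {A : M → Type*} [TopologicalSpace (TotalSpace F A)] [∀ x, TopologicalSpace (A x)]
  [∀ x, AddCommGroup (A x)] [∀ x, Module ℝ (A x)] [FiberBundle F A] [VectorBundle ℝ F A]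

variable (E F A) in
theorem exists_coordBump (p : M) : ∃ ψ : SmoothBumpFunction 𝓘(ℝ, E) p,
    tsupport ψ ⊆ (trivializationAt F A p).baseSet := by
  have h : (trivializationAt F A p).baseSet ∈ 𝓝 p :=
    (trivializationAt F A p).open_baseSet.mem_nhds (FiberBundle.mem_baseSet_trivializationAt' p)
  obtain ⟨ψ, -, hψ⟩ := (SmoothBumpFunction.nhds_basis_tsupport (I := 𝓘(ℝ, E)) p).mem_iff.1 h
  exact ⟨ψ, hψ⟩

variable (E F A) in
/-- A bump function at `p` with support in the domain of the chart and of the trivialization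
at `p`. -/
def coordBump (p : M) : SmoothBumpFunction 𝓘(ℝ, E) p := (exists_coordBump E F A p).choose

variable (E F A) in
/-- An open neighbourhood of `p` in the domain of the chart and of the trivialization at `p`, on
which the bump function `coordBump` is equal to `1`. -/
def coordSource (p : M) : Set M :=
  interior {x | coordBump E F A p x = 1} ∩
    ((chartAt E p).source ∩ (trivializationAt F A p).baseSet)

variable (E F A) in
/-- The image of `coordSource` in the chart at `p`. -/
def coordTarget (p : M) : Set E :=
  (extChartAt 𝓘(ℝ, E) p).target ∩ (extChartAt 𝓘(ℝ, E) p).symm ⁻¹' coordSource E F A p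

variable {p : M} {x : M} {y : E}

theorem isOpen_coordSource : IsOpen (coordSource E F A p) :=
  isOpen_interior.inter ((chartAt E p).open_source.inter (trivializationAt F A p).open_baseSet)

theorem mem_coordSource_self : p ∈ coordSource E F A p :=
  ⟨mem_interior_iff_mem_nhds.2 (coordBump E F A p).eventuallyEq_one, mem_chart_source E p,
    FiberBundle.mem_baseSet_trivializationAt' p⟩

theorem isOpen_coordTarget : IsOpen (coordTarget E F A p) :=
  (continuousOn_extChartAt_symm p).isOpen_inter_preimage (isOpen_extChartAt_target p)
    isOpen_coordSource

theorem coordBump_eq_one (hx : x ∈ coordSource E F A p) : coordBump E F A p x = 1 := by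
  obtain ⟨U, ⟨-, hU⟩, hxU⟩ := hx.1
  exact hU hxU

theorem mem_extChartAt_source_of_mem (hx : x ∈ coordSource E F A p) :
    x ∈ (extChartAt 𝓘(ℝ, E) p).source := by
  rw [extChartAt_source]; exact hx.2.1

theorem extChartAt_mem_coordTarget (hx : x ∈ coordSource E F A p) :
    extChartAt 𝓘(ℝ, E) p x ∈ coordTarget E F A p := by
  have h := mem_extChartAt_source_of_mem hx
  refine ⟨(extChartAt 𝓘(ℝ, E) p).map_source h, ?_⟩
  rwa [mem_preimage, (extChartAt 𝓘(ℝ, E) p).left_inv h]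

theorem extChartAt_left_inv (hx : x ∈ coordSource E F A p) :
    (extChartAt 𝓘(ℝ, E) p).symm (extChartAt 𝓘(ℝ, E) p x) = x :=
  (extChartAt 𝓘(ℝ, E) p).left_inv (mem_extChartAt_source_of_mem hx)

theorem extChartAt_right_inv (hy : y ∈ coordTarget E F A p) :
    extChartAt 𝓘(ℝ, E) p ((extChartAt 𝓘(ℝ, E) p).symm y) = y :=
  (extChartAt 𝓘(ℝ, E) p).right_inv hy.1

theorem continuousAt_extChartAt_of_mem (hx : x ∈ coordSource E F A p) :
    ContinuousAt (extChartAt 𝓘(ℝ, E) p) x :=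
  continuousAt_extChartAt' (mem_extChartAt_source_of_mem hx)

theorem continuousAt_symm_of_mem (hy : y ∈ coordTarget E F A p) :
    ContinuousAt (extChartAt 𝓘(ℝ, E) p).symm y :=
  continuousAt_extChartAt_symm'' hy.1

theorem contMDiffOn_extChartAt_coordSource :
    ContMDiffOn 𝓘(ℝ, E) 𝓘(ℝ, E) ∞ (extChartAt 𝓘(ℝ, E) p) (coordSource E F A p) :=
  (contMDiffOn_extChartAt (I := 𝓘(ℝ, E)) (n := ∞) (x := p)).mono fun _ hx => hx.2.1

theorem contMDiffOn_extChartAt_symm_coordTarget :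
    ContMDiffOn 𝓘(ℝ, E) 𝓘(ℝ, E) ∞ (extChartAt 𝓘(ℝ, E) p).symm (coordTarget E F A p) :=
  (contMDiffOn_extChartAt_symm (I := 𝓘(ℝ, E)) (n := ∞) p).mono fun _ hy => hy.1

theorem hasMFDerivAt_extChartAt_coord (hx : x ∈ coordSource E F A p) :
    HasMFDerivAt 𝓘(ℝ, E) 𝓘(ℝ, E) (extChartAt 𝓘(ℝ, E) p) x
      (mfderiv 𝓘(ℝ, E) 𝓘(ℝ, E) (extChartAt 𝓘(ℝ, E) p) x) :=
  ((contMDiffOn_extChartAt_coordSource.contMDiffAt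
    (isOpen_coordSource.mem_nhds hx)).mdifferentiableAt (by simp)).hasMFDerivAt

variable (E F) in
/-- The coordinate expression of a section in the chart and the trivialization at `p`. -/
def coordRep (p : M) (s : (x : M) → A x) (y : E) : F :=
  (trivializationAt F A p).linearMapAt ℝ ((extChartAt 𝓘(ℝ, E) p).symm y)
    (s ((extChartAt 𝓘(ℝ, E) p).symm y))

variable [ContMDiffVectorBundle ∞ F A 𝓘(ℝ, E)]

theorem contMDiffAt_linearMapAt_section {s : (x : M) → A x} {x : M}
    (hx : x ∈ (trivializationAt F A p).baseSet)
    (hs : ContMDiffAt 𝓘(ℝ, E) (𝓘(ℝ, E).prod 𝓘(ℝ, F)) ∞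
      (fun x => (⟨x, s x⟩ : TotalSpace F A)) x) :
    ContMDiffAt 𝓘(ℝ, E) 𝓘(ℝ, F) ∞
      (fun z => (trivializationAt F A p).linearMapAt ℝ z (s z)) x := by
  refine (((trivializationAt F A p).contMDiffAt_section_iff hx).1 hs).congr_of_eventuallyEq ?_
  filter_upwards [(trivializationAt F A p).open_baseSet.mem_nhds hx] with z hz
  rw [Trivialization.coe_linearMapAt_of_mem _ hz]

theorem contDiffAt_coordRep {s : (x : M) → A x} {y : E} (hy : y ∈ coordTarget E F A p)
    (hs : ContMDiffAt 𝓘(ℝ, E) (𝓘(ℝ, E).prod 𝓘(ℝ, F)) ∞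
      (fun x => (⟨x, s x⟩ : TotalSpace F A)) ((extChartAt 𝓘(ℝ, E) p).symm y)) :
    ContDiffAt ℝ ∞ (coordRep E F p s) y := by
  rw [← contMDiffAt_iff_contDiffAt]
  exact (contMDiffAt_linearMapAt_section hy.2.2.2 hs).comp y
    (contMDiffOn_extChartAt_symm_coordTarget.contMDiffAt (isOpen_coordTarget.mem_nhds hy))

theorem contDiffOn_coordRep (s : Cₛ^∞⟮𝓘(ℝ, E); F, A⟯) :
    ContDiffOn ℝ ∞ (coordRep E F p s) (coordTarget E F A p) := fun _ hy =>
  (contDiffAt_coordRep hy s.contMDiff.contMDiffAt).contDiffWithinAt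

/-- The section with coordinate expression `a` near `p`, cut off to a global one. -/
def coordSection (p : M) (a : E → F) (ha : ContDiff ℝ ∞ a) : Cₛ^∞⟮𝓘(ℝ, E); F, A⟯ :=
  ⟨fun x => coordBump E F A p x •
      (trivializationAt F A p).symmₗ ℝ x (a (extChartAt 𝓘(ℝ, E) p x)), by
    refine ContMDiffOn.smul_section_of_tsupport (coordBump E F A p).contMDiff.contMDiffOn
      ((chartAt E p).open_source.inter (trivializationAt F A p).open_baseSet)
      (subset_inter ?_ (exists_coordBump E F A p).choose_spec) ?_
    · exact (coordBump E F A p).tsupport_subset_chartAt_source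
    · rw [Trivialization.contMDiffOn_section_iff (trivializationAt F A p)
        ((chartAt E p).open_source.inter (trivializationAt F A p).open_baseSet) inter_subset_right]
      have h : ContMDiffOn 𝓘(ℝ, E) 𝓘(ℝ, F) ∞ (fun x => a (extChartAt 𝓘(ℝ, E) p x))
          (chartAt E p).source := ha.contMDiff.comp_contMDiffOn contMDiffOn_extChartAt
      refine (h.mono inter_subset_left).congr fun x hx => ?_
      exact (congrFun (Trivialization.coe_linearMapAt_of_mem (R := ℝ) _ hx.2) _).symm.trans
        (Trivialization.linearMapAt_symmₗ _ hx.2 _)⟩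

theorem coordSection_apply {a : E → F} (ha : ContDiff ℝ ∞ a) (hx : x ∈ coordSource E F A p) :
    coordSection (A := A) p a ha x =
      (trivializationAt F A p).symmₗ ℝ x (a (extChartAt 𝓘(ℝ, E) p x)) := by
  change coordBump E F A p x • (trivializationAt F A p).symmₗ ℝ x _ = _
  rw [coordBump_eq_one hx, one_smul]

theorem coordRep_coordSection {a : E → F} (ha : ContDiff ℝ ∞ a) (hy : y ∈ coordTarget E F A p) :
    coordRep E F p (coordSection (A := A) p a ha) y = a y := by
  rw [coordRep, coordSection_apply ha hy.2, extChartAt_right_inv hy,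
    Trivialization.linearMapAt_symmₗ _ hy.2.2.2]

variable (E A) in
/-- The sections that are constant in coordinates near `p`. -/
def coordFrame (p : M) : F →ₗ[ℝ] Cₛ^∞⟮𝓘(ℝ, E); F, A⟯ where
  toFun v := coordSection p (fun _ => v) contDiff_const
  map_add' v w := by
    ext x
    change coordBump E F A p x • (trivializationAt F A p).symmₗ ℝ x (v + w) =
      coordBump E F A p x • (trivializationAt F A p).symmₗ ℝ x v +
      coordBump E F A p x • (trivializationAt F A p).symmₗ ℝ x w
    rw [map_add, smul_add]
  map_smul' c v := by
    ext x
    change coordBump E F A p x • (trivializationAt F A p).symmₗ ℝ x (c • v) =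
      c • coordBump E F A p x • (trivializationAt F A p).symmₗ ℝ x v
    rw [map_smul, smul_comm]

theorem coordFrame_apply (v : F) (hx : x ∈ coordSource E F A p) :
    coordFrame E A p v x = (trivializationAt F A p).symmₗ ℝ x v :=
  coordSection_apply contDiff_const hx

theorem symmₗ_coordRep (s : (x : M) → A x) (hx : x ∈ coordSource E F A p) :
    (trivializationAt F A p).symmₗ ℝ x (coordRep E F p s (extChartAt 𝓘(ℝ, E) p x)) = s x := by
  rw [coordRep, extChartAt_left_inv hx, Trivialization.symmₗ_linearMapAt _ hx.2.2]

end Coordinates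


section CoordModelLocality

variable {E : Type*} [NormedAddCommGroup E] [NormedSpace ℝ E]
  {F : Type*} [NormedAddCommGroup F] [NormedSpace ℝ F] {y : E}

theorem CoordModel.deriv_congr (m : CoordModel E F) {a a' : E → F} (h : a =ᶠ[𝓝 y] a') :
    m.deriv a y = m.deriv a' y := by
  rw [deriv, deriv, h.fderiv_eq, h.self_of_nhds]

theorem CoordModel.bracket_congr (m : CoordModel E F) {a a' b b' : E → F} (h : a =ᶠ[𝓝 y] a')
    (h' : b =ᶠ[𝓝 y] b') : m.bracket a b y = m.bracket a' b' y := by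
  rw [bracket, bracket, h.fderiv_eq, h.self_of_nhds, h'.fderiv_eq, h'.self_of_nhds]

end CoordModelLocality

/-! ### Coordinate expressions of derivations and brackets -/

section CoordinateExpressions

set_option linter.unusedSectionVars false

variable {E : Type*} [NormedAddCommGroup E] [NormedSpace ℝ E] [FiniteDimensional ℝ E]
  {M : Type*} [TopologicalSpace M] [ChartedSpace E M] [IsManifold 𝓘(ℝ, E) ∞ M] [T2Space M]
  {F : Type*} [NormedAddCommGroup F] [NormedSpace ℝ F]
  {A : M → Type*} [TopologicalSpace (TotalSpace F A)] [∀ x, TopologicalSpace (A x)]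
  [∀ x, AddCommGroup (A x)] [∀ x, Module ℝ (A x)] [FiberBundle F A] [VectorBundle ℝ F A]
  {p x : M} {y : E}

/-- The coordinate expression of a vector field in the chart at `p`. -/
def coordVF (p : M) (X : (x : M) → TangentSpace 𝓘(ℝ, E) x) (y : E) : E :=
  mfderiv 𝓘(ℝ, E) 𝓘(ℝ, E) (extChartAt 𝓘(ℝ, E) p) ((extChartAt 𝓘(ℝ, E) p).symm y)
    (X ((extChartAt 𝓘(ℝ, E) p).symm y))

theorem contDiffOn_coordVF (X : Cₛ^∞⟮𝓘(ℝ, E); E, (TangentSpace 𝓘(ℝ, E) : M → Type _)⟯) :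
    ContDiffOn ℝ ∞ (coordVF p X) (coordTarget E F A p) := by
  intro y hy
  refine ContDiffAt.contDiffWithinAt ?_
  rw [← contMDiffAt_iff_contDiffAt]
  have hx := hy.2.2.1
  have h := (Trivialization.contMDiffAt_section_iff
    (trivializationAt E (TangentSpace 𝓘(ℝ, E)) p) (by simpa using hx)).1 (X.contMDiff _)
  have h2 : ContMDiffAt 𝓘(ℝ, E) 𝓘(ℝ, E) ∞
      (fun z => (mfderiv 𝓘(ℝ, E) 𝓘(ℝ, E) (extChartAt 𝓘(ℝ, E) p) z (X z) : E))
      ((extChartAt 𝓘(ℝ, E) p).symm y) := by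
    refine h.congr_of_eventuallyEq ?_
    filter_upwards [(chartAt E p).open_source.mem_nhds hx] with z hz
    have h3 := TangentBundle.continuousLinearMapAt_trivializationAt (𝕜 := ℝ) (I := 𝓘(ℝ, E)) hz
    have h4 := congrFun (Trivialization.coe_linearMapAt_of_mem (R := ℝ)
      (trivializationAt E (TangentSpace 𝓘(ℝ, E)) p) (b := z) (by simpa using hz)) (X z)
    exact (DFunLike.congr_fun h3 (X z)).symm.trans h4
  exact h2.comp y
    (contMDiffOn_extChartAt_symm_coordTarget.contMDiffAt (isOpen_coordTarget.mem_nhds hy))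

theorem ContMDiffSection.sum_apply {ι : Type*} (t : Finset ι) (s : ι → Cₛ^∞⟮𝓘(ℝ, E); F, A⟯)
    (x : M) : (∑ i ∈ t, s i) x = ∑ i ∈ t, s i x := by
  have h := map_sum (ContMDiffSection.coeAddHom 𝓘(ℝ, E) F ∞ A) s t
  have h2 := congrFun h x
  simpa only [ContMDiffSection.coeAddHom_apply, Finset.sum_apply] using h2

/-- A linear derivation is a local operator. -/
theorem LinearDerivation.congr_of_eventuallyEq (D : LinearDerivation E F A)
    {s s' : Cₛ^∞⟮𝓘(ℝ, E); F, A⟯} (h : ∀ᶠ z in 𝓝 x, s z = s' z) :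
    D.toLinearMap s x = D.toLinearMap s' x := by
  obtain ⟨V, hV, hVo, hxV⟩ := mem_nhds_iff.1 h
  obtain ⟨ψ, hψ, -⟩ := (SmoothBumpFunction.nhds_basis_support (I := 𝓘(ℝ, E))
    (hVo.mem_nhds hxV)).mem_iff.1 (hVo.mem_nhds hxV)
  let f : C^∞⟮𝓘(ℝ, E), M; ℝ⟯ := ⟨ψ, ψ.contMDiff⟩
  have hf : f x = 1 := ψ.eq_one
  have hss : s x = s' x := h.self_of_nhds
  have key : smulSection f s = smulSection f s' := by
    ext y
    change ψ y • s y = ψ y • s' y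
    by_cases hy : y ∈ V
    · rw [show s y = s' y from hV hy]
    · have : ψ y = 0 := by
        by_contra h0
        exact hy (hψ (subset_tsupport _ h0))
      rw [this, zero_smul, zero_smul]
  have h1 := D.leibniz f s x
  have h2 := D.leibniz f s' x
  rw [key, h2, hf, hss, one_smul, one_smul] at h1
  exact (add_right_cancel h1).symm

/-- Bracket with a fixed section, as a linear derivation. -/
def LieAlgebroid.ad (L : LieAlgebroid E F A) (a : Cₛ^∞⟮𝓘(ℝ, E); F, A⟯) :
    LinearDerivation E F A where
  toLinearMap := L.bracket a
  symbol := ⟨fun x => L.anchor x (a x), L.contMDiff_anchor.comp a.contMDiff⟩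
  leibniz := L.leibniz a

theorem LieAlgebroid.bracket_skew (L : LieAlgebroid E F A) (c d : Cₛ^∞⟮𝓘(ℝ, E); F, A⟯) :
    L.bracket c d = -L.bracket d c := by
  have h := L.bracket_self (c + d)
  simp only [map_add, LinearMap.add_apply, L.bracket_self, zero_add, add_zero] at h
  exact eq_neg_of_add_eq_zero_right h

theorem coordRep_add (s s' : (x : M) → A x) :
    coordRep E F p (s + s') = coordRep E F p s + coordRep E F p s' := by
  funext y
  exact map_add _ _ _

theorem coordRep_smul (c : ℝ) (s : (x : M) → A x) :
    coordRep E F p (c • s) = c • coordRep E F p s := by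
  funext y
  exact map_smul _ _ _

variable [ContMDiffVectorBundle ∞ F A 𝓘(ℝ, E)]

/-- The coordinate expression at `y`, as a linear map on sections. -/
def coordRepₗ (p : M) (y : E) : Cₛ^∞⟮𝓘(ℝ, E); F, A⟯ →ₗ[ℝ] F where
  toFun s := coordRep E F p s y
  map_add' s s' := congrFun (coordRep_add (s : (x : M) → A x) s') y
  map_smul' c s := congrFun (coordRep_smul c (s : (x : M) → A x)) y

theorem coordRepₗ_apply (s : Cₛ^∞⟮𝓘(ℝ, E); F, A⟯) : coordRepₗ p y s = coordRep E F p s y := rfl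

/-- The `l`-component of the coordinate expression of a section, cut off to a global function. -/
def coordComponent (p : M) (l : F →L[ℝ] ℝ) (s : Cₛ^∞⟮𝓘(ℝ, E); F, A⟯) :
    C^∞⟮𝓘(ℝ, E), M; ℝ⟯ :=
  ⟨fun x => coordBump E F A p x • l ((trivializationAt F A p).linearMapAt ℝ x (s x)), by
    refine contMDiff_of_tsupport fun x hx => ?_
    have hx' := tsupport_smul_subset_left _ _ hx
    refine (coordBump E F A p).contMDiff.contMDiffAt.smul ?_
    exact l.contMDiff.contMDiffAt.comp x (contMDiffAt_linearMapAt_section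
      ((exists_coordBump E F A p).choose_spec hx') (s.contMDiff x))⟩

theorem coordComponent_eventuallyEq (l : F →L[ℝ] ℝ) (s : Cₛ^∞⟮𝓘(ℝ, E); F, A⟯)
    (hx : x ∈ coordSource E F A p) :
    (coordComponent p l s : M → ℝ) =ᶠ[𝓝 x]
      fun z => l (coordRep E F p s (extChartAt 𝓘(ℝ, E) p z)) := by
  filter_upwards [isOpen_coordSource.mem_nhds hx] with z hz
  change coordBump E F A p z • l ((trivializationAt F A p).linearMapAt ℝ z (s z)) = _
  rw [coordBump_eq_one hz, one_smul, coordRep, extChartAt_left_inv hz]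

/-- The derivative of a function along a vector field can be computed in coordinates. -/
theorem dirDeriv_comp_extChartAt {g : E → ℝ} (hx : x ∈ coordSource E F A p)
    (hg : DifferentiableAt ℝ g (extChartAt 𝓘(ℝ, E) p x)) (v : TangentSpace 𝓘(ℝ, E) x) :
    dirDeriv (fun z => g (extChartAt 𝓘(ℝ, E) p z)) x v =
      fderiv ℝ g (extChartAt 𝓘(ℝ, E) p x)
        (mfderiv 𝓘(ℝ, E) 𝓘(ℝ, E) (extChartAt 𝓘(ℝ, E) p) x v) := by
  have h := HasMFDerivAt.comp x hg.hasFDerivAt.hasMFDerivAt (hasMFDerivAt_extChartAt_coord hx)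
  exact DFunLike.congr_fun h.mfderiv v

theorem dirDeriv_congr {f g : M → ℝ} (h : f =ᶠ[𝓝 x] g) (v : TangentSpace 𝓘(ℝ, E) x) :
    dirDeriv f x v = dirDeriv g x v := by
  rw [dirDeriv, dirDeriv, h.mfderiv_eq]
  rfl

variable [FiniteDimensional ℝ F]

/-- A linear derivation in coordinates: it is determined by its symbol and by its values on constant
sections. -/
theorem LinearDerivation.coordRep_apply (D : LinearDerivation E F A) (s : Cₛ^∞⟮𝓘(ℝ, E); F, A⟯)
    (hy : y ∈ coordTarget E F A p) :
    coordRep E F p (D.toLinearMap s) y =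
      fderiv ℝ (coordRep E F p s) y (coordVF p D.symbol y) +
        coordRep E F p (D.toLinearMap (coordFrame E A p (coordRep E F p s y))) y := by
  let b := Module.finBasis ℝ F
  let l := fun k => LinearMap.toContinuousLinearMap (b.coord k)
  have hl : ∀ w : F, ∑ k, l k w • b k = w := b.sum_repr
  set x := (extChartAt 𝓘(ℝ, E) p).symm y with hxdef
  have hx : x ∈ coordSource E F A p := hy.2
  have hxy : extChartAt 𝓘(ℝ, E) p x = y := extChartAt_right_inv hy
  have hdiff : DifferentiableAt ℝ (coordRep E F p s) y :=
    (contDiffAt_coordRep hy s.contMDiff.contMDiffAt).differentiableAt (by simp)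
  have h1 : ∀ᶠ z in 𝓝 x, s z =
      (∑ k, smulSection (coordComponent p (l k) s) (coordFrame E A p (b k))) z := by
    filter_upwards [isOpen_coordSource.mem_nhds hx] with z hz
    rw [ContMDiffSection.sum_apply]
    change _ = ∑ k, coordComponent p (l k) s z • coordFrame E A p (b k) z
    simp only [coordFrame_apply _ hz, (coordComponent_eventuallyEq _ s hz).self_of_nhds]
    rw [← symmₗ_coordRep s hz]
    simp only [← map_smul, ← map_sum, hl]
  have h2 : D.toLinearMap s x = ∑ k, (coordComponent p (l k) s x •
      D.toLinearMap (coordFrame E A p (b k)) x +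
      dirDeriv (coordComponent p (l k) s) x (D.symbol x) • coordFrame E A p (b k) x) := by
    rw [D.congr_of_eventuallyEq h1, map_sum, ContMDiffSection.sum_apply]
    exact Finset.sum_congr rfl fun k _ => D.leibniz _ _ _
  have h3 : ∀ k, dirDeriv (coordComponent p (l k) s) x (D.symbol x) =
      l k (fderiv ℝ (coordRep E F p s) y (coordVF p D.symbol y)) := by
    intro k
    rw [← hxy] at hdiff
    rw [dirDeriv_congr (coordComponent_eventuallyEq (l k) s hx),
      dirDeriv_comp_extChartAt (g := fun z => l k (coordRep E F p s z)) hx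
        ((l k).differentiableAt.comp _ hdiff)]
    have h4 : HasFDerivAt (fun z => l k (coordRep E F p s z)) _ (extChartAt 𝓘(ℝ, E) p x) :=
      (l k).hasFDerivAt.comp _ hdiff.hasFDerivAt
    rw [h4.fderiv, hxy]
    rfl
  have h5 : ∀ k, coordComponent p (l k) s x = l k (coordRep E F p s y) := fun k => by
    rw [(coordComponent_eventuallyEq (l k) s hx).self_of_nhds]
    exact congrArg (fun z => l k (coordRep E F p s z)) hxy
  have h6 : coordRep E F p (D.toLinearMap s) y =
      ∑ k, (l k (coordRep E F p s y) • coordRep E F p (D.toLinearMap (coordFrame E A p (b k))) y +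
        l k (fderiv ℝ (coordRep E F p s) y (coordVF p D.symbol y)) • b k) := by
    rw [coordRep, ← hxdef, h2, map_sum]
    refine Finset.sum_congr rfl fun k _ => ?_
    rw [map_add, map_smul, map_smul, h3, h5, coordFrame_apply _ hx,
      Trivialization.linearMapAt_symmₗ _ hx.2.2]
    rfl
  have h7 : ∑ k, l k (coordRep E F p s y) •
      coordRep E F p (D.toLinearMap (coordFrame E A p (b k))) y =
      coordRep E F p (D.toLinearMap (coordFrame E A p (coordRep E F p s y))) y := by
    simp only [← coordRepₗ_apply, ← map_smul, ← map_sum]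
    rw [coordRepₗ_apply, hl]
    rfl
  rw [h6, Finset.sum_add_distrib, hl, h7, add_comm]

theorem LieAlgebroid.coordVF_ad (L : LieAlgebroid E F A) (a : Cₛ^∞⟮𝓘(ℝ, E); F, A⟯)
    (hy : y ∈ coordTarget E F A p) :
    coordVF p (L.ad a).symbol y =
      coordVF p (L.ad (coordFrame E A p (coordRep E F p a y))).symbol y := by
  have h : coordFrame E A p (coordRep E F p a y) ((extChartAt 𝓘(ℝ, E) p).symm y) =
      a ((extChartAt 𝓘(ℝ, E) p).symm y) := by
    rw [coordFrame_apply _ hy.2]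
    have h1 := symmₗ_coordRep (F := F) (p := p) a hy.2
    rwa [extChartAt_right_inv hy] at h1
  change mfderiv 𝓘(ℝ, E) 𝓘(ℝ, E) (extChartAt 𝓘(ℝ, E) p) _ (L.anchor _ (a _)) =
    mfderiv 𝓘(ℝ, E) 𝓘(ℝ, E) (extChartAt 𝓘(ℝ, E) p) _
      (L.anchor _ (coordFrame E A p (coordRep E F p a y) _))
  rw [h]

/-- The bracket of a Lie algebroid in coordinates. Both arguments are reduced to constant sections
by the coordinate formula for the derivations `[a, ·]`. -/
theorem LieAlgebroid.coordRep_bracket (L : LieAlgebroid E F A) (a b : Cₛ^∞⟮𝓘(ℝ, E); F, A⟯)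
    (hy : y ∈ coordTarget E F A p) :
    coordRep E F p (L.bracket a b) y =
      coordRep E F p (L.bracket (coordFrame E A p (coordRep E F p a y))
        (coordFrame E A p (coordRep E F p b y))) y
      + fderiv ℝ (coordRep E F p b) y
        (coordVF p (L.ad (coordFrame E A p (coordRep E F p a y))).symbol y)
      - fderiv ℝ (coordRep E F p a) y
        (coordVF p (L.ad (coordFrame E A p (coordRep E F p b y))).symbol y) := by
  have hskew : ∀ c d : Cₛ^∞⟮𝓘(ℝ, E); F, A⟯,
      coordRep E F p (L.bracket c d) y = -coordRep E F p (L.bracket d c) y := fun c d => by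
    rw [← coordRepₗ_apply, ← coordRepₗ_apply, L.bracket_skew c d, map_neg]
  have h1 := (L.ad a).coordRep_apply b hy
  have h2 := (L.ad (coordFrame E A p (coordRep E F p b y))).coordRep_apply a hy
  change coordRep E F p (L.bracket a b) y = _ + coordRep E F p (L.bracket a _) y at h1
  change coordRep E F p (L.bracket _ a) y = _ + coordRep E F p (L.bracket _ _) y at h2
  rw [h1, hskew a, h2, L.coordVF_ad a hy, hskew (coordFrame E A p (coordRep E F p a y))]
  abel

/-- The anchor in coordinates near `p`. -/
def coordAnchor (L : LieAlgebroid E F A) (p : M) (y : E) : F →ₗ[ℝ] E :=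
  let dκ : TangentSpace 𝓘(ℝ, E) ((extChartAt 𝓘(ℝ, E) p).symm y) →ₗ[ℝ] E :=
    (mfderiv 𝓘(ℝ, E) 𝓘(ℝ, E) (extChartAt 𝓘(ℝ, E) p)
      ((extChartAt 𝓘(ℝ, E) p).symm y)).toLinearMap
  { toFun := fun v => coordVF p (L.ad (coordFrame E A p v)).symbol y
    map_add' := fun v w => (congrArg (fun s : Cₛ^∞⟮𝓘(ℝ, E); F, A⟯ =>
        (dκ ∘ₗ L.anchor _) (s ((extChartAt 𝓘(ℝ, E) p).symm y)))
      (map_add (coordFrame E A p) v w)).trans (map_add (dκ ∘ₗ L.anchor _) _ _)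
    map_smul' := fun c v => (congrArg (fun s : Cₛ^∞⟮𝓘(ℝ, E); F, A⟯ =>
        (dκ ∘ₗ L.anchor _) (s ((extChartAt 𝓘(ℝ, E) p).symm y)))
      (map_smul (coordFrame E A p) c v)).trans (map_smul (dκ ∘ₗ L.anchor _) _ _) }

/-- A Lie algebroid with a linear derivation, in coordinates near `p`. -/
def coordModel (L : LieAlgebroid E F A) (D : LinearDerivation E F A) (p : M) : CoordModel E F where
  dom := coordTarget E F A p
  vf := coordVF p D.symbol
  der y := LinearMap.toContinuousLinearMap
    ((coordRepₗ p y).comp (D.toLinearMap.comp (coordFrame E A p)))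
  anc y := LinearMap.toContinuousLinearMap (coordAnchor L p y)
  brk y := LinearMap.toContinuousLinearMap
    ((LinearMap.toContinuousLinearMap : (F →ₗ[ℝ] F) ≃ₗ[ℝ] (F →L[ℝ] F)).toLinearMap.comp
      ((L.bracket.compl₁₂ (coordFrame E A p) (coordFrame E A p)).compr₂ (coordRepₗ p y)))
  isOpen_dom := isOpen_coordTarget
  contDiffOn_vf := contDiffOn_coordVF D.symbol
  contDiffOn_der := contDiffOn_clm_apply.2 fun _ => contDiffOn_coordRep _
  contDiffOn_anc := contDiffOn_clm_apply.2 fun _ => contDiffOn_coordVF _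
  contDiffOn_brk := contDiffOn_clm_apply.2 fun _ => contDiffOn_clm_apply.2 fun _ =>
    contDiffOn_coordRep _

theorem coordRep_derivation (L : LieAlgebroid E F A) (D : LinearDerivation E F A)
    (s : Cₛ^∞⟮𝓘(ℝ, E); F, A⟯) (hy : y ∈ coordTarget E F A p) :
    coordRep E F p (D.toLinearMap s) y = (coordModel L D p).deriv (coordRep E F p s) y :=
  D.coordRep_apply s hy

theorem coordRep_bracket (L : LieAlgebroid E F A) (D : LinearDerivation E F A)
    (a b : Cₛ^∞⟮𝓘(ℝ, E); F, A⟯) (hy : y ∈ coordTarget E F A p) :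
    coordRep E F p (L.bracket a b) y =
      (coordModel L D p).bracket (coordRep E F p a) (coordRep E F p b) y :=
  L.coordRep_bracket a b hy

theorem isDerivation_coordModel {L : LieAlgebroid E F A} {D : LinearDerivation E F A}
    (hD : L.IsDerivation D) (p : M) : (coordModel L D p).IsDerivation := by
  intro a b ha hb y hy
  change y ∈ coordTarget E F A p at hy
  set m := coordModel L D p
  let s : Cₛ^∞⟮𝓘(ℝ, E); F, A⟯ := coordSection p a ha
  let t : Cₛ^∞⟮𝓘(ℝ, E); F, A⟯ := coordSection p b hb
  have hn := isOpen_coordTarget.mem_nhds hy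
  have hs : coordRep E F p s =ᶠ[𝓝 y] a := by
    filter_upwards [hn] with z hz using coordRep_coordSection ha hz
  have ht : coordRep E F p t =ᶠ[𝓝 y] b := by
    filter_upwards [hn] with z hz using coordRep_coordSection hb hz
  have hDs : ∀ {u : Cₛ^∞⟮𝓘(ℝ, E); F, A⟯} {c : E → F}, coordRep E F p u =ᶠ[𝓝 y] c →
      coordRep E F p (D.toLinearMap u) =ᶠ[𝓝 y] m.deriv c := by
    intro u c hu
    filter_upwards [hn, hu.eventuallyEq_nhds] with z hz hz'
    rw [coordRep_derivation L D u hz, m.deriv_congr hz']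
  have hbr : ∀ {u w : Cₛ^∞⟮𝓘(ℝ, E); F, A⟯} {c d : E → F}, coordRep E F p u =ᶠ[𝓝 y] c →
      coordRep E F p w =ᶠ[𝓝 y] d →
      coordRep E F p (L.bracket u w) =ᶠ[𝓝 y] m.bracket c d := by
    intro u w c d hu hw
    filter_upwards [hn, hu.eventuallyEq_nhds, hw.eventuallyEq_nhds] with z hz hz' hz''
    rw [coordRep_bracket L D u w hz, m.bracket_congr hz' hz'']
  have key := congrArg (coordRepₗ p y) (hD s t)
  rw [map_add] at key
  simp only [coordRepₗ_apply] at key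
  rw [← (hDs (hbr hs ht)).self_of_nhds, ← (hbr (hDs hs) ht).self_of_nhds,
    ← (hbr hs (hDs ht)).self_of_nhds]
  exact key

end CoordinateExpressions


/-! ### The linear vector field of a derivation in coordinates -/

section LinearVectorField

set_option linter.unusedSectionVars false

variable {E : Type*} [NormedAddCommGroup E] [NormedSpace ℝ E] [FiniteDimensional ℝ E]
  {M : Type*} [TopologicalSpace M] [ChartedSpace E M] [IsManifold 𝓘(ℝ, E) ∞ M] [T2Space M]
  {F : Type*} [NormedAddCommGroup F] [NormedSpace ℝ F]
  {A : M → Type*} [TopologicalSpace (TotalSpace F A)] [∀ x, TopologicalSpace (A x)]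
  [∀ x, AddCommGroup (A x)] [∀ x, Module ℝ (A x)] [FiberBundle F A] [VectorBundle ℝ F A]
  {p x : M} {y : E} {e : TotalSpace F A}

theorem coordVF_extChartAt {X : (x : M) → TangentSpace 𝓘(ℝ, E) x}
    (hx : x ∈ coordSource E F A p) :
    coordVF p X (extChartAt 𝓘(ℝ, E) p x) =
      mfderiv 𝓘(ℝ, E) 𝓘(ℝ, E) (extChartAt 𝓘(ℝ, E) p) x (X x) :=
  congrArg (fun z => (mfderiv 𝓘(ℝ, E) 𝓘(ℝ, E) (extChartAt 𝓘(ℝ, E) p) z (X z) : E))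
    (extChartAt_left_inv hx)

variable (E) in
/-- The coordinates of a point of the total space in the chart and the trivialization at `p`. -/
def coordTotal (p : M) (e : TotalSpace F A) : E × F :=
  (extChartAt 𝓘(ℝ, E) p e.1, (trivializationAt F A p).linearMapAt ℝ e.1 e.2)

variable (A) in
/-- The point of the total space with given coordinates in the chart and the trivialization
at `p`. -/
def coordTotalSymm (p : M) (z : E × F) : TotalSpace F A :=
  ⟨(extChartAt 𝓘(ℝ, E) p).symm z.1,
    (trivializationAt F A p).symmₗ ℝ ((extChartAt 𝓘(ℝ, E) p).symm z.1) z.2⟩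

theorem coordTotal_coordTotalSymm {z : E × F} (hz : z.1 ∈ coordTarget E F A p) :
    coordTotal E p (coordTotalSymm A p z) = z :=
  Prod.ext (extChartAt_right_inv hz) (Trivialization.linearMapAt_symmₗ _ hz.2.2.2 _)

theorem coordTotalSymm_mk (hx : x ∈ coordSource E F A p) (w : F) :
    coordTotalSymm A p (extChartAt 𝓘(ℝ, E) p x, w) =
      ⟨x, (trivializationAt F A p).symmₗ ℝ x w⟩ :=
  congrArg (fun z => (⟨z, (trivializationAt F A p).symmₗ ℝ z w⟩ : TotalSpace F A))
    (extChartAt_left_inv hx)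

theorem coordTotalSymm_coordTotal (he : e.1 ∈ coordSource E F A p) :
    coordTotalSymm A p (coordTotal E p e) = e := by
  rw [coordTotal, coordTotalSymm_mk he, Trivialization.symmₗ_linearMapAt _ he.2.2]

theorem coordTotal_section (s : (x : M) → A x) (hx : x ∈ coordSource E F A p) :
    coordTotal E p (⟨x, s x⟩ : TotalSpace F A) =
      (extChartAt 𝓘(ℝ, E) p x, coordRep E F p s (extChartAt 𝓘(ℝ, E) p x)) :=
  congrArg (fun z => (extChartAt 𝓘(ℝ, E) p x, (trivializationAt F A p).linearMapAt ℝ z (s z)))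
    (extChartAt_left_inv hx).symm

theorem isOpen_proj_preimage {U : Set M} (hU : IsOpen U) : IsOpen {e : TotalSpace F A | e.1 ∈ U} :=
  hU.preimage (FiberBundle.continuous_proj F A)

variable [ContMDiffVectorBundle ∞ F A 𝓘(ℝ, E)]

theorem contMDiffAt_coordTotal (he : e.1 ∈ coordSource E F A p) :
    ContMDiffAt (𝓘(ℝ, E).prod 𝓘(ℝ, F)) 𝓘(ℝ, E × F) ∞ (coordTotal E p) e := by
  refine ContMDiffAt.prodMk_space ?_ ?_
  · exact (contMDiffOn_extChartAt_coordSource.contMDiffAt (isOpen_coordSource.mem_nhds he)).comp e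
      (Bundle.contMDiff_proj A e)
  · have hs : (trivializationAt F A p).source ∈ 𝓝 e :=
      (trivializationAt F A p).open_source.mem_nhds
        ((trivializationAt F A p).mem_source.2 he.2.2)
    have h := ((trivializationAt F A p).contMDiffOn (IB := 𝓘(ℝ, E)) (n := ∞)).contMDiffAt hs
    refine (contMDiffAt_snd.comp e h).congr_of_eventuallyEq ?_
    filter_upwards [hs] with z hz
    exact congrFun (Trivialization.coe_linearMapAt_of_mem (R := ℝ) _
      ((trivializationAt F A p).mem_source.1 hz)) z.2

theorem contMDiffAt_coordTotalSymm {z : E × F} (hz : z.1 ∈ coordTarget E F A p) :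
    ContMDiffAt 𝓘(ℝ, E × F) (𝓘(ℝ, E).prod 𝓘(ℝ, F)) ∞ (coordTotalSymm A p) z := by
  have h1 := contMDiffOn_extChartAt_symm_coordTarget.contMDiffAt (isOpen_coordTarget.mem_nhds hz)
  have h2 : ContMDiffAt 𝓘(ℝ, E × F) 𝓘(ℝ, E) ∞
      (fun z : E × F => (extChartAt 𝓘(ℝ, E) p).symm z.1) z :=
    ContMDiffAt.comp z h1 contDiff_fst.contMDiff.contMDiffAt
  have ht : ((extChartAt 𝓘(ℝ, E) p).symm z.1, z.2) ∈ (trivializationAt F A p).target :=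
    (trivializationAt F A p).mem_target.2 hz.2.2.2
  have h3 := ((trivializationAt F A p).contMDiffOn_symm (IB := 𝓘(ℝ, E)) (n := ∞)).contMDiffAt
    ((trivializationAt F A p).open_target.mem_nhds ht)
  refine (ContMDiffAt.comp z h3
    (h2.prodMk (contDiff_snd.contMDiff.contMDiffAt))).congr_of_eventuallyEq ?_
  filter_upwards [(isOpen_coordTarget.preimage continuous_fst).mem_nhds hz] with w hw
  have hb : (extChartAt 𝓘(ℝ, E) p).symm w.1 ∈ (trivializationAt F A p).baseSet := hw.2.2.2
  rw [coordTotalSymm, Trivialization.coe_symmₗ _ hb]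
  exact (trivializationAt F A p).mk_symm hb w.2

theorem hasMFDerivAt_coordTotal (he : e.1 ∈ coordSource E F A p) :
    HasMFDerivAt (𝓘(ℝ, E).prod 𝓘(ℝ, F)) 𝓘(ℝ, E × F) (coordTotal E p) e
      (mfderiv (𝓘(ℝ, E).prod 𝓘(ℝ, F)) 𝓘(ℝ, E × F) (coordTotal E p) e) :=
  ((contMDiffAt_coordTotal he).mdifferentiableAt (by simp)).hasMFDerivAt

theorem hasMFDerivAt_coordTotalSymm {z : E × F} (hz : z.1 ∈ coordTarget E F A p) :
    HasMFDerivAt 𝓘(ℝ, E × F) (𝓘(ℝ, E).prod 𝓘(ℝ, F)) (coordTotalSymm A p) z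
      (mfderiv 𝓘(ℝ, E × F) (𝓘(ℝ, E).prod 𝓘(ℝ, F)) (coordTotalSymm A p) z) :=
  ((contMDiffAt_coordTotalSymm hz).mdifferentiableAt (by simp)).hasMFDerivAt

theorem mfderiv_coordTotalSymm_comp (he : e.1 ∈ coordSource E F A p) :
    (mfderiv 𝓘(ℝ, E × F) (𝓘(ℝ, E).prod 𝓘(ℝ, F)) (coordTotalSymm A p) (coordTotal E p e)).comp
      (mfderiv (𝓘(ℝ, E).prod 𝓘(ℝ, F)) 𝓘(ℝ, E × F) (coordTotal E p) e) =
      ContinuousLinearMap.id ℝ (E × F) := by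
  have h := HasMFDerivAt.comp e
    (hasMFDerivAt_coordTotalSymm (A := A) (extChartAt_mem_coordTarget he))
    (hasMFDerivAt_coordTotal he)
  have h2 : HasMFDerivAt (𝓘(ℝ, E).prod 𝓘(ℝ, F)) (𝓘(ℝ, E).prod 𝓘(ℝ, F))
      (coordTotalSymm A p ∘ coordTotal E p) e (ContinuousLinearMap.id ℝ _) := by
    refine (hasMFDerivAt_id e).congr_of_eventuallyEq ?_
    filter_upwards [(isOpen_proj_preimage isOpen_coordSource).mem_nhds he] with z hz
      using coordTotalSymm_coordTotal hz
  exact hasMFDerivAt_unique h h2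

theorem mfderiv_coordTotal_comp (he : e.1 ∈ coordSource E F A p) :
    (mfderiv (𝓘(ℝ, E).prod 𝓘(ℝ, F)) 𝓘(ℝ, E × F) (coordTotal E p) e).comp
    (mfderiv 𝓘(ℝ, E × F) (𝓘(ℝ, E).prod 𝓘(ℝ, F)) (coordTotalSymm A p) (coordTotal E p e)) =
      ContinuousLinearMap.id ℝ (E × F) := by
  have hz : (coordTotal E p e).1 ∈ coordTarget E F A p := extChartAt_mem_coordTarget he
  have h1 : HasMFDerivAt (𝓘(ℝ, E).prod 𝓘(ℝ, F)) 𝓘(ℝ, E × F) (coordTotal E p)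
      (coordTotalSymm A p (coordTotal E p e))
      (mfderiv (𝓘(ℝ, E).prod 𝓘(ℝ, F)) 𝓘(ℝ, E × F) (coordTotal E p) e) := by
    have key : ∀ e', e' = e → HasMFDerivAt (𝓘(ℝ, E).prod 𝓘(ℝ, F)) 𝓘(ℝ, E × F) (coordTotal E p) e'
        (mfderiv (𝓘(ℝ, E).prod 𝓘(ℝ, F)) 𝓘(ℝ, E × F) (coordTotal E p) e) := by
      rintro e' rfl
      exact hasMFDerivAt_coordTotal he
    exact key _ (coordTotalSymm_coordTotal he)
  have h := HasMFDerivAt.comp _ h1 (hasMFDerivAt_coordTotalSymm hz)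
  have h2 : HasMFDerivAt 𝓘(ℝ, E × F) 𝓘(ℝ, E × F)
      (coordTotal E p ∘ coordTotalSymm A p) (coordTotal E p e) (ContinuousLinearMap.id ℝ _) := by
    refine (hasMFDerivAt_id _).congr_of_eventuallyEq ?_
    filter_upwards [(isOpen_coordTarget.preimage continuous_fst).mem_nhds hz] with w hw
      using coordTotal_coordTotalSymm hw
  exact hasMFDerivAt_unique h h2

variable [FiniteDimensional ℝ F]

/-- In coordinates, the vector field `D.liftAlong e s` does not depend on the section `s`: the
derivative of `s` in the horizontal term cancels with that in the vertical term. -/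
theorem mfderiv_coordTotal_liftAlong (L : LieAlgebroid E F A) (D : LinearDerivation E F A)
    (s : Cₛ^∞⟮𝓘(ℝ, E); F, A⟯) (hx : x ∈ coordSource E F A p) :
    (mfderiv (𝓘(ℝ, E).prod 𝓘(ℝ, F)) 𝓘(ℝ, E × F) (coordTotal E p)
      (⟨x, s x⟩ : TotalSpace F A) (D.liftAlong ⟨x, s x⟩ s) : E × F) =
      (coordVF p D.symbol (extChartAt 𝓘(ℝ, E) p x),
        -((coordModel L D p).der (extChartAt 𝓘(ℝ, E) p x)
          (coordRep E F p s (extChartAt 𝓘(ℝ, E) p x)))) := by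
  set y := extChartAt 𝓘(ℝ, E) p x with hydef
  have hy : y ∈ coordTarget E F A p := extChartAt_mem_coordTarget hx
  have hΘ := hasMFDerivAt_coordTotal (E := E) (p := p) (e := (⟨x, s x⟩ : TotalSpace F A)) hx
  set dΘ := mfderiv (𝓘(ℝ, E).prod 𝓘(ℝ, F)) 𝓘(ℝ, E × F) (coordTotal E p)
      (⟨x, s x⟩ : TotalSpace F A) with hdΘ
  have hκ := hasMFDerivAt_extChartAt_coord hx
  have hrep : HasFDerivAt (coordRep E F p s) _ y :=
    ((contDiffAt_coordRep hy s.contMDiff.contMDiffAt).differentiableAt (by simp)).hasFDerivAt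
  -- the horizontal term
  have hs : HasMFDerivAt 𝓘(ℝ, E) (𝓘(ℝ, E).prod 𝓘(ℝ, F))
      (fun x => (⟨x, s x⟩ : TotalSpace F A)) x _ :=
    (s.contMDiff.contMDiffAt.mdifferentiableAt (by simp)).hasMFDerivAt
  have h1 := HasMFDerivAt.comp x hΘ hs
  have h2 : HasMFDerivAt 𝓘(ℝ, E) 𝓘(ℝ, E × F)
      (coordTotal E p ∘ fun x => (⟨x, s x⟩ : TotalSpace F A)) x
      ((((ContinuousLinearMap.id ℝ E).prod (fderiv ℝ (coordRep E F p s) y)).comp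
        (mfderiv 𝓘(ℝ, E) 𝓘(ℝ, E) (extChartAt 𝓘(ℝ, E) p) x) :)) := by
    refine (HasMFDerivAt.comp x (((hasFDerivAt_id y).prodMk hrep).hasMFDerivAt) hκ
      ).congr_of_eventuallyEq ?_
    filter_upwards [isOpen_coordSource.mem_nhds hx] with z hz using coordTotal_section s hz
  have hh := DFunLike.congr_fun (hasMFDerivAt_unique h1 h2) (D.symbol x)
  -- the vertical term
  let lin := (trivializationAt F A p).linearMapAt ℝ x
  have hvert : ∀ t : ℝ, (⟨x, s x - t • D.toLinearMap s x⟩ : TotalSpace F A) =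
      coordTotalSymm A p (y, lin (s x) - t • lin (D.toLinearMap s x)) := fun t => by
    rw [coordTotalSymm_mk hx, ← map_smul, ← map_sub, Trivialization.symmₗ_linearMapAt _ hx.2.2]
  have hline : HasMFDerivAt 𝓘(ℝ, ℝ) 𝓘(ℝ, E × F)
      (fun t : ℝ => (y, lin (s x) - t • lin (D.toLinearMap s x))) 0
      (ContinuousLinearMap.toSpanSingleton ℝ ((0 : E), -lin (D.toLinearMap s x))) := by
    have : HasDerivAt (fun t : ℝ => (y, lin (s x) - t • lin (D.toLinearMap s x)))
        ((0 : E), -lin (D.toLinearMap s x)) 0 := by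
      refine (hasDerivAt_const _ _).prodMk ?_
      simpa using ((hasDerivAt_id (0 : ℝ)).smul_const (lin (D.toLinearMap s x))).const_sub
        (lin (s x))
    exact this.hasFDerivAt.hasMFDerivAt
  have hv1 : MDifferentiableAt 𝓘(ℝ, ℝ) (𝓘(ℝ, E).prod 𝓘(ℝ, F))
      (fun t : ℝ => (⟨x, s x - t • D.toLinearMap s x⟩ : TotalSpace F A)) 0 := by
    simp only [hvert]
    exact ((contMDiffAt_coordTotalSymm hy).mdifferentiableAt (by simp)).comp 0
      hline.mdifferentiableAt
  have hΘ' : HasMFDerivAt (𝓘(ℝ, E).prod 𝓘(ℝ, F)) 𝓘(ℝ, E × F) (coordTotal E p)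
      (⟨x, s x - (0 : ℝ) • D.toLinearMap s x⟩ : TotalSpace F A) dΘ := by
    have h0 : s x = s x - (0 : ℝ) • D.toLinearMap s x := by rw [zero_smul, sub_zero]
    rw [← h0]; exact hΘ
  have h3 := HasMFDerivAt.comp (0 : ℝ) hΘ' hv1.hasMFDerivAt
  have h4 : HasMFDerivAt 𝓘(ℝ, ℝ) 𝓘(ℝ, E × F)
      (coordTotal E p ∘ fun t : ℝ => (⟨x, s x - t • D.toLinearMap s x⟩ : TotalSpace F A)) 0
      (ContinuousLinearMap.toSpanSingleton ℝ ((0 : E), -lin (D.toLinearMap s x))) := by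
    refine hline.congr_of_eventuallyEq (Eventually.of_forall fun t => ?_)
    rw [Function.comp_apply, hvert, coordTotal_coordTotalSymm hy]
  have hv := DFunLike.congr_fun (hasMFDerivAt_unique h3 h4) (1 : ℝ)
  obtain ⟨X', hX'⟩ : ∃ X' : E, X' =
    mfderiv 𝓘(ℝ, E) 𝓘(ℝ, E) (extChartAt 𝓘(ℝ, E) p) x (D.symbol x) := ⟨_, rfl⟩
  have hvf : X' = coordVF p D.symbol y := hX'.trans (coordVF_extChartAt hx).symm
  have hD : lin (D.toLinearMap s x) =
      fderiv ℝ (coordRep E F p s) y (coordVF p D.symbol y) +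
        (coordModel L D p).der y (coordRep E F p s y) := by
    refine Eq.trans ?_ (coordRep_derivation L D s hy)
    exact congrArg (fun z => (trivializationAt F A p).linearMapAt ℝ z (D.toLinearMap s z))
      (extChartAt_left_inv hx).symm
  have hh' : (dΘ (mfderiv 𝓘(ℝ, E) (𝓘(ℝ, E).prod 𝓘(ℝ, F))
      (fun x => (⟨x, s x⟩ : TotalSpace F A)) x (D.symbol x)) : E × F) =
      (X', fderiv ℝ (coordRep E F p s) y X') := by
    rw [hX']; exact hh
  have hsum : (dΘ (D.liftAlong ⟨x, s x⟩ s) : E × F) =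
      (X', fderiv ℝ (coordRep E F p s) y X') + (1 : ℝ) • ((0 : E), -lin (D.toLinearMap s x)) :=
    (map_add dΘ _ _).trans (congrArg₂ (fun u v : E × F => u + v) hh' hv)
  have hE : ((X', fderiv ℝ (coordRep E F p s) y X') +
      (1 : ℝ) • ((0 : E), -lin (D.toLinearMap s x)) : E × F) =
        (coordVF p D.symbol y, -((coordModel L D p).der y (coordRep E F p s y))) := by
    rw [hvf, hD, one_smul]
    ext
    · simp
    · simp
  exact hsum.trans hE

/-- The linear vector field in coordinates: its base component is the symbol of the derivation, and
its fibre component is linear. -/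
theorem mfderiv_coordTotal_hat (L : LieAlgebroid E F A) (D : LinearDerivation E F A)
    (he : e.1 ∈ coordSource E F A p) :
    (mfderiv (𝓘(ℝ, E).prod 𝓘(ℝ, F)) 𝓘(ℝ, E × F) (coordTotal E p) e (D.hat e) : E × F) =
      (coordVF p D.symbol (coordTotal E p e).1,
        -((coordModel L D p).der (coordTotal E p e).1 (coordTotal E p e).2)) := by
  have key : ∀ s : Cₛ^∞⟮𝓘(ℝ, E); F, A⟯, s e.1 = e.2 →
      (mfderiv (𝓘(ℝ, E).prod 𝓘(ℝ, F)) 𝓘(ℝ, E × F) (coordTotal E p) e (D.liftAlong e s) : E × F) =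
        (coordVF p D.symbol (coordTotal E p e).1,
          -((coordModel L D p).der (coordTotal E p e).1 (coordTotal E p e).2)) := by
    obtain ⟨x, v⟩ := e
    intro s hs
    dsimp only at hs
    subst hs
    refine (mfderiv_coordTotal_liftAlong L D s he).trans ?_
    rw [coordTotal_section (E := E) (p := p) s he]
  exact key _ (exists_section_through (E := E) e).choose_spec

/-- The linear vector field of a derivation is smooth. -/
theorem contMDiff_hat (L : LieAlgebroid E F A) (D : LinearDerivation E F A) :
    ContMDiff (𝓘(ℝ, E).prod 𝓘(ℝ, F)) (𝓘(ℝ, E).prod 𝓘(ℝ, F)).tangent 1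
      (fun e : TotalSpace F A =>
        (⟨e, D.hat e⟩ : TangentBundle (𝓘(ℝ, E).prod 𝓘(ℝ, F)) (TotalSpace F A))) := by
  intro e
  let p := e.1
  have he : e.1 ∈ coordSource E F A p := mem_coordSource_self
  let m := coordModel L D p
  let W : (z : E × F) → TangentSpace 𝓘(ℝ, E × F) z := fun z => (m.vf z.1, -(m.der z.1 z.2))
  have hz : (coordTotal E p e).1 ∈ m.dom := extChartAt_mem_coordTarget he
  have hW : ContDiffAt ℝ ∞ (fun z : E × F => (m.vf z.1, -(m.der z.1 z.2))) (coordTotal E p e) := by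
    refine ContDiffAt.prodMk ?_ (ContDiffAt.neg (ContDiffAt.clm_apply ?_ contDiffAt_snd))
    · exact (m.contDiffOn_vf.contDiffAt (m.isOpen_dom.mem_nhds hz)).comp _ contDiffAt_fst
    · exact (m.contDiffOn_der.contDiffAt (m.isOpen_dom.mem_nhds hz)).comp _ contDiffAt_fst
  have hW' : ContMDiffAt 𝓘(ℝ, E × F) 𝓘(ℝ, E × F).tangent 1
      (fun z => (⟨z, W z⟩ : TangentBundle 𝓘(ℝ, E × F) (E × F))) (coordTotal E p e) :=
    contMDiffAt_vectorSpace_iff_contDiffAt.2 (hW.of_le (by simp))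
  have hinv : ∀ z : TotalSpace F A, z.1 ∈ coordSource E F A p →
      ContinuousLinearMap.IsInvertible
        (mfderiv (𝓘(ℝ, E).prod 𝓘(ℝ, F)) 𝓘(ℝ, E × F) (coordTotal E p) z) := fun z hz =>
    ContinuousLinearMap.IsInvertible.of_inverse (mfderiv_coordTotal_comp hz)
      (mfderiv_coordTotalSymm_comp hz)
  have h := ContMDiffAt.mpullback_vectorField_preimage hW' (contMDiffAt_coordTotal he) (hinv e he)
    (by norm_cast)
  refine h.congr_of_eventuallyEq ?_
  filter_upwards [(isOpen_proj_preimage isOpen_coordSource).mem_nhds he] with z hz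
  refine congrArg (fun w => (⟨z, w⟩ :
    TangentBundle (𝓘(ℝ, E).prod 𝓘(ℝ, F)) (TotalSpace F A))) (Eq.symm ?_)
  refine (hinv z hz).inverse_apply_eq.2 ?_
  exact (mfderiv_coordTotal_hat L D hz).symm

end LinearVectorField


/-! ### Flows of continuously differentiable vector fields -/

section FlowProperties

variable {E : Type*} [NormedAddCommGroup E] [NormedSpace ℝ E]
  {H : Type*} [TopologicalSpace H] {I : ModelWithCorners ℝ E H}
  {M : Type*} [TopologicalSpace M] [ChartedSpace H M]
  {V : (x : M) → TangentSpace I x} {s t : ℝ} {x y z : M}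

theorem IsMIntegralCurveOn.flowsTo {γ : ℝ → M} {a b : ℝ}
    (h : IsMIntegralCurveOn γ V (Ioo a b)) (hs : s ∈ Ioo a b) (ht : t ∈ Ioo a b) :
    FlowsTo V (t - s) (γ s) (γ t) := by
  refine ⟨γ ∘ (· + s), a - s, b - s, ?_, ?_, ?_, ?_, ?_⟩
  · constructor <;> linarith [hs.1, hs.2]
  · constructor <;> linarith [ht.1, ht.2]
  · have h1 := h.comp_add s
    have h2 : {u | u + s ∈ Ioo a b} = Ioo (a - s) (b - s) := by
      ext u
      simp [sub_lt_iff_lt_add, lt_sub_iff_add_lt]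
    rwa [h2] at h1
  · simp
  · simp

theorem FlowsTo.symm (h : FlowsTo V t x y) : FlowsTo V (-t) y x := by
  obtain ⟨γ, a, b, h0, ht, hγ, rfl, rfl⟩ := h
  simpa using hγ.flowsTo ht h0

/-- A property of pairs (time, point) that holds for small times, locally uniformly, and that is
inherited by concatenations of integral curves holds along all integral curves. -/
theorem FlowsTo.propagate {P : ℝ → M → Prop}
    (hloc : ∀ p, ∃ ε > 0, ∀ᶠ x in 𝓝 p, ∀ t ∈ Ioo (-ε) ε, P t x)
    (hcomp : ∀ s t x y, FlowsTo V s x y → P s x → P t y → P (s + t) x)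
    (h : FlowsTo V t x y) : P t x := by
  obtain ⟨γ, a, b, h0, ht, hγ, rfl, -⟩ := h
  have key := isPreconnected_Ioo.induction₂' (fun u w => P (w - u) (γ u)) (fun r hr => ?_)
    (fun u v w hu hv hw h1 h2 => ?_) h0 ht
  · simpa using key
  · obtain ⟨ε, hε, h⟩ := hloc (γ r)
    have h1 : ∀ᶠ u in 𝓝[Ioo a b] r, ∀ t ∈ Ioo (-ε) ε, P t (γ u) :=
      (hγ.continuousOn r hr).eventually h
    have h2 : ∀ᶠ u in 𝓝[Ioo a b] r, u ∈ Ioo (r - ε) (r + ε) :=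
      mem_nhdsWithin_of_mem_nhds (Ioo_mem_nhds (by linarith) (by linarith))
    filter_upwards [h1, h2] with u hu hu'
    exact ⟨h.self_of_nhds _ ⟨by linarith [hu'.1], by linarith [hu'.2]⟩,
      hu _ ⟨by linarith [hu'.2], by linarith [hu'.1]⟩⟩
  · have := hcomp _ _ _ _ (hγ.flowsTo hu hv) h1 h2
    rwa [show v - u + (w - v) = w - u by ring] at this

variable [IsManifold I 1 M] [T2Space M] [BoundarylessManifold I M]

theorem FlowsTo.unique (hV : ContMDiff I I.tangent 1 (fun x => (⟨x, V x⟩ : TangentBundle I M)))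
    (h : FlowsTo V t x y) (h' : FlowsTo V t x z) : y = z := by
  obtain ⟨γ, a, b, h0, ht, hγ, rfl, rfl⟩ := h
  obtain ⟨γ', a', b', h0', ht', hγ', h00, rfl⟩ := h'
  refine isMIntegralCurveOn_Ioo_eqOn_of_contMDiff_boundaryless
    (a := max a a') (b := min b b') (t₀ := 0)
    ⟨max_lt h0.1 h0'.1, lt_min h0.2 h0'.2⟩ hV
    (hγ.mono (Ioo_subset_Ioo (le_max_left ..) (min_le_left ..)))
    (hγ'.mono (Ioo_subset_Ioo (le_max_right ..) (min_le_right ..))) h00.symm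
    ⟨max_lt ht.1 ht'.1, lt_min ht.2 ht'.2⟩

theorem FlowsTo.flow_eq (hV : ContMDiff I I.tangent 1 (fun x => (⟨x, V x⟩ : TangentBundle I M)))
    (h : FlowsTo V t x y) : flow V t x = y := by
  have hex : ∃ y, FlowsTo V t x y := ⟨y, h⟩
  rw [flow, dif_pos hex]
  exact hex.choose_spec.unique hV h

theorem FlowsTo.trans (hV : ContMDiff I I.tangent 1 (fun x => (⟨x, V x⟩ : TangentBundle I M)))
    (h : FlowsTo V s x y) (h' : FlowsTo V t y z) : FlowsTo V (s + t) x z := by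
  obtain ⟨γ, a, b, h0, hs, hγ, rfl, rfl⟩ := h
  obtain ⟨γ', a', b', h0', ht', hγ', h00, rfl⟩ := h'
  have hδ : IsMIntegralCurveOn (γ' ∘ (· - s)) V (Ioo (a' + s) (b' + s)) := by
    have h2 : Ioo (a' + s) (b' + s) = {u | u - s ∈ Ioo a' b'} := by
      ext u
      simp [sub_lt_iff_lt_add, lt_sub_iff_add_lt]
    rw [h2]
    exact isMIntegralCurveOn_comp_sub.2 hγ'
  have hs' : s ∈ Ioo (a' + s) (b' + s) := ⟨by linarith [h0'.1], by linarith [h0'.2]⟩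
  have hst : s + t ∈ Ioo (a' + s) (b' + s) := ⟨by linarith [ht'.1], by linarith [ht'.2]⟩
  have hagree : γ s = (γ' ∘ (· - s)) s := by simp [h00]
  have hpw := isMIntegralCurveOn_piecewise hV hγ hδ ⟨hs, hs'⟩ hagree
  have heq := eqOn_piecewise_of_isMIntegralCurveOn_Ioo hV hγ hδ ⟨hs, hs'⟩ hagree hst
  rw [Ioo_union_Ioo' (by linarith [hs'.1, hs.2]) (by linarith [hs.1, hs'.2])] at hpw
  have := hpw.flowsTo (s := 0) (t := s + t) ⟨min_lt_of_left_lt h0.1, lt_max_of_lt_left h0.2⟩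
    ⟨min_lt_of_right_lt hst.1, lt_max_of_lt_right hst.2⟩
  rw [heq, piecewise_eq_of_mem _ _ _ h0] at this
  simpa using this

end FlowProperties

section TotalSpaceTopology

theorem t2Space_totalSpace {M F : Type*} {A : M → Type*} [TopologicalSpace M] [TopologicalSpace F]
    [TopologicalSpace (TotalSpace F A)] [∀ x, TopologicalSpace (A x)] [FiberBundle F A]
    [T2Space M] [T2Space F] : T2Space (TotalSpace F A) := by
  rw [t2_iff_nhds]
  intro e e' hne
  have hc := FiberBundle.continuous_proj F A
  have h1 : e.1 = e'.1 := tendsto_nhds_unique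
    ((hc.tendsto e).mono_left (inf_le_left (b := 𝓝 e')))
    ((hc.tendsto e').mono_left inf_le_right)
  let τ := trivializationAt F A e.1
  have he : e ∈ τ.source := FiberBundle.mem_trivializationAt_proj_source
  have he' : e' ∈ τ.source := by
    rw [τ.mem_source, ← h1]
    exact FiberBundle.mem_baseSet_trivializationAt' e.1
  have h2 : τ e = τ e' := tendsto_nhds_unique
    ((τ.continuousOn.continuousAt (τ.open_source.mem_nhds he)).tendsto.mono_left
      (inf_le_left (b := 𝓝 e')))
    ((τ.continuousOn.continuousAt (τ.open_source.mem_nhds he')).tendsto.mono_left inf_le_right)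
  exact τ.injOn he he' h2

end TotalSpaceTopology


/-! ### The flow of the linear vector field for small times -/

section SmallTimes

set_option linter.unusedSectionVars false

variable {E : Type*} [NormedAddCommGroup E] [NormedSpace ℝ E] [FiniteDimensional ℝ E]
  {M : Type*} [TopologicalSpace M] [ChartedSpace E M] [IsManifold 𝓘(ℝ, E) ∞ M] [T2Space M]
  {F : Type*} [NormedAddCommGroup F] [NormedSpace ℝ F]
  {A : M → Type*} [TopologicalSpace (TotalSpace F A)] [∀ x, TopologicalSpace (A x)]
  [∀ x, AddCommGroup (A x)] [∀ x, Module ℝ (A x)] [FiberBundle F A] [VectorBundle ℝ F A]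
  {p x : M} {y : E} {e : TotalSpace F A}

theorem hasMFDerivAt_symm_coord (hy : y ∈ coordTarget E F A p) :
    HasMFDerivAt 𝓘(ℝ, E) 𝓘(ℝ, E) (extChartAt 𝓘(ℝ, E) p).symm y
      (mfderiv 𝓘(ℝ, E) 𝓘(ℝ, E) (extChartAt 𝓘(ℝ, E) p).symm y) :=
  ((contMDiffOn_extChartAt_symm_coordTarget.contMDiffAt
    (isOpen_coordTarget.mem_nhds hy)).mdifferentiableAt (by simp)).hasMFDerivAt

theorem mfderiv_symm_mfderiv_extChartAt (hx : x ∈ coordSource E F A p)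
    (v : TangentSpace 𝓘(ℝ, E) x) :
    (mfderiv 𝓘(ℝ, E) 𝓘(ℝ, E) (extChartAt 𝓘(ℝ, E) p).symm (extChartAt 𝓘(ℝ, E) p x)
      (mfderiv 𝓘(ℝ, E) 𝓘(ℝ, E) (extChartAt 𝓘(ℝ, E) p) x v) : E) = v := by
  have h := HasMFDerivAt.comp x (hasMFDerivAt_symm_coord (extChartAt_mem_coordTarget hx))
    (hasMFDerivAt_extChartAt_coord hx)
  have h2 : HasMFDerivAt 𝓘(ℝ, E) 𝓘(ℝ, E)
      ((extChartAt 𝓘(ℝ, E) p).symm ∘ extChartAt 𝓘(ℝ, E) p) x (ContinuousLinearMap.id ℝ _) := by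
    refine (hasMFDerivAt_id x).congr_of_eventuallyEq ?_
    filter_upwards [isOpen_coordSource.mem_nhds hx] with z hz using extChartAt_left_inv hz
  exact DFunLike.congr_fun (hasMFDerivAt_unique h h2) v

theorem mfderiv_extChartAt_injective (hx : x ∈ coordSource E F A p) {v w : E}
    (h : (mfderiv 𝓘(ℝ, E) 𝓘(ℝ, E) (extChartAt 𝓘(ℝ, E) p) x v : E) =
      mfderiv 𝓘(ℝ, E) 𝓘(ℝ, E) (extChartAt 𝓘(ℝ, E) p) x w) : v = w :=
  (mfderiv_symm_mfderiv_extChartAt hx v).symm.trans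
    ((congrArg (fun u : E => (mfderiv 𝓘(ℝ, E) 𝓘(ℝ, E) (extChartAt 𝓘(ℝ, E) p).symm
      (extChartAt 𝓘(ℝ, E) p x) u : E)) h).trans (mfderiv_symm_mfderiv_extChartAt hx w))

theorem mfderiv_symm_coordVF {X : (x : M) → TangentSpace 𝓘(ℝ, E) x}
    (hy : y ∈ coordTarget E F A p) :
    (mfderiv 𝓘(ℝ, E) 𝓘(ℝ, E) (extChartAt 𝓘(ℝ, E) p).symm y (coordVF (E := E) p X y) : E) =
      X ((extChartAt 𝓘(ℝ, E) p).symm y) := by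
  have h := mfderiv_symm_mfderiv_extChartAt hy.2 (X ((extChartAt 𝓘(ℝ, E) p).symm y))
  rw [extChartAt_right_inv hy] at h
  exact h

/-- A curve that solves the equation of integral curves in coordinates is an integral curve. -/
theorem isMIntegralCurveOn_symm {X : (x : M) → TangentSpace 𝓘(ℝ, E) x} {c : ℝ → E} {J : Set ℝ}
    (hc : ∀ t ∈ J, c t ∈ coordTarget E F A p)
    (hc' : ∀ t ∈ J, HasDerivAt c (coordVF p X (c t)) t) :
    IsMIntegralCurveOn (fun t => (extChartAt 𝓘(ℝ, E) p).symm (c t)) X J := by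
  intro t ht
  have h := HasMFDerivAt.comp t (hasMFDerivAt_symm_coord (hc t ht))
    (hc' t ht).hasFDerivAt.hasMFDerivAt
  refine (h.congr_mfderiv ?_).hasMFDerivWithinAt
  refine ContinuousLinearMap.ext fun r : ℝ => ?_
  exact (map_smul (mfderiv 𝓘(ℝ, E) 𝓘(ℝ, E) (extChartAt 𝓘(ℝ, E) p).symm (c t)) r
    (coordVF (E := E) p X (c t))).trans
      (congrArg (fun u : E => r • u) (mfderiv_symm_coordVF (hc t ht)))

variable [ContMDiffVectorBundle ∞ F A 𝓘(ℝ, E)] [FiniteDimensional ℝ F]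

theorem mfderiv_coordTotalSymm_model (L : LieAlgebroid E F A) (D : LinearDerivation E F A)
    {z : E × F} (hz : z.1 ∈ coordTarget E F A p) :
    (mfderiv 𝓘(ℝ, E × F) (𝓘(ℝ, E).prod 𝓘(ℝ, F)) (coordTotalSymm A p) z
      ((coordModel L D p).vf z.1, -((coordModel L D p).der z.1 z.2)) : E × F) =
      D.hat (coordTotalSymm A p z) := by
  have he : (coordTotalSymm A p z).1 ∈ coordSource E F A p := hz.2
  have h1 := DFunLike.congr_fun (mfderiv_coordTotalSymm_comp he) (D.hat (coordTotalSymm A p z))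
  have h2 := mfderiv_coordTotal_hat L D he
  rw [coordTotal_coordTotalSymm hz] at h1 h2
  refine Eq.trans ?_ h1
  exact congrArg (fun u : E × F => (mfderiv 𝓘(ℝ, E × F) (𝓘(ℝ, E).prod 𝓘(ℝ, F))
    (coordTotalSymm A p) z u : E × F)) h2.symm

theorem isMIntegralCurveOn_coordTotalSymm (L : LieAlgebroid E F A) (D : LinearDerivation E F A)
    {c : ℝ → E × F} {J : Set ℝ} (hc : ∀ t ∈ J, (c t).1 ∈ coordTarget E F A p)
    (hc' : ∀ t ∈ J, HasDerivAt c ((coordModel L D p).vf (c t).1,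
      -((coordModel L D p).der (c t).1 (c t).2)) t) :
    IsMIntegralCurveOn (fun t => coordTotalSymm A p (c t)) D.hat J := by
  intro t ht
  have h := HasMFDerivAt.comp t (hasMFDerivAt_coordTotalSymm (A := A) (hc t ht))
    (hc' t ht).hasFDerivAt.hasMFDerivAt
  refine (h.congr_mfderiv ?_).hasMFDerivWithinAt
  refine ContinuousLinearMap.ext fun r : ℝ => ?_
  exact (map_smul (mfderiv 𝓘(ℝ, E × F) (𝓘(ℝ, E).prod 𝓘(ℝ, F)) (coordTotalSymm A p) (c t)) r
    _).trans (congrArg (fun u : E × F => r • u) (mfderiv_coordTotalSymm_model L D (hc t ht)))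

theorem coordModel_anc (L : LieAlgebroid E F A) (D : LinearDerivation E F A)
    (hx : x ∈ coordSource E F A p) (w : F) :
    (coordModel L D p).anc (extChartAt 𝓘(ℝ, E) p x) w =
      mfderiv 𝓘(ℝ, E) 𝓘(ℝ, E) (extChartAt 𝓘(ℝ, E) p) x
        (L.anchor x ((trivializationAt F A p).symmₗ ℝ x w)) := by
  refine (coordVF_extChartAt hx).trans ?_
  change _ = mfderiv 𝓘(ℝ, E) 𝓘(ℝ, E) (extChartAt 𝓘(ℝ, E) p) x (L.anchor x _)
  rw [← coordFrame_apply w hx]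
  rfl

variable {L : LieAlgebroid E F A} {D : LinearDerivation E F A} {ε t : ℝ} {U : Set E}
  {φ : ℝ → E → E} {T : ℝ → E → F →L[ℝ] F}

theorem CoordModel.IsLocalFlow.zero_mem {m : CoordModel E F} (hf : m.IsLocalFlow ε U φ T) :
    (0 : ℝ) ∈ Ioo (-ε) ε := ⟨by linarith [hf.pos], hf.pos⟩

theorem flowsTo_symbol (hf : (coordModel L D p).IsLocalFlow ε U φ T) (ht : t ∈ Ioo (-ε) ε)
    (hx : x ∈ coordSource E F A p) (hU : extChartAt 𝓘(ℝ, E) p x ∈ U) :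
    FlowsTo D.symbol t x ((extChartAt 𝓘(ℝ, E) p).symm (φ t (extChartAt 𝓘(ℝ, E) p x))) := by
  have h := (isMIntegralCurveOn_symm (F := F) (A := A) (X := D.symbol)
    (fun s hs => hf.mem_dom s hs _ hU) (fun s hs => hf.hasDerivAt_base s hs _ hU)).flowsTo
    hf.zero_mem ht
  rwa [hf.base_zero _ hU, extChartAt_left_inv hx, sub_zero] at h

theorem flowsTo_hat (hf : (coordModel L D p).IsLocalFlow ε U φ T) (ht : t ∈ Ioo (-ε) ε)
    (he : e.1 ∈ coordSource E F A p) (hU : (coordTotal E p e).1 ∈ U) :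
    FlowsTo D.hat t e (coordTotalSymm A p
      (φ t (coordTotal E p e).1, T t (coordTotal E p e).1 (coordTotal E p e).2)) := by
  have h := (isMIntegralCurveOn_coordTotalSymm L D (p := p)
    (c := fun s => (φ s (coordTotal E p e).1, T s (coordTotal E p e).1 (coordTotal E p e).2))
    (fun s hs => hf.mem_dom s hs _ hU) (fun s hs => ?_)).flowsTo
    hf.zero_mem ht
  · rwa [hf.base_zero _ hU, hf.fibre_zero _ hU, ContinuousLinearMap.id_apply,
      coordTotalSymm_coordTotal he, sub_zero] at h
  · have h1 := (hf.hasDerivAt_fibre s hs _ hU).clm_apply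
      (hasDerivAt_const s (coordTotal E p e).2)
    refine (hf.hasDerivAt_base s hs _ hU).prodMk (h1.congr_deriv ?_)
    simp

/-- The time-`t` flow of a linear derivation is regular at `x`: the flows of the symbol and of the
linear vector field exist until time `t` on `x` and on the fibre over it, they are smooth there, and
the flow of the linear vector field is linear between the fibres. -/
structure LinearDerivation.IsRegularAt (D : LinearDerivation E F A) (t : ℝ) (x : M) : Prop where
  contMDiffAt_base : ContMDiffAt 𝓘(ℝ, E) 𝓘(ℝ, E) ∞ (flow D.symbol t) x
  contMDiffAt_total : ∀ v : A x, ContMDiffAt (𝓘(ℝ, E).prod 𝓘(ℝ, F)) (𝓘(ℝ, E).prod 𝓘(ℝ, F)) ∞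
    (flow D.hat t) (⟨x, v⟩ : TotalSpace F A)
  exists_linear : ∃ (y : M) (S : A x →ₗ[ℝ] A y), FlowsTo D.symbol t x y ∧
    ∀ v : A x, FlowsTo D.hat t (⟨x, v⟩ : TotalSpace F A) ⟨y, S v⟩

theorem LinearDerivation.flow_symbol_eq (D : LinearDerivation E F A) {y : M}
    (h : FlowsTo D.symbol t x y) : flow D.symbol t x = y :=
  haveI : IsManifold 𝓘(ℝ, E) 1 M := IsManifold.of_le (n := ∞) (by simp)
  h.flow_eq (D.symbol.contMDiff.of_le (by simp))

theorem LieAlgebroid.flow_hat_eq (L : LieAlgebroid E F A) (D : LinearDerivation E F A)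
    {e' : TotalSpace F A} (h : FlowsTo D.hat t e e') : flow D.hat t e = e' :=
  haveI : T2Space (TotalSpace F A) := t2Space_totalSpace
  haveI : IsManifold (𝓘(ℝ, E).prod 𝓘(ℝ, F)) 1 (TotalSpace F A) :=
    IsManifold.of_le (n := ∞) (by simp)
  h.flow_eq (contMDiff_hat L D)

theorem isRegularAt_of_isLocalFlow (hf : (coordModel L D p).IsLocalFlow ε U φ T)
    (ht : t ∈ Ioo (-ε) ε) (hx : x ∈ coordSource E F A p) (hU : extChartAt 𝓘(ℝ, E) p x ∈ U) :
    D.IsRegularAt t x := by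
  have hd : φ t (extChartAt 𝓘(ℝ, E) p x) ∈ coordTarget E F A p := hf.mem_dom t ht _ hU
  have hnhds : coordSource E F A p ∩ extChartAt 𝓘(ℝ, E) p ⁻¹' U ∈ 𝓝 x :=
    inter_mem (isOpen_coordSource.mem_nhds hx)
      ((continuousAt_extChartAt_of_mem hx).preimage_mem_nhds (hf.isOpen.mem_nhds hU))
  refine ⟨?_, fun v => ?_, ?_⟩
  · have h1 := contMDiffOn_extChartAt_coordSource.contMDiffAt (isOpen_coordSource.mem_nhds hx)
    have h2 := contMDiffOn_extChartAt_symm_coordTarget.contMDiffAt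
      (isOpen_coordTarget.mem_nhds hd)
    refine (h2.comp x ((hf.contDiff_base t ht).contMDiff.contMDiffAt.comp x h1)
      ).congr_of_eventuallyEq ?_
    filter_upwards [hnhds] with z hz using D.flow_symbol_eq (flowsTo_symbol hf ht hz.1 hz.2)
  · have h1 := contMDiffAt_coordTotal (E := E) (e := (⟨x, v⟩ : TotalSpace F A)) hx
    have h2 : ContDiff ℝ ∞ (fun z : E × F => (φ t z.1, T t z.1 z.2)) :=
      ((hf.contDiff_base t ht).comp contDiff_fst).prodMk
        (((hf.contDiff_fibre t ht).comp contDiff_fst).clm_apply contDiff_snd)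
    have h3 := contMDiffAt_coordTotalSymm (A := A) (p := p)
      (z := (φ t (extChartAt 𝓘(ℝ, E) p x), T t (extChartAt 𝓘(ℝ, E) p x)
        ((trivializationAt F A p).linearMapAt ℝ x v))) hd
    refine (ContMDiffAt.comp (⟨x, v⟩ : TotalSpace F A) h3 (h2.contMDiff.contMDiffAt.comp _ h1)
      ).congr_of_eventuallyEq ?_
    filter_upwards [(FiberBundle.continuous_proj F A).continuousAt.preimage_mem_nhds hnhds]
      with e he using L.flow_hat_eq D (flowsTo_hat hf ht he.1 he.2)
  · exact ⟨_, (trivializationAt F A p).symmₗ ℝ _ ∘ₗ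
      (T t (extChartAt 𝓘(ℝ, E) p x) : F →ₗ[ℝ] F) ∘ₗ (trivializationAt F A p).linearMapAt ℝ x,
      flowsTo_symbol hf ht hx hU,
      fun v => flowsTo_hat (e := (⟨x, v⟩ : TotalSpace F A)) hf ht hx hU⟩

end SmallTimes


/-! ### Compatibility of the flow with anchor and bracket for small times -/

section SmallTimesCompatibility

set_option linter.unusedSectionVars false

variable {E : Type*} [NormedAddCommGroup E] [NormedSpace ℝ E] [FiniteDimensional ℝ E]
  {M : Type*} [TopologicalSpace M] [ChartedSpace E M] [IsManifold 𝓘(ℝ, E) ∞ M] [T2Space M]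
  {F : Type*} [NormedAddCommGroup F] [NormedSpace ℝ F] [FiniteDimensional ℝ F]
  {A : M → Type*} [TopologicalSpace (TotalSpace F A)] [∀ x, TopologicalSpace (A x)]
  [∀ x, AddCommGroup (A x)] [∀ x, Module ℝ (A x)] [FiberBundle F A] [VectorBundle ℝ F A]
  [ContMDiffVectorBundle ∞ F A 𝓘(ℝ, E)]
  {p x : M} {e : TotalSpace F A}
  {L : LieAlgebroid E F A} {D : LinearDerivation E F A} {ε t : ℝ} {U : Set E}
  {φ : ℝ → E → E} {T : ℝ → E → F →L[ℝ] F}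

theorem tangentBundle_mk_eq {z z' : M} (h : z = z') {v : TangentSpace 𝓘(ℝ, E) z}
    {w : TangentSpace 𝓘(ℝ, E) z'} (hvw : (v : E) = w) :
    (⟨z, v⟩ : TangentBundle 𝓘(ℝ, E) M) = ⟨z', w⟩ := by
  subst h
  exact congrArg (fun u : TangentSpace 𝓘(ℝ, E) z => (⟨z, u⟩ : TangentBundle 𝓘(ℝ, E) M)) hvw

/-- The time-`t` flow of a linear derivation respects the anchors at `x`. -/
def LieAlgebroid.AnchorCompatibleAt (L : LieAlgebroid E F A) (D : LinearDerivation E F A) (t : ℝ)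
    (x : M) : Prop :=
  ∀ v : A x, (⟨(flow D.hat t ⟨x, v⟩).1, L.anchor _ (flow D.hat t ⟨x, v⟩).2⟩ :
      TangentBundle 𝓘(ℝ, E) M) =
    ⟨flow D.symbol t x, mfderiv 𝓘(ℝ, E) 𝓘(ℝ, E) (flow D.symbol t) x (L.anchor x v)⟩

/-- The sections `a` and `b` are related near `x` by the time-`t` flow of a linear derivation:
the flow maps `a z` to the value of `b` at the flow of `z`. -/
def LinearDerivation.RelatedAt (D : LinearDerivation E F A) (t : ℝ) (x : M)
    (a b : Cₛ^∞⟮𝓘(ℝ, E); F, A⟯) : Prop :=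
  ∀ᶠ z in 𝓝 x, flow D.hat t ⟨z, a z⟩ = ⟨flow D.symbol t z, b (flow D.symbol t z)⟩

/-- The time-`t` flow of a linear derivation respects the brackets at `x`: the brackets of related
sections are related. -/
def LieAlgebroid.BracketCompatibleAt (L : LieAlgebroid E F A) (D : LinearDerivation E F A) (t : ℝ)
    (x : M) : Prop :=
  ∀ a₁ a₂ b₁ b₂ : Cₛ^∞⟮𝓘(ℝ, E); F, A⟯, D.RelatedAt t x a₁ b₁ → D.RelatedAt t x a₂ b₂ →
    flow D.hat t ⟨x, L.bracket a₁ a₂ x⟩ =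
      ⟨flow D.symbol t x, L.bracket b₁ b₂ (flow D.symbol t x)⟩

theorem anchorCompatibleAt_of_isLocalFlow (hD : L.IsDerivation D)
    (hf : (coordModel L D p).IsLocalFlow ε U φ T)
    (ht : t ∈ Ioo (-ε) ε) (hx : x ∈ coordSource E F A p) (hU : extChartAt 𝓘(ℝ, E) p x ∈ U) :
    L.AnchorCompatibleAt D t x := by
  intro v
  set y := extChartAt 𝓘(ℝ, E) p x with hy
  have hd : φ t y ∈ coordTarget E F A p := hf.mem_dom t ht _ hU
  set x' := (extChartAt 𝓘(ℝ, E) p).symm (φ t y) with hx'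
  have hxx' : x' ∈ coordSource E F A p := hd.2
  have hκx' : extChartAt 𝓘(ℝ, E) p x' = φ t y := extChartAt_right_inv hd
  have hnhds : coordSource E F A p ∩ extChartAt 𝓘(ℝ, E) p ⁻¹' U ∈ 𝓝 x :=
    inter_mem (isOpen_coordSource.mem_nhds hx)
      ((continuousAt_extChartAt_of_mem hx).preimage_mem_nhds (hf.isOpen.mem_nhds hU))
  have hflow : flow D.symbol t x = x' := D.flow_symbol_eq (flowsTo_symbol hf ht hx hU)
  rw [L.flow_hat_eq D (flowsTo_hat (e := (⟨x, v⟩ : TotalSpace F A)) hf ht hx hU)]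
  refine tangentBundle_mk_eq hflow.symm ?_
  -- the two vectors are compared in the chart at `p`
  refine mfderiv_extChartAt_injective hxx' ?_
  have h1 := coordModel_anc L D hxx' (T t y ((trivializationAt F A p).linearMapAt ℝ x v))
  have h2 := (coordModel_anc L D hx ((trivializationAt F A p).linearMapAt ℝ x v)).trans
    (congrArg (fun w : A x => (mfderiv 𝓘(ℝ, E) 𝓘(ℝ, E) (extChartAt 𝓘(ℝ, E) p) x (L.anchor x w) : E))
      (Trivialization.symmₗ_linearMapAt _ hx.2.2 v))
  have h3 := hf.fderiv_anc (isDerivation_coordModel hD p) ht hU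
    ((trivializationAt F A p).linearMapAt ℝ x v)
  have hreg := (isRegularAt_of_isLocalFlow hf ht hx hU).contMDiffAt_base
  have hflow' : HasMFDerivAt 𝓘(ℝ, E) 𝓘(ℝ, E) (flow D.symbol t) x
      (mfderiv 𝓘(ℝ, E) 𝓘(ℝ, E) (flow D.symbol t) x) :=
    (hreg.mdifferentiableAt (by simp)).hasMFDerivAt
  have hκ' : HasMFDerivAt 𝓘(ℝ, E) 𝓘(ℝ, E) (extChartAt 𝓘(ℝ, E) p) (flow D.symbol t x)
      (mfderiv 𝓘(ℝ, E) 𝓘(ℝ, E) (extChartAt 𝓘(ℝ, E) p) x') := by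
    rw [hflow]; exact hasMFDerivAt_extChartAt_coord hxx'
  have h4 := HasMFDerivAt.comp x hκ' hflow'
  have h5 : HasMFDerivAt 𝓘(ℝ, E) 𝓘(ℝ, E) (extChartAt 𝓘(ℝ, E) p ∘ flow D.symbol t) x
      (((fderiv ℝ (φ t) y).comp (mfderiv 𝓘(ℝ, E) 𝓘(ℝ, E) (extChartAt 𝓘(ℝ, E) p) x) :)) := by
    refine (HasMFDerivAt.comp x (((hf.contDiff_base t ht).differentiable (by simp)
      y).hasFDerivAt.hasMFDerivAt) (hasMFDerivAt_extChartAt_coord hx)).congr_of_eventuallyEq ?_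
    filter_upwards [hnhds] with z hz
    rw [Function.comp_apply, D.flow_symbol_eq (flowsTo_symbol hf ht hz.1 hz.2),
      extChartAt_right_inv (hf.mem_dom t ht _ hz.2)]
    rfl
  have h6 := DFunLike.congr_fun (hasMFDerivAt_unique h4 h5) (L.anchor x v)
  refine Eq.trans ?_ h6.symm
  rw [hκx', ← h3] at h1
  exact h1.symm.trans (congrArg (fderiv ℝ (φ t) y) h2)

theorem bracketCompatibleAt_of_isLocalFlow (hD : L.IsDerivation D)
    (hf : (coordModel L D p).IsLocalFlow ε U φ T)
    (ht : t ∈ Ioo (-ε) ε) (hx : x ∈ coordSource E F A p) (hU : extChartAt 𝓘(ℝ, E) p x ∈ U) :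
    L.BracketCompatibleAt D t x := by
  intro a₁ a₂ b₁ b₂ h₁ h₂
  set y := extChartAt 𝓘(ℝ, E) p x with hy
  have hyt : y ∈ coordTarget E F A p := extChartAt_mem_coordTarget hx
  have hd : φ t y ∈ coordTarget E F A p := hf.mem_dom t ht _ hU
  set x' := (extChartAt 𝓘(ℝ, E) p).symm (φ t y) with hx'
  have hxx' : x' ∈ coordSource E F A p := hd.2
  have hκx' : extChartAt 𝓘(ℝ, E) p x' = φ t y := extChartAt_right_inv hd
  have hflow : flow D.symbol t x = x' := D.flow_symbol_eq (flowsTo_symbol hf ht hx hU)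
  have hdiff : ∀ (s : Cₛ^∞⟮𝓘(ℝ, E); F, A⟯) {z : E}, z ∈ coordTarget E F A p →
      DifferentiableAt ℝ (coordRep E F p s) z := fun s z hz =>
    (contDiffAt_coordRep hz s.contMDiff.contMDiffAt).differentiableAt (by simp)
  have hrel : ∀ {a b : Cₛ^∞⟮𝓘(ℝ, E); F, A⟯}, D.RelatedAt t x a b →
      ∀ᶠ z in 𝓝 y, T t z (coordRep E F p a z) = coordRep E F p b (φ t z) := by
    intro a b hab
    have hc : Tendsto (extChartAt 𝓘(ℝ, E) p).symm (𝓝 y) (𝓝 x) := by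
      have := continuousAt_symm_of_mem hyt
      rwa [ContinuousAt, extChartAt_left_inv hx] at this
    filter_upwards [hc.eventually hab, isOpen_coordTarget.mem_nhds hyt, hf.isOpen.mem_nhds hU]
      with z hz hzt hzU
    have hzd : φ t z ∈ coordTarget E F A p := hf.mem_dom t ht z hzU
    have hκz : extChartAt 𝓘(ℝ, E) p ((extChartAt 𝓘(ℝ, E) p).symm z) = z :=
      extChartAt_right_inv hzt
    have hzU' : extChartAt 𝓘(ℝ, E) p ((extChartAt 𝓘(ℝ, E) p).symm z) ∈ U := by rwa [hκz]
    rw [D.flow_symbol_eq (flowsTo_symbol hf ht hzt.2 hzU'),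
      L.flow_hat_eq D (flowsTo_hat (e := (⟨_, a _⟩ : TotalSpace F A)) hf ht hzt.2 hzU'),
      coordTotal_section (E := E) a hzt.2, hκz] at hz
    have h := congrArg (fun e => (coordTotal E p e).2) hz
    dsimp only at h
    rw [coordTotal_coordTotalSymm (by exact hzd), coordTotal_section (E := E) b hzd.2,
      extChartAt_right_inv hzd] at h
    exact h
  have key := hf.fibre_bracket (isDerivation_coordModel hD p) ht hU (hdiff a₁ hyt) (hdiff a₂ hyt)
    (hdiff b₁ hd) (hdiff b₂ hd) (hrel h₁) (hrel h₂)
  rw [← coordRep_bracket L D _ _ hyt, ← coordRep_bracket L D _ _ hd] at key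
  rw [L.flow_hat_eq D (flowsTo_hat (e := (⟨x, _⟩ : TotalSpace F A)) hf ht hx hU), hflow,
    coordTotal_section (E := E) (L.bracket a₁ a₂) hx, ← hy, key, ← hκx', coordTotalSymm_mk hxx',
    symmₗ_coordRep (F := F) (p := p) (L.bracket b₁ b₂) hxx']

/-- Near every point, the flow of a derivation of a Lie algebroid is regular and compatible with
the structure of the Lie algebroid for small times. -/
theorem exists_smallTimes (hD : L.IsDerivation D) (p : M) :
    ∃ ε > 0, ∀ᶠ x in 𝓝 p, ∀ t ∈ Ioo (-ε) ε,
      D.IsRegularAt t x ∧ L.AnchorCompatibleAt D t x ∧ L.BracketCompatibleAt D t x := by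
  obtain ⟨ε, U, φ, T, hf, hpU, -⟩ := (coordModel L D p).exists_isLocalFlow
    (extChartAt_mem_coordTarget mem_coordSource_self)
  have hp : p ∈ coordSource E F A p := mem_coordSource_self
  refine ⟨ε, hf.pos, ?_⟩
  filter_upwards [isOpen_coordSource.mem_nhds hp,
    (continuousAt_extChartAt_of_mem hp).preimage_mem_nhds (hf.isOpen.mem_nhds hpU)]
    with x hx hU t ht
  exact ⟨isRegularAt_of_isLocalFlow hf ht hx hU, anchorCompatibleAt_of_isLocalFlow hD hf ht hx hU,
    bracketCompatibleAt_of_isLocalFlow hD hf ht hx hU⟩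

end SmallTimesCompatibility


/-! ### The flow for arbitrary times -/

section ArbitraryTimes

set_option linter.unusedSectionVars false

variable {E : Type*} [NormedAddCommGroup E] [NormedSpace ℝ E] [FiniteDimensional ℝ E]
  {M : Type*} [TopologicalSpace M] [ChartedSpace E M] [IsManifold 𝓘(ℝ, E) ∞ M] [T2Space M]
  {F : Type*} [NormedAddCommGroup F] [NormedSpace ℝ F] [FiniteDimensional ℝ F]
  {A : M → Type*} [TopologicalSpace (TotalSpace F A)] [∀ x, TopologicalSpace (A x)]
  [∀ x, AddCommGroup (A x)] [∀ x, Module ℝ (A x)] [FiberBundle F A] [VectorBundle ℝ F A]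
  [ContMDiffVectorBundle ∞ F A 𝓘(ℝ, E)]
  {x y z : M} {e e' e'' : TotalSpace F A}
  {L : LieAlgebroid E F A} {D : LinearDerivation E F A} {s t : ℝ}

theorem LinearDerivation.flowsTo_symbol_trans (D : LinearDerivation E F A)
    (h : FlowsTo D.symbol s x y) (h' : FlowsTo D.symbol t y z) : FlowsTo D.symbol (s + t) x z :=
  haveI : IsManifold 𝓘(ℝ, E) 1 M := IsManifold.of_le (n := ∞) (by simp)
  h.trans (D.symbol.contMDiff.of_le (by simp)) h'

theorem LieAlgebroid.flowsTo_hat_trans (L : LieAlgebroid E F A) (D : LinearDerivation E F A)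
    (h : FlowsTo D.hat s e e') (h' : FlowsTo D.hat t e' e'') : FlowsTo D.hat (s + t) e e'' :=
  haveI : T2Space (TotalSpace F A) := t2Space_totalSpace
  haveI : IsManifold (𝓘(ℝ, E).prod 𝓘(ℝ, F)) 1 (TotalSpace F A) :=
    IsManifold.of_le (n := ∞) (by simp)
  h.trans (contMDiff_hat L D) h'

namespace LinearDerivation.IsRegularAt

theorem flowsTo_base (h : D.IsRegularAt t x) : FlowsTo D.symbol t x (flow D.symbol t x) := by
  obtain ⟨y, S, hy, -⟩ := h.exists_linear
  rwa [D.flow_symbol_eq hy]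

theorem exists_flow_hat (L : LieAlgebroid E F A) (h : D.IsRegularAt t x) :
    ∃ S : A x →ₗ[ℝ] A (flow D.symbol t x), ∀ v : A x,
      FlowsTo D.hat t (⟨x, v⟩ : TotalSpace F A) ⟨flow D.symbol t x, S v⟩ ∧
      flow D.hat t (⟨x, v⟩ : TotalSpace F A) = ⟨flow D.symbol t x, S v⟩ := by
  obtain ⟨y, S, hy, hS⟩ := h.exists_linear
  obtain rfl := D.flow_symbol_eq hy
  exact ⟨S, fun v => ⟨hS v, L.flow_hat_eq D (hS v)⟩⟩

theorem flowsTo_total (L : LieAlgebroid E F A) (h : D.IsRegularAt t e.1) :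
    FlowsTo D.hat t e (flow D.hat t e) := by
  obtain ⟨S, hS⟩ := h.exists_flow_hat L
  have := hS e.2
  rw [← this.2] at this
  exact this.1

theorem flow_hat_proj (L : LieAlgebroid E F A) (h : D.IsRegularAt t e.1) :
    (flow D.hat t e).1 = flow D.symbol t e.1 := by
  obtain ⟨S, hS⟩ := h.exists_flow_hat L
  exact congrArg TotalSpace.proj (hS e.2).2

theorem flow_symbol_add (hs : D.IsRegularAt s x) (ht : D.IsRegularAt t (flow D.symbol s x)) :
    flow D.symbol (s + t) x = flow D.symbol t (flow D.symbol s x) :=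
  D.flow_symbol_eq (D.flowsTo_symbol_trans hs.flowsTo_base ht.flowsTo_base)

theorem flow_hat_add (L : LieAlgebroid E F A) (hs : D.IsRegularAt s e.1)
    (ht : D.IsRegularAt t (flow D.symbol s e.1)) :
    flow D.hat (s + t) e = flow D.hat t (flow D.hat s e) := by
  refine L.flow_hat_eq D (L.flowsTo_hat_trans D (hs.flowsTo_total L) (flowsTo_total L ?_))
  rwa [hs.flow_hat_proj L]

/-- Regularity is inherited by concatenations. -/
theorem add (L : LieAlgebroid E F A)
    (h : ∀ᶠ w in 𝓝 x, D.IsRegularAt s w ∧ D.IsRegularAt t (flow D.symbol s w)) :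
    D.IsRegularAt (s + t) x := by
  obtain ⟨hs, ht⟩ := h.self_of_nhds
  refine ⟨?_, fun v => ?_, ?_⟩
  · refine (ht.contMDiffAt_base.comp x hs.contMDiffAt_base).congr_of_eventuallyEq ?_
    filter_upwards [h] with w hw using hw.1.flow_symbol_add hw.2
  · obtain ⟨S, hS⟩ := hs.exists_flow_hat L
    have h1 : ContMDiffAt (𝓘(ℝ, E).prod 𝓘(ℝ, F)) (𝓘(ℝ, E).prod 𝓘(ℝ, F)) ∞ (flow D.hat t)
        (flow D.hat s (⟨x, v⟩ : TotalSpace F A)) := by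
      rw [(hS v).2]; exact ht.contMDiffAt_total _
    refine (h1.comp _ (hs.contMDiffAt_total v)).congr_of_eventuallyEq ?_
    filter_upwards [((FiberBundle.continuous_proj F A).tendsto (⟨x, v⟩ : TotalSpace F A)).eventually
      h] with w hw using flow_hat_add L hw.1 hw.2
  · obtain ⟨S, hS⟩ := hs.exists_flow_hat L
    obtain ⟨S', hS'⟩ := ht.exists_flow_hat L
    exact ⟨_, S' ∘ₗ S, D.flowsTo_symbol_trans hs.flowsTo_base ht.flowsTo_base,
      fun v => L.flowsTo_hat_trans D (hS v).1 (hS' (S v)).1⟩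

end LinearDerivation.IsRegularAt

/-- As long as the flow of the symbol exists, the flow of a derivation is regular. -/
theorem eventually_isRegularAt (hD : L.IsDerivation D) (h : FlowsTo D.symbol t x y) :
    ∀ᶠ z in 𝓝 x, D.IsRegularAt t z := by
  refine h.propagate (P := fun t x => ∀ᶠ z in 𝓝 x, D.IsRegularAt t z) (fun p => ?_) ?_
  · obtain ⟨ε, hε, h⟩ := exists_smallTimes hD p
    refine ⟨ε, hε, ?_⟩
    filter_upwards [h.eventually_nhds] with x hx t ht
    exact hx.mono fun z hz => (hz t ht).1
  · intro s t x y hxy hs ht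
    have hc : Tendsto (flow D.symbol s) (𝓝 x) (𝓝 y) := by
      have := hs.self_of_nhds.contMDiffAt_base.continuousAt
      rwa [ContinuousAt, D.flow_symbol_eq hxy] at this
    filter_upwards [(hs.and (hc.eventually ht)).eventually_nhds] with z hz
    exact LinearDerivation.IsRegularAt.add L hz

theorem isRegularAt (hD : L.IsDerivation D) (h : FlowsTo D.symbol t x y) : D.IsRegularAt t x :=
  (eventually_isRegularAt hD h).self_of_nhds

theorem LinearDerivation.flow_symbol_neg (D : LinearDerivation E F A)
    (h : FlowsTo D.symbol t x y) : flow D.symbol (-t) y = x := D.flow_symbol_eq h.symm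

/-- A smooth map to the total space that is a section near `x` agrees near `x` with a global
section. -/
theorem exists_section_eq_of_proj_eq {g : M → TotalSpace F A}
    (h : ∀ᶠ z in 𝓝 x, (g z).1 = z ∧ ContMDiffAt 𝓘(ℝ, E) (𝓘(ℝ, E).prod 𝓘(ℝ, F)) ∞ g z) :
    ∃ c : Cₛ^∞⟮𝓘(ℝ, E); F, A⟯, ∀ᶠ z in 𝓝 x, (⟨z, c z⟩ : TotalSpace F A) = g z := by
  classical
  let c : (z : M) → A z := fun z => if hz : (g z).1 = z then hz ▸ (g z).2 else 0
  have hc : ∀ z, (g z).1 = z → (⟨z, c z⟩ : TotalSpace F A) = g z := by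
    intro z hz
    simp only [c, dif_pos hz]
    generalize g z = e at hz
    subst hz
    rfl
  obtain ⟨c', hc'⟩ := exists_section_eventuallyEq (E := E) (F := F) (s := c)
    (eventually_eventually_nhds.2 h) (fun z hz => by
      refine ContMDiffAt.contMDiffWithinAt (hz.self_of_nhds.2.congr_of_eventuallyEq ?_)
      filter_upwards [hz] with w hw using hc w hw.1)
  refine ⟨c', ?_⟩
  filter_upwards [hc', h] with z hz hz'
  rw [hz, hc z hz'.1]

/-- Every section can be pushed forward along the flow, as a germ. -/
theorem exists_relatedAt (hD : L.IsDerivation D) (h : FlowsTo D.symbol t x y)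
    (a : Cₛ^∞⟮𝓘(ℝ, E); F, A⟯) :
    ∃ c : Cₛ^∞⟮𝓘(ℝ, E); F, A⟯, D.RelatedAt t x a c ∧ ∀ᶠ z in 𝓝 y,
      (⟨z, c z⟩ : TotalSpace F A) =
        flow D.hat t ⟨flow D.symbol (-t) z, a (flow D.symbol (-t) z)⟩ := by
  have hx := eventually_isRegularAt hD h
  have hy := eventually_isRegularAt hD h.symm
  have hcx : Tendsto (flow D.symbol t) (𝓝 x) (𝓝 y) := by
    have := hx.self_of_nhds.contMDiffAt_base.continuousAt
    rwa [ContinuousAt, D.flow_symbol_eq h] at this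
  have hcy : Tendsto (flow D.symbol (-t)) (𝓝 y) (𝓝 x) := by
    have := hy.self_of_nhds.contMDiffAt_base.continuousAt
    rwa [ContinuousAt, D.flow_symbol_neg h] at this
  obtain ⟨c, hc⟩ := exists_section_eq_of_proj_eq (x := y)
    (g := fun z => flow D.hat t (⟨flow D.symbol (-t) z, a (flow D.symbol (-t) z)⟩ :
      TotalSpace F A)) (by
    filter_upwards [hy, hcy.eventually hx] with z hz hz'
    have hback : FlowsTo D.symbol t (flow D.symbol (-t) z) z := by
      simpa using hz.flowsTo_base.symm
    refine ⟨?_, ?_⟩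
    · rw [LinearDerivation.IsRegularAt.flow_hat_proj L hz', D.flow_symbol_eq hback]
    · have h1 : ContMDiffAt 𝓘(ℝ, E) (𝓘(ℝ, E).prod 𝓘(ℝ, F)) ∞
          (fun z => (⟨flow D.symbol (-t) z, a (flow D.symbol (-t) z)⟩ : TotalSpace F A)) z :=
        (a.contMDiff _).comp z hz.contMDiffAt_base
      exact ContMDiffAt.comp z (hz'.contMDiffAt_total _) h1)
  refine ⟨c, ?_, hc⟩
  filter_upwards [hcx.eventually hc, hx] with z hz hz'
  rw [hz, D.flow_symbol_neg hz'.flowsTo_base]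

/-- As long as the flow of the symbol exists, the flow of a derivation of a Lie algebroid is
compatible with the anchor and the bracket. -/
theorem compatibleAt (hD : L.IsDerivation D) (h : FlowsTo D.symbol t x y) :
    L.AnchorCompatibleAt D t x ∧ L.BracketCompatibleAt D t x := by
  refine (h.propagate (P := fun t x => D.IsRegularAt t x ∧ L.AnchorCompatibleAt D t x ∧
    L.BracketCompatibleAt D t x) (fun p => ?_) ?_).2
  · exact exists_smallTimes hD p
  · rintro s t x y hxy ⟨hs, hsa, hsb⟩ ⟨ht, hta, htb⟩
    obtain rfl := D.flow_symbol_eq hxy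
    have hs' := eventually_isRegularAt hD hxy
    have ht' := eventually_isRegularAt hD ht.flowsTo_base
    have hev : ∀ᶠ w in 𝓝 x, D.IsRegularAt s w ∧ D.IsRegularAt t (flow D.symbol s w) :=
      hs'.and (hs.contMDiffAt_base.continuousAt.eventually ht')
    refine ⟨LinearDerivation.IsRegularAt.add L hev, fun v => ?_, ?_⟩
    · obtain ⟨S, hS⟩ := hs.exists_flow_hat L
      have h1 := hsa v
      rw [(hS v).2] at h1
      have h2 : L.anchor _ (S v) = mfderiv 𝓘(ℝ, E) 𝓘(ℝ, E) (flow D.symbol s) x (L.anchor x v) :=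
        TotalSpace.mk_inj.1 h1
      have h3 := hta (S v)
      rw [LinearDerivation.IsRegularAt.flow_hat_add L (e := ⟨x, v⟩) hs ht, (hS v).2, h3, h2]
      refine tangentBundle_mk_eq (hs.flow_symbol_add ht).symm ?_
      have h4 := HasMFDerivAt.comp x
        (ht.contMDiffAt_base.mdifferentiableAt (by simp)).hasMFDerivAt
        (hs.contMDiffAt_base.mdifferentiableAt (by simp)).hasMFDerivAt
      have h5 : flow D.symbol (s + t) =ᶠ[𝓝 x] flow D.symbol t ∘ flow D.symbol s := by
        filter_upwards [hev] with w hw using hw.1.flow_symbol_add hw.2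
      exact DFunLike.congr_fun (h4.congr_of_eventuallyEq h5).mfderiv.symm (L.anchor x v)
    · intro a₁ a₂ b₁ b₂ h₁ h₂
      have hpush : ∀ {a b : Cₛ^∞⟮𝓘(ℝ, E); F, A⟯}, D.RelatedAt (s + t) x a b →
          ∃ c, D.RelatedAt s x a c ∧ D.RelatedAt t (flow D.symbol s x) c b := by
        intro a b hab
        obtain ⟨c, hc, hc'⟩ := exists_relatedAt hD hxy a
        refine ⟨c, hc, ?_⟩
        have hback := eventually_isRegularAt hD hxy.symm
        have hcont : Tendsto (flow D.symbol (-s)) (𝓝 (flow D.symbol s x)) (𝓝 x) := by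
          have := hback.self_of_nhds.contMDiffAt_base.continuousAt
          rwa [ContinuousAt, D.flow_symbol_neg hxy] at this
        filter_upwards [hc', hback, hcont.eventually hab, hcont.eventually hev]
          with w hw hw' hab' hev'
        have hfwd : flow D.symbol s (flow D.symbol (-s) w) = w :=
          D.flow_symbol_eq (by simpa using hw'.flowsTo_base.symm)
        rw [LinearDerivation.IsRegularAt.flow_hat_add L
          (e := ⟨flow D.symbol (-s) w, a (flow D.symbol (-s) w)⟩) hev'.1 hev'.2, ← hw,
          hev'.1.flow_symbol_add hev'.2, hfwd] at hab'
        exact hab'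
      obtain ⟨c₁, h₁s, h₁t⟩ := hpush h₁
      obtain ⟨c₂, h₂s, h₂t⟩ := hpush h₂
      rw [LinearDerivation.IsRegularAt.flow_hat_add L (e := ⟨x, L.bracket a₁ a₂ x⟩) hs ht,
        hsb _ _ _ _ h₁s h₂s, htb _ _ _ _ h₁t h₂t, hs.flow_symbol_add ht]

end ArbitraryTimes


/-! ### The flow is an isomorphism of Lie algebroids -/

section FlowIsomorphism

set_option linter.unusedSectionVars false

variable {E : Type*} [NormedAddCommGroup E] [NormedSpace ℝ E] [FiniteDimensional ℝ E]
  {M : Type*} [TopologicalSpace M] [ChartedSpace E M] [IsManifold 𝓘(ℝ, E) ∞ M] [T2Space M]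
  {F : Type*} [NormedAddCommGroup F] [NormedSpace ℝ F]
  {A : M → Type*} [TopologicalSpace (TotalSpace F A)] [∀ x, TopologicalSpace (A x)]
  [∀ x, AddCommGroup (A x)] [∀ x, Module ℝ (A x)] [FiberBundle F A] [VectorBundle ℝ F A]
  {x y : M} {e e' : TotalSpace F A}

/-- A function that is smooth near `x` agrees near `x` with a global smooth function. -/
theorem exists_contMDiffMap_eventuallyEq {f : M → ℝ}
    (hf : ∀ᶠ z in 𝓝 x, ContMDiffAt 𝓘(ℝ, E) 𝓘(ℝ, ℝ) ∞ f z) :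
    ∃ g : C^∞⟮𝓘(ℝ, E), M; ℝ⟯, (g : M → ℝ) =ᶠ[𝓝 x] f := by
  obtain ⟨ψ, -, hψ⟩ := (SmoothBumpFunction.nhds_basis_tsupport (I := 𝓘(ℝ, E)) x).mem_iff.1 hf
  refine ⟨⟨fun z => ψ z • f z, contMDiff_of_tsupport fun z hz => ?_⟩, ?_⟩
  · exact ψ.contMDiff.contMDiffAt.smul (hψ (tsupport_smul_subset_left _ _ hz))
  · filter_upwards [ψ.eventuallyEq_one] with z hz
    change ψ z • f z = f z
    rw [hz, Pi.one_apply, one_smul]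

theorem dirDeriv_sum_smul {ι : Type*} (u : Finset ι) (f : M → ℝ) (c : ι → ℝ)
    (v : ι → TangentSpace 𝓘(ℝ, E) x) :
    dirDeriv f x (∑ i ∈ u, c i • v i) = ∑ i ∈ u, c i * dirDeriv f x (v i) := by
  refine (map_sum (mfderiv 𝓘(ℝ, E) 𝓘(ℝ, ℝ) f x) _ u).trans (Finset.sum_congr rfl fun i _ => ?_)
  exact map_smul (mfderiv 𝓘(ℝ, E) 𝓘(ℝ, ℝ) f x) (c i) (v i)

theorem sum_smulSection_apply {n : ℕ} (f : Fin n → C^∞⟮𝓘(ℝ, E), M; ℝ⟯)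
    (b : Fin n → Cₛ^∞⟮𝓘(ℝ, E); F, A⟯) (y : M) :
    (∑ i, smulSection (f i) (b i)) y = ∑ i, f i y • b i y :=
  ContMDiffSection.sum_apply _ _ _

theorem LieAlgebroid.bracket_sum_right (L : LieAlgebroid E F A) {n : ℕ}
    (a : Cₛ^∞⟮𝓘(ℝ, E); F, A⟯) (f : Fin n → C^∞⟮𝓘(ℝ, E), M; ℝ⟯)
    (b : Fin n → Cₛ^∞⟮𝓘(ℝ, E); F, A⟯) (y : M) :
    L.bracket a (∑ i, smulSection (f i) (b i)) y =
      ∑ i, (f i y • L.bracket a (b i) y + dirDeriv (f i) y (L.anchor y (a y)) • b i y) := by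
  rw [map_sum, ContMDiffSection.sum_apply]
  exact Finset.sum_congr rfl fun i _ => L.leibniz _ _ _ _

/-- The bracket of two linear combinations of sections with smooth coefficients. -/
theorem LieAlgebroid.bracket_sum_sum (L : LieAlgebroid E F A) {n₁ n₂ : ℕ}
    (f₁ : Fin n₁ → C^∞⟮𝓘(ℝ, E), M; ℝ⟯) (b₁ : Fin n₁ → Cₛ^∞⟮𝓘(ℝ, E); F, A⟯)
    (f₂ : Fin n₂ → C^∞⟮𝓘(ℝ, E), M; ℝ⟯) (b₂ : Fin n₂ → Cₛ^∞⟮𝓘(ℝ, E); F, A⟯) (y : M) :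
    L.bracket (∑ i, smulSection (f₁ i) (b₁ i)) (∑ j, smulSection (f₂ j) (b₂ j)) y =
      ∑ i, ∑ j, (f₁ i y * f₂ j y) • L.bracket (b₁ i) (b₂ j) y
      + ∑ j, dirDeriv (f₂ j) y (L.anchor y ((∑ i, smulSection (f₁ i) (b₁ i)) y)) • b₂ j y
      - ∑ i, dirDeriv (f₁ i) y (L.anchor y ((∑ j, smulSection (f₂ j) (b₂ j)) y)) • b₁ i y := by
  have hskew : ∀ c d : Cₛ^∞⟮𝓘(ℝ, E); F, A⟯, L.bracket c d y = -L.bracket d c y := fun c d => by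
    rw [L.bracket_skew c d]; rfl
  have h1 : ∀ i, dirDeriv (f₁ i) y (L.anchor y ((∑ j, smulSection (f₂ j) (b₂ j)) y)) =
      ∑ j, f₂ j y * dirDeriv (f₁ i) y (L.anchor y (b₂ j y)) := fun i => by
    rw [← dirDeriv_sum_smul, sum_smulSection_apply, map_sum]
    simp only [map_smul]
  have h2 : ∀ j, L.bracket (∑ i, smulSection (f₁ i) (b₁ i)) (b₂ j) y =
      ∑ i, (f₁ i y • L.bracket (b₁ i) (b₂ j) y
        - dirDeriv (f₁ i) y (L.anchor y (b₂ j y)) • b₁ i y) := fun j => by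
    rw [hskew, L.bracket_sum_right, ← Finset.sum_neg_distrib]
    refine Finset.sum_congr rfl fun i _ => ?_
    rw [hskew (b₁ i), smul_neg, neg_add, sub_eq_add_neg]
  rw [L.bracket_sum_right, Finset.sum_add_distrib, add_sub_right_comm]
  congr 1
  simp only [h1, h2, Finset.smul_sum, smul_sub, Finset.sum_sub_distrib, smul_smul, Finset.sum_smul]
  rw [Finset.sum_comm, Finset.sum_comm (f := fun j i => (f₂ j y * _) • b₁ i y)]
  simp only [mul_comm]

variable [ContMDiffVectorBundle ∞ F A 𝓘(ℝ, E)] [FiniteDimensional ℝ F]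
  {L : LieAlgebroid E F A} {D : LinearDerivation E F A} {t : ℝ}

/-- The integral curves of the linear vector field project to integral curves of the symbol. -/
theorem flowsTo_symbol_of_flowsTo_hat (hD : L.IsDerivation D) (h : FlowsTo D.hat t e e') :
    FlowsTo D.symbol t e.1 e'.1 := by
  have key : ∃ e'', FlowsTo D.hat t e e'' ∧ FlowsTo D.symbol t e.1 e''.1 := by
    refine h.propagate
      (P := fun t e => ∃ e'', FlowsTo D.hat t e e'' ∧ FlowsTo D.symbol t e.1 e''.1)
      (fun e₀ => ?_) ?_
    · obtain ⟨ε, hε, h⟩ := exists_smallTimes hD e₀.1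
      refine ⟨ε, hε, ?_⟩
      filter_upwards [((FiberBundle.continuous_proj F A).tendsto e₀).eventually h] with e he t ht
      have hr : D.IsRegularAt t e.1 := (he t ht).1
      exact ⟨_, hr.flowsTo_total L, by rw [hr.flow_hat_proj L]; exact hr.flowsTo_base⟩
    -- the curve of the symbol is concatenated over the same intermediate point, by uniqueness of
    -- the integral curves of the linear vector field
    · rintro s t e₀ e₁ h01 ⟨e₁', h1, h1'⟩ ⟨e₂, h2, h2'⟩
      obtain rfl : e₁ = e₁' := (L.flow_hat_eq D h01).symm.trans (L.flow_hat_eq D h1)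
      exact ⟨e₂, L.flowsTo_hat_trans D h01 h2, D.flowsTo_symbol_trans h1' h2'⟩
  obtain ⟨e'', h1, h2⟩ := key
  obtain rfl : e' = e'' := (L.flow_hat_eq D h).symm.trans (L.flow_hat_eq D h1)
  exact h2

theorem isOpen_flowDomainAt_symbol (hD : L.IsDerivation D) (t : ℝ) :
    IsOpen (flowDomainAt D.symbol t) := by
  rw [isOpen_iff_mem_nhds]
  rintro x ⟨y, hy⟩
  filter_upwards [eventually_isRegularAt hD hy] with z hz using ⟨_, hz.flowsTo_base⟩

theorem isVectorBundleMorphismOn_flow (hD : L.IsDerivation D) (t : ℝ) :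
    IsVectorBundleMorphismOn E E (flowDomainAt D.symbol t) (flowDomainAt D.symbol (-t))
      (flow D.hat t) (flow D.symbol t) where
  isOpen_source := isOpen_flowDomainAt_symbol hD t
  isOpen_target := isOpen_flowDomainAt_symbol hD (-t)
  mapsTo := by
    rintro x ⟨y, hy⟩
    exact ⟨x, (isRegularAt hD hy).flowsTo_base.symm⟩
  contMDiffOn_base := by
    rintro x ⟨y, hy⟩
    exact (isRegularAt hD hy).contMDiffAt_base.contMDiffWithinAt
  contMDiffOn_total := by
    rintro ⟨x, v⟩ ⟨y, hy⟩
    exact ((isRegularAt hD hy).contMDiffAt_total v).contMDiffWithinAt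
  fiberwise_linear := by
    rintro x ⟨y, hy⟩
    obtain ⟨S, hS⟩ := (isRegularAt hD hy).exists_flow_hat L
    exact ⟨S, fun v => (hS v).2⟩

/-- The derivative of a function along the anchor of a section can be computed after the flow. -/
theorem dirDeriv_anchor_of_relatedAt (hx : D.IsRegularAt t x) (hc : L.AnchorCompatibleAt D t x)
    {a b : Cₛ^∞⟮𝓘(ℝ, E); F, A⟯} (hab : D.RelatedAt t x a b) {f : M → ℝ}
    {g : C^∞⟮𝓘(ℝ, E), M; ℝ⟯} (hfg : ∀ᶠ z in 𝓝 x, g (flow D.symbol t z) = f z) :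
    dirDeriv g (flow D.symbol t x) (L.anchor _ (b (flow D.symbol t x))) =
      dirDeriv f x (L.anchor x (a x)) := by
  have h1 := hc (a x)
  rw [hab.self_of_nhds] at h1
  have h2 : L.anchor _ (b (flow D.symbol t x)) =
      mfderiv 𝓘(ℝ, E) 𝓘(ℝ, E) (flow D.symbol t) x (L.anchor x (a x)) := TotalSpace.mk_inj.1 h1
  have h3 := HasMFDerivAt.comp x
    (g.contMDiff.contMDiffAt.mdifferentiableAt (by simp)).hasMFDerivAt
    (hx.contMDiffAt_base.mdifferentiableAt (by simp)).hasMFDerivAt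
  have h4 : f =ᶠ[𝓝 x] g ∘ flow D.symbol t := hfg.mono fun z hz => hz.symm
  rw [h2]
  exact DFunLike.congr_fun (h3.congr_of_eventuallyEq h4).mfderiv.symm (L.anchor x (a x))

/-- Smooth functions can be pushed forward along the flow of the symbol, as germs. -/
theorem exists_pushforward_function (hD : L.IsDerivation D) (hxy : FlowsTo D.symbol t x y)
    {f : M → ℝ} (hf : ContMDiffOn 𝓘(ℝ, E) 𝓘(ℝ, ℝ) ∞ f (flowDomainAt D.symbol t)) :
    ∃ g : C^∞⟮𝓘(ℝ, E), M; ℝ⟯, ∀ᶠ z in 𝓝 x, g (flow D.symbol t z) = f z := by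
  have hx := eventually_isRegularAt hD hxy
  obtain ⟨g, hg⟩ := exists_contMDiffMap_eventuallyEq (E := E) (x := y)
    (f := fun w => f (flow D.symbol (-t) w)) (by
      filter_upwards [eventually_isRegularAt hD hxy.symm] with w hw
      have hmem : flow D.symbol (-t) w ∈ flowDomainAt D.symbol t :=
        ⟨w, by simpa using hw.flowsTo_base.symm⟩
      exact (hf.contMDiffAt ((isOpen_flowDomainAt_symbol hD t).mem_nhds hmem)).comp w
        hw.contMDiffAt_base)
  refine ⟨g, ?_⟩
  have hc : Tendsto (flow D.symbol t) (𝓝 x) (𝓝 y) := by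
    have := hx.self_of_nhds.contMDiffAt_base.continuousAt
    rwa [ContinuousAt, D.flow_symbol_eq hxy] at this
  filter_upwards [hc.eventually hg, hx] with z hz hz'
  rw [hz, D.flow_symbol_neg hz'.flowsTo_base]

/-- A decomposition `Φ ∘ a = ∑ᵢ fᵢ (bᵢ ∘ φ)` along the flow is realized, near a given point, by
global sections and by functions on the target. -/
theorem exists_relatedAt_sum (hD : L.IsDerivation D) (hxy : FlowsTo D.symbol t x y)
    {a : (x : M) → A x} (ha : SmoothSectionOn E F a (flowDomainAt D.symbol t)) {n : ℕ}
    {f : Fin n → M → ℝ} {b : Fin n → (y : M) → A y}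
    (hf : ∀ i, ContMDiffOn 𝓘(ℝ, E) 𝓘(ℝ, ℝ) ∞ (f i) (flowDomainAt D.symbol t))
    (hb : ∀ i, SmoothSectionOn E F (b i) (flowDomainAt D.symbol (-t)))
    (hab : ∀ x ∈ flowDomainAt D.symbol t, flow D.hat t ⟨x, a x⟩ =
      (⟨flow D.symbol t x, ∑ i, f i x • b i (flow D.symbol t x)⟩ : TotalSpace F A)) :
    ∃ (a' : Cₛ^∞⟮𝓘(ℝ, E); F, A⟯) (f' : Fin n → C^∞⟮𝓘(ℝ, E), M; ℝ⟯)
      (b' : Fin n → Cₛ^∞⟮𝓘(ℝ, E); F, A⟯),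
      (∀ᶠ z in 𝓝 x, a' z = a z) ∧ (∀ i, ∀ᶠ z in 𝓝 x, f' i (flow D.symbol t z) = f i z) ∧
      (∀ i, ∀ᶠ z in 𝓝 y, b' i z = b i z) ∧
      D.RelatedAt t x a' (∑ i, smulSection (f' i) (b' i)) := by
  have hU : flowDomainAt D.symbol t ∈ 𝓝 x :=
    (isOpen_flowDomainAt_symbol hD t).mem_nhds ⟨y, hxy⟩
  have hV : flowDomainAt D.symbol (-t) ∈ 𝓝 y :=
    (isOpen_flowDomainAt_symbol hD (-t)).mem_nhds ⟨x, hxy.symm⟩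
  obtain ⟨a', ha'⟩ := exists_section_eventuallyEq hU ha
  choose f' hf' using fun i => exists_pushforward_function hD hxy (hf i)
  choose b' hb' using fun i => exists_section_eventuallyEq hV (hb i)
  refine ⟨a', f', b', ha', hf', hb', ?_⟩
  have hc : Tendsto (flow D.symbol t) (𝓝 x) (𝓝 y) := by
    have := (isRegularAt hD hxy).contMDiffAt_base.continuousAt
    rwa [ContinuousAt, D.flow_symbol_eq hxy] at this
  filter_upwards [hU, ha', eventually_all.2 hf', hc.eventually (eventually_all.2 hb')]
    with z hz h1 h2 h3
  rw [h1, hab z hz, sum_smulSection_apply]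
  simp only [h2, h3]

theorem isMorphismOn_flow (hD : L.IsDerivation D) (t : ℝ) :
    L.IsMorphismOn L (flowDomainAt D.symbol t) (flowDomainAt D.symbol (-t))
      (flow D.hat t) (flow D.symbol t) where
  toIsVectorBundleMorphismOn := isVectorBundleMorphismOn_flow hD t
  anchor_comp := by
    rintro x ⟨y, hy⟩
    exact (compatibleAt hD hy).1
  bracket_comp := by
    rintro a₁ a₂ ha₁ ha₂ n₁ n₂ f₁ f₂ b₁ b₂ hf₁ hf₂ hb₁ hb₂ h₁ h₂ x ⟨y, hxy⟩
    obtain rfl := D.flow_symbol_eq hxy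
    have hr := isRegularAt hD hxy
    obtain ⟨hca, hcb⟩ := compatibleAt hD hxy
    obtain ⟨a₁', f₁', b₁', ha₁', hf₁', hb₁', hrel₁⟩ := exists_relatedAt_sum hD hxy ha₁ hf₁ hb₁ h₁
    obtain ⟨a₂', f₂', b₂', ha₂', hf₂', hb₂', hrel₂⟩ := exists_relatedAt_sum hD hxy ha₂ hf₂ hb₂ h₂
    rw [L.localBracket_eq ha₁' ha₂', hcb _ _ _ _ hrel₁ hrel₂, L.bracket_sum_sum,
      ← ha₁'.self_of_nhds, ← ha₂'.self_of_nhds]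
    simp only [dirDeriv_anchor_of_relatedAt hr hca hrel₁ (hf₂' _),
      dirDeriv_anchor_of_relatedAt hr hca hrel₂ (hf₁' _), (hf₁' _).self_of_nhds,
      (hf₂' _).self_of_nhds, (hb₁' _).self_of_nhds, (hb₂' _).self_of_nhds,
      L.localBracket_eq (hb₁' _) (hb₂' _)]

end FlowIsomorphism

end

theorem proposition7p2
    {E : Type*} [NormedAddCommGroup E] [NormedSpace ℝ E] [FiniteDimensional ℝ E]
    {M : Type*} [TopologicalSpace M] [ChartedSpace E M] [IsManifold 𝓘(ℝ, E) ∞ M]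
    [T2Space M] [SigmaCompactSpace M]
    {F : Type*} [NormedAddCommGroup F] [NormedSpace ℝ F] [FiniteDimensional ℝ F]
    {A : M → Type*} [TopologicalSpace (TotalSpace F A)] [∀ x, TopologicalSpace (A x)]
    [∀ x, AddCommGroup (A x)] [∀ x, Module ℝ (A x)] [FiberBundle F A] [VectorBundle ℝ F A]
    [ContMDiffVectorBundle ∞ F A 𝓘(ℝ, E)]
    (L : LieAlgebroid E F A) (D : LinearDerivation E F A) (hD : L.IsDerivation D) :
    flowDomain D.hat = {p : ℝ × TotalSpace F A | (p.1, p.2.1) ∈ flowDomain D.symbol} ∧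
    ∀ t : ℝ, L.IsIsomorphismOn L (flowDomainAt D.symbol t) (flowDomainAt D.symbol (-t))
      (flow D.hat t) (flow D.symbol t) := by
  refine ⟨?_, fun t => ⟨isMorphismOn_flow hD t, flow D.hat (-t), flow D.symbol (-t), ?_, ?_, ?_,
    ?_, ?_⟩⟩
  · ext ⟨t, e⟩
    constructor
    · rintro ⟨e', he'⟩
      exact ⟨e'.1, flowsTo_symbol_of_flowsTo_hat hD he'⟩
    · rintro ⟨y, hy⟩
      exact ⟨_, (isRegularAt hD hy).flowsTo_total L⟩
  · simpa only [neg_neg] using isMorphismOn_flow hD (-t)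
  · rintro x ⟨y, hy⟩
    exact D.flow_symbol_eq (isRegularAt hD hy).flowsTo_base.symm
  · rintro x ⟨y, hy⟩
    exact D.flow_symbol_eq (by simpa using (isRegularAt hD hy).flowsTo_base.symm)
  · rintro e ⟨y, hy⟩
    exact L.flow_hat_eq D ((isRegularAt hD hy).flowsTo_total L).symm
  · rintro e ⟨y, hy⟩
    exact L.flow_hat_eq D (by simpa using ((isRegularAt hD hy).flowsTo_total L).symm)
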